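/- A binary CSP instance $I$ has variables $x_1,\dots,x_n$ with finite domains $\mathcal D(x_i)$, and for each pair of distinct variables a relation $R_{ij}\subseteq \mathcal D(x_i)\times\mathcal D(x_j)$, where $R_{ji}$ is the transpose of $R_{ij}$. Let $e$ be the number of non-trivial constraints, i.e. of pairs $\{i,j\}$ with $R_{ij}\neq\mathcal D(x_i)\times\mathcal D(x_j)$, and $d$ the maximum size of the domains. $I$ is arc consistent if for all $i\ne j$ and $v\in\mathcal D(x_i)$ there is $w\in\mathcal D(x_j)$ with $(v,w)\in R_{ij}$. Write $b\xrightarrow{ij}a$ if for all $c\in\mathcal D(x_j)$, $(b,c)\in R_{ij}$ implies $(a,c)\in R_{ij}$. A value $b\in\mathcal D(x_i)$ is neighbourhood substitutable (NS) if there is $a\in\mathcal D(x_i)\setminus\{b\}$ with $b\xrightarrow{ij}a$ for all $j\neq i$. It is conditioned neighbourhood-substitutable (CNS) if for some $j\ne i$ and all $c\in\mathcal D(x_j)$ with $(b,c)\in R_{ij}$ there is $a\in\mathcal D(x_i)\setminus\{b\}$ such that $(a,c)\in R_{ij}$ and $b\xrightarrow{ik}a$ for all $k\notin\{i,j\}$.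 Theorem 3. There is an algorithm (one fixed program of a random access machine with unit-cost operations) which, given an arc-consistent binary CSP instance (as $n$, $d$, $e$, the table of its domains, and the list, in any order, of its non-trivial constraints as Boolean matrices), eliminates values one after the other until no NS or CNS value is left in the instance. Each eliminated value is, at the moment of its elimination, NS, or it is CNS and no value of the instance is NS. The algorithm outputs the reduced domains and the sequence of eliminations. On instances with $n\geq 1$ and $n=O(e)$ (for example, those in which every variable takes part in a non-trivial constraint) it runs in $O(ed^3)$ time and $O(ed^2)$ space, with words of $O(\log(ed))$ bits. That is, for every $K$ there is a constant $C$, depending only on $K$, such that on every arc-consistent instance with $1\le n\le Ke$ it takes at most $Ced^3$ steps on a machine with $Ced^2$ memory cells (including those of the input), each holding a natural number less than $C(ed)^C$. -/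

import Mathlib

/-! ### Binary CSP instances and substitution -/

/-- A binary CSP instance over the variables `x_0, …, x_{n-1}`, with values named by natural
numbers: a finite domain for each variable, and one relation for each pair of distinct variables,
the relation of `(j, i)` being the transpose of that of `(i, j)`. Only the entries `rel i j a b`
with `i ≠ j`, `a ∈ dom i`, `b ∈ dom j` are meaningful. -/
structure BinaryCSP (n : ℕ) where
  dom : Fin n → Finset ℕ
  rel : Fin n → Fin n → ℕ → ℕ → Bool
  rel_symm : ∀ i j, i ≠ j → ∀ a b, rel i j a b = rel j i b a

namespace BinaryCSP

variable {n : ℕ}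

/-- Every value has a support at every other variable. -/
def ArcConsistent (I : BinaryCSP n) : Prop :=
  ∀ i j, i ≠ j → ∀ a ∈ I.dom i, ∃ b ∈ I.dom j, I.rel i j a b = true

/-- `x_i` and `x_j` constrain each other: the constraint between them is not the complete
relation `D(x_i) × D(x_j)`. -/
def constraintGraph (I : BinaryCSP n) : SimpleGraph (Fin n) where
  Adj i j := i ≠ j ∧ ∃ a ∈ I.dom i, ∃ b ∈ I.dom j, I.rel i j a b = false
  symm := ⟨fun i j h => by
    obtain ⟨hij, a, ha, b, hb, hab⟩ := h
    exact ⟨hij.symm, b, hb, a, ha, by rw [← I.rel_symm i j hij]; exact hab⟩⟩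
  loopless := ⟨fun _ h => h.1 rfl⟩

/-- `e`, the number of non-trivial constraints (unordered pairs of variables). -/
noncomputable def numConstraints (I : BinaryCSP n) : ℕ := I.constraintGraph.edgeSet.ncard

/-- `d`, the maximum size of the domains. -/
def maxDom (I : BinaryCSP n) : ℕ := Finset.univ.sup fun i => (I.dom i).card

/-- `a` can be substituted for `b` in every tuple `(b, c) ∈ R_ij`. -/
def Arrow (I : BinaryCSP n) (i j : Fin n) (b a : ℕ) : Prop :=
  ∀ c ∈ I.dom j, I.rel i j b c = true → I.rel i j a c = true

/-- `b ∈ D(x_i)` is neighbourhood substitutable by another value `a ∈ D(x_i)`. -/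
def NS (I : BinaryCSP n) (i : Fin n) (b : ℕ) : Prop :=
  b ∈ I.dom i ∧ ∃ a ∈ I.dom i, a ≠ b ∧ ∀ j, j ≠ i → I.Arrow i j b a

/-- `b ∈ D(x_i)` is conditioned neighbourhood-substitutable (conditioned by some `x_j`). -/
def CNS (I : BinaryCSP n) (i : Fin n) (b : ℕ) : Prop :=
  b ∈ I.dom i ∧ ∃ j, j ≠ i ∧ ∀ c ∈ I.dom j, I.rel i j b c = true →
    ∃ a ∈ I.dom i, a ≠ b ∧ I.rel i j a c = true ∧ ∀ k, k ≠ i → k ≠ j → I.Arrow i k b a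

/-- The instance in which the value `b` has been eliminated from `D(x_i)`. -/
def eliminate (I : BinaryCSP n) (i : Fin n) (b : ℕ) : BinaryCSP n where
  dom := Function.update I.dom i ((I.dom i).erase b)
  rel := I.rel
  rel_symm := I.rel_symm

/-- One elimination by CNS with priority given to neighbourhood substitution: `b` is eliminated
from `D(x_i)` by neighbourhood substitution, or by CNS at a moment when no value of any domain can
be eliminated by neighbourhood substitution. -/
def PriorityStep (I : BinaryCSP n) (i : Fin n) (b : ℕ) : Prop :=
  I.NS i b ∨ (I.CNS i b ∧ ∀ i' b', ¬ I.NS i' b')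

/-- `I.EliminatesTo l J`: the eliminations listed in `l`, applied one after the other to `I`, each
of them a legitimate prioritised elimination in the instance reached so far, lead to `J`. -/
def EliminatesTo (I : BinaryCSP n) : List (Fin n × ℕ) → BinaryCSP n → Prop
  | [], J => J = I
  | (i, b) :: l, J => I.PriorityStep i b ∧ (I.eliminate i b).EliminatesTo l J

/-- No further elimination by (neighbourhood substitution or) CNS is possible. -/
def Converged (I : BinaryCSP n) : Prop :=
  ∀ i b, ¬ I.NS i b ∧ ¬ I.CNS i b

/-- The values are named by numbers below `d`. -/
def Numbered (I : BinaryCSP n) : Prop := ∀ i, I.dom i ⊆ Finset.range I.maxDom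

/-- `es` lists the non-trivial constraints: each unordered pair of variables that constrain each
other occurs exactly once, in one of its two orientations, the order being arbitrary. -/
def IsConstraintList (I : BinaryCSP n) (es : List (Fin n × Fin n)) : Prop :=
  (es.map fun p => s(p.1, p.2)).Nodup ∧
    ∀ z : Sym2 (Fin n), z ∈ es.map (fun p => s(p.1, p.2)) ↔ z ∈ I.constraintGraph.edgeSet

end BinaryCSP

/-! ### A random access machine -/

namespace RAM

/-- The binary operations of the machine (subtraction is truncated, comparisons give `0` or `1`). -/
inductive BinOp
  | add | sub | mul | lt | eq

def BinOp.apply : BinOp → ℕ → ℕ → ℕ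
  | .add, x, y => x + y
  | .sub, x, y => x - y
  | .mul, x, y => x * y
  | .lt, x, y => if x < y then 1 else 0
  | .eq, x, y => if x = y then 1 else 0

/-- Expressions: literals, registers, the contents of an addressed memory cell, operations. -/
inductive Expr
  | lit (k : ℕ)
  | reg (r : ℕ)
  | load (addr : Expr)
  | op (o : BinOp) (x y : Expr)

/-- Programs. A program is a finite object, so it uses finitely many registers. -/
inductive Program
  | skip
  | set (r : ℕ) (x : Expr)
  | store (addr x : Expr)
  | seq (p q : Program)
  | ite (x : Expr) (p q : Program)
  | while (x : Expr) (p : Program)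

structure State where
  reg : ℕ → ℕ
  mem : ℕ → ℕ

/-- The size of a machine: it has the memory cells `0, …, cells - 1`, and its words are the
numbers `0, …, words - 1`. -/
structure Size where
  cells : ℕ
  words : ℕ

/-- The value of an expression; undefined if an address outside the memory is read, or if a
number that is not a word of the machine turns up. -/
def Expr.eval (L : Size) (s : State) : Expr → Option ℕ
  | .lit k => if k < L.words then some k else none
  | .reg r => if s.reg r < L.words then some (s.reg r) else none
  | .load a => (a.eval L s).bind fun v =>
      if v < L.cells ∧ s.mem v < L.words then some (s.mem v) else none
  | .op o x y => (x.eval L s).bind fun v => (y.eval L s).bind fun w =>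
      if o.apply v w < L.words then some (o.apply v w) else none

/-- The time to evaluate an expression: one unit per literal, register access, memory access and
operation. -/
def Expr.cost : Expr → ℕ
  | .lit _ => 1
  | .reg _ => 1
  | .load a => a.cost + 1
  | .op _ x y => x.cost + y.cost + 1

/-- `Exec L p s t s'`: on a machine of size `L`, the program `p` started in the state `s` halts
after `t` units of time in the state `s'`, without ever leaving the memory or the range of the
words. A test or jump, an assignment and a store each take one unit, plus the time to evaluate the
expressions; a test succeeds when its value is not `0`. -/
inductive Exec (L : Size) : Program → State → ℕ → State → Prop
  | skip (s : State) : Exec L .skip s 1 s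
  | set (s : State) (r : ℕ) (x : Expr) (v : ℕ) (hx : x.eval L s = some v) :
      Exec L (.set r x) s (x.cost + 1) ⟨Function.update s.reg r v, s.mem⟩
  | store (s : State) (a x : Expr) (k v : ℕ) (ha : a.eval L s = some k) (hk : k < L.cells)
      (hx : x.eval L s = some v) :
      Exec L (.store a x) s (a.cost + x.cost + 1) ⟨s.reg, Function.update s.mem k v⟩
  | seq (p q : Program) (s s₁ s₂ : State) (t₁ t₂ : ℕ) (hp : Exec L p s t₁ s₁)
      (hq : Exec L q s₁ t₂ s₂) : Exec L (.seq p q) s (t₁ + t₂) s₂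
  | iteTrue (x : Expr) (p q : Program) (s s₁ : State) (v t : ℕ) (hx : x.eval L s = some v)
      (hv : v ≠ 0) (hp : Exec L p s t s₁) : Exec L (.ite x p q) s (x.cost + 1 + t) s₁
  | iteFalse (x : Expr) (p q : Program) (s s₁ : State) (t : ℕ) (hx : x.eval L s = some 0)
      (hq : Exec L q s t s₁) : Exec L (.ite x p q) s (x.cost + 1 + t) s₁
  | whileTrue (x : Expr) (p : Program) (s s₁ s₂ : State) (v t₁ t₂ : ℕ)
      (hx : x.eval L s = some v) (hv : v ≠ 0) (hp : Exec L p s t₁ s₁)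
      (hw : Exec L (.while x p) s₁ t₂ s₂) :
      Exec L (.while x p) s (x.cost + 1 + t₁ + t₂) s₂
  | whileFalse (x : Expr) (p : Program) (s : State) (hx : x.eval L s = some 0) :
      Exec L (.while x p) s (x.cost + 1) s

end RAM

/-! ### Input and output -/

namespace BinaryCSP

variable {n : ℕ}

/-- The domains as a table of bits, row after row: `n` rows of length `d`. -/
def domTable (dom : Fin n → Finset ℕ) (d : ℕ) : List ℕ :=
  (List.finRange n).flatMap fun i =>
    (List.range d).map fun a => if a ∈ dom i then 1 else 0

/-- A constraint: its two variables, followed by its `d × d` matrix of bits, row after row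
(with `0` wherever one of the two values does not belong to the domain). -/
def constraintBlock (I : BinaryCSP n) (p : Fin n × Fin n) : List ℕ :=
  (p.1 : ℕ) :: (p.2 : ℕ) :: (List.range I.maxDom).flatMap fun a =>
    (List.range I.maxDom).map fun b =>
      if a ∈ I.dom p.1 ∧ b ∈ I.dom p.2 ∧ I.rel p.1 p.2 a b = true then 1 else 0

/-- The input: `n`, `d`, `e`, the table of the domains, and the non-trivial constraints. -/
def encode (I : BinaryCSP n) (es : List (Fin n × Fin n)) : List ℕ :=
  n :: I.maxDom :: es.length :: (domTable I.dom I.maxDom ++ es.flatMap I.constraintBlock)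

/-- The initial state: the input stands at the beginning of the memory, and everything else
is `0`. -/
def initState (I : BinaryCSP n) (es : List (Fin n × Fin n)) : RAM.State where
  reg _ := 0
  mem k := (I.encode es).getD k 0

/-- The state `s` of a machine with `cells` memory cells records the list `l` of eliminations and
the instance `J` obtained by them from `I`: the table of the domains has been updated in place, and
`l` is stored, as `variable, value, variable, value, …`, in consecutive cells of the memory, from
the address given by register `0` on, its length being given by register `1`. -/
def Records (I J : BinaryCSP n) (l : List (Fin n × ℕ)) (s : RAM.State) (cells : ℕ) : Prop :=
  (∀ (i : Fin n) (a : ℕ), a < I.maxDom →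
    s.mem (3 + (i : ℕ) * I.maxDom + a) = if a ∈ J.dom i then 1 else 0) ∧
  s.reg 1 = l.length ∧ s.reg 0 + 2 * l.length ≤ cells ∧
  ∀ (t : ℕ) (ht : t < l.length),
    s.mem (s.reg 0 + 2 * t) = (l[t].1 : ℕ) ∧ s.mem (s.reg 0 + 2 * t + 1) = l[t].2

/-- On a machine of size `L`, whose memory holds the input `I`, the program `P` halts within time
`T` and has then applied eliminations by CNS, with priority given to neighbourhood substitution,
until convergence. -/
def AppliesCNS (P : RAM.Program) (I : BinaryCSP n) (es : List (Fin n × Fin n)) (L : RAM.Size)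
    (T : ℕ) : Prop :=
  (I.encode es).length ≤ L.cells ∧
  ∃ (t : ℕ) (s : RAM.State) (l : List (Fin n × ℕ)) (J : BinaryCSP n),
    t ≤ T ∧ RAM.Exec L P (I.initState es) t s ∧
    I.EliminatesTo l J ∧ J.Converged ∧ I.Records J l s L.cells

end BinaryCSP

/-! Orient every non-trivial constraint both ways, and let `f` range over the `2e` results, leading
from `x_i` to `x_j`. For values `b`, `a` of `x_i` let `W f b a` be the number of surviving `c` in
`D(x_j)` compatible with `b` but not with `a`, and `N i b a` the number of `f` at `x_i` with `W f b
a ≠ 0`. Substituting `a` for `b` is harmless in `f` iff `W f b a = 0`, so a surviving `a ≠ b` makes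
`b` NS iff `N i b a = 0`. If `N i b a = 1`, a single constraint stands in the way; its number is
read off from the sum `SM` of the numbers of all obstructing constraints, which has one term. Hence,
when no value is NS, `b` is CNS conditioned by `f` iff every surviving `c` compatible with `b` is
compatible with a surviving `a` whose only obstruction is `f`; `S f b c` counts these `a`. Trivial
constraints need not be considered as conditions: in an arc-consistent instance a CNS value
conditioned by one is already NS, and eliminations preserve arc consistency.

Domains only shrink, so `W` and `N` only decrease. A triple `(i, b, a)` requires `O(d)` work on `S`
only when `N` reaches 1 or 0 (or starts there), in total `O(nd³)`. Eliminating `c` from `x_j`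
concerns the `O(d²)` pairs `(b, a)` of each of the `deg j` constraints at `x_j`, in total `O(ed³)`.
A condition `(f, b)` can become true only when some `S f b c` grows or the destination of `f` loses
a value; at these moments it is pushed on a stack of candidates. Another stack, which has priority,
holds the triples with `N = 0`. Candidates are tested when they reach the top; when both stacks are
empty nothing can be eliminated.

On the machine, `Rel` splits the memory into arrays and `WP` is a program logic with one resource,
credits. A credit pays for 300 units of time and lets the entries grow by one, which bounds the
words; each stack entry owns `32 * D` credits (`tok`), which bounds the stacks. The potential `pot`
and the weight `sumA` do the amortisation. `Net.Inv` is the invariant of the counters, kept by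
`event_spec`, `decW_spec` and `elim_spec`; `init_spec` and `mainLoop_spec` give the run,
`Models.priorityStep` the legitimacy of each elimination, `Models.not_NS` and `Models.not_CNS` the
convergence. -/

namespace RAM

/-! ### Evaluation of bounded expressions -/

/-- The value of an expression on a machine without bounds. -/
def Expr.tot (σ : State) : Expr → ℕ
  | .lit k => k
  | .reg r => σ.reg r
  | .load a => σ.mem (a.tot σ)
  | .op o x y => o.apply (x.tot σ) (y.tot σ)

/-- Every address that is read belongs to the memory. -/
def Expr.Safe (L : Size) (σ : State) : Expr → Prop
  | .lit _ => True
  | .reg _ => True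
  | .load a => a.Safe L σ ∧ a.tot σ < L.cells
  | .op _ x y => x.Safe L σ ∧ y.Safe L σ

/-- All literals of the expression are at most `100`. -/
def Expr.smallLits : Expr → Bool
  | .lit k => decide (k ≤ 100)
  | .reg _ => true
  | .load a => a.smallLits
  | .op _ x y => x.smallLits && y.smallLits

/-- The exponent grows exactly as `Expr.cost` does. The spare factor `Z ≥ 2` absorbs a sum of two
terms. -/
theorem BinOp.apply_le_pow {Z a b : ℕ} (hZ : 2 ≤ Z) (o : BinOp)
    {v w : ℕ} (hv : v ≤ Z ^ a) (hw : w ≤ Z ^ b) : o.apply v w ≤ Z ^ (a + b + 1) := by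
  have h1 : 1 ≤ Z ^ a := Nat.one_le_pow _ _ (by omega)
  have h2 : 1 ≤ Z ^ b := Nat.one_le_pow _ _ (by omega)
  have hab : Z ^ (a + b + 1) = Z ^ a * Z ^ b * Z := by rw [pow_succ, pow_add]
  rw [hab]
  have h4 : 1 ≤ Z ^ a * Z ^ b := Nat.mul_pos h1 h2
  have h5 : Z ^ a ≤ Z ^ a * Z ^ b := Nat.le_mul_of_pos_right _ h2
  have h6 : Z ^ b ≤ Z ^ a * Z ^ b := Nat.le_mul_of_pos_left _ h1
  have h7 : Z ^ a * Z ^ b * 2 ≤ Z ^ a * Z ^ b * Z := Nat.mul_le_mul_left _ hZ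
  cases o
  · simp only [BinOp.apply]; omega
  · simp only [BinOp.apply]; omega
  · simp only [BinOp.apply]
    have := Nat.mul_le_mul hv hw
    omega
  · simp only [BinOp.apply]; split <;> omega
  · simp only [BinOp.apply]; split <;> omega

/-- Overflow is excluded syntactically: a value is at most `Z` to the power of the cost of its
expression, and `Z ^ 128` is a word. Only the addresses remain to be checked, which is `Expr.Safe`.
-/
theorem Expr.eval_eq_tot {L : Size} {σ : State} {Z : ℕ} (hZ : 100 ≤ Z) (hreg : ∀ r, σ.reg r ≤ Z)
    (hmem : ∀ x, σ.mem x ≤ Z) (hW : Z ^ 128 < L.words) (x : Expr) (hl : x.smallLits = true)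
    (hs : x.Safe L σ) (hc : x.cost ≤ 128) :
    x.eval L σ = some (x.tot σ) ∧ x.tot σ ≤ Z ^ x.cost := by
  have hpow : ∀ m, m ≤ 128 → Z ^ m < L.words := fun m hm =>
    lt_of_le_of_lt (Nat.pow_le_pow_right (by omega) hm) hW
  have hone : Z < L.words := by simpa using hpow 1 (by norm_num)
  induction x with
  | lit k =>
    simp only [Expr.smallLits, decide_eq_true_eq] at hl
    simp only [Expr.eval, Expr.tot, Expr.cost, pow_one]
    exact ⟨if_pos (by omega), by omega⟩
  | reg r =>
    have := hreg r
    simp only [Expr.eval, Expr.tot, Expr.cost, pow_one]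
    exact ⟨if_pos (by omega), by omega⟩
  | load a ih =>
    simp only [Expr.cost] at hc
    obtain ⟨h1, h2⟩ := ih hl hs.1 (by omega)
    have h3 := hmem (a.tot σ)
    refine ⟨?_, ?_⟩
    · simp only [Expr.eval, h1, Option.bind_some, Expr.tot]
      exact if_pos ⟨hs.2, by omega⟩
    · simp only [Expr.tot]
      exact h3.trans (Nat.le_self_pow (by simp [Expr.cost]) Z)
  | op o x y ihx ihy =>
    simp only [Expr.cost] at hc
    simp only [Expr.smallLits, Bool.and_eq_true] at hl
    obtain ⟨h1, h2⟩ := ihx hl.1 hs.1 (by omega)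
    obtain ⟨h3, h4⟩ := ihy hl.2 hs.2 (by omega)
    have h5 := BinOp.apply_le_pow (by omega : 2 ≤ Z) o h2 h4
    have h6 := hpow _ hc
    refine ⟨?_, h5⟩
    simp only [Expr.eval, h1, h3, Option.bind_some, Expr.tot]
    exact if_pos (by omega)

/-! ### The memory layout and the abstract state -/

/-- The parameters of a run: the numbers `n`, `d`, `e` of the input, the bits `blk p x` of its
constraints, the length `M` of the work arrays, the number `K` of credits, and the machine. -/
structure Layout where
  n : ℕ
  d : ℕ
  e : ℕ
  M : ℕ
  K : ℕ
  blk : ℕ → ℕ → ℕ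
  L : Size

namespace Layout

/-- `D` exceeds `d` by one, so that the entry `(x, 0, 0)` exists even if all domains are empty;
tables with a single index are kept in such entries. `F` suffices to index by variables and by
oriented constraints. `low` dominates all addresses, the sums of constraint numbers and the
literals. -/
def D (Λ : Layout) : ℕ := Λ.d + 1
def F (Λ : Layout) : ℕ := Λ.n + 2 * Λ.e
def base (Λ : Layout) : ℕ := (3 + Λ.n * Λ.d) + Λ.e * (2 + Λ.d * Λ.d)
def low (Λ : Layout) : ℕ := Λ.base + 33 * Λ.M + (2 * Λ.e + 1) * (2 * Λ.e + 1) + 100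

/-- Entries start below `low` and grow by at most one per credit, so `low + K` bounds them during
the whole run; the exponent 128 is the maximal cost of an expression. -/
structure Valid (Λ : Layout) : Prop where
  len : Λ.F * Λ.D * Λ.D ≤ Λ.M
  cells : Λ.base + 33 * Λ.M ≤ Λ.L.cells
  words : (Λ.low + Λ.K) ^ 128 < Λ.L.words

end Layout

/-- The memory seen as a family of separate arrays. -/
structure ASt where
  reg : ℕ → ℕ
  alv : ℕ → ℕ → ℕ
  out : ℕ → ℕ
  a3 : ℕ → ℕ → ℕ → ℕ → ℕ
  a1 : ℕ → ℕ → ℕ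

def upd2 (f : ℕ → ℕ → ℕ) (x y v : ℕ) : ℕ → ℕ → ℕ :=
  fun x' y' => if x' = x ∧ y' = y then v else f x' y'

def upd3 (f : ℕ → ℕ → ℕ → ℕ) (x y z v : ℕ) : ℕ → ℕ → ℕ → ℕ :=
  fun x' y' z' => if x' = x ∧ y' = y ∧ z' = z then v else f x' y' z'

namespace ASt

def setReg (s : ASt) (r v : ℕ) : ASt := { s with reg := Function.update s.reg r v }
def setAlv (s : ASt) (x y v : ℕ) : ASt := { s with alv := upd2 s.alv x y v }
def setOut (s : ASt) (x v : ℕ) : ASt := { s with out := Function.update s.out x v }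
def set3 (s : ASt) (α x y z v : ℕ) : ASt :=
  { s with a3 := Function.update s.a3 α (upd3 (s.a3 α) x y z v) }
def set1 (s : ASt) (α x v : ℕ) : ASt :=
  { s with a1 := Function.update s.a1 α (Function.update (s.a1 α) x v) }

end ASt

/-- The registers that do not hold a parameter of the layout. -/
def userReg (r : ℕ) : Bool := decide (r = 1) || decide (7 ≤ r)

/-- The concrete state `σ`, all of whose entries are at most `Z`, implements `s`. -/
structure Rel (Λ : Layout) (σ : State) (s : ASt) (Z : ℕ) : Prop where
  r0 : σ.reg 0 = Λ.base + 32 * Λ.M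
  r2 : σ.reg 2 = Λ.base
  r3 : σ.reg 3 = Λ.D
  r4 : σ.reg 4 = Λ.n
  r5 : σ.reg 5 = Λ.d
  r6 : σ.reg 6 = Λ.e
  reg : ∀ r, userReg r = true → σ.reg r = s.reg r
  alv : ∀ x < Λ.n, ∀ y < Λ.d, σ.mem (3 + (x * Λ.d + y)) = s.alv x y
  blk : ∀ p < Λ.e, ∀ x < 2 + Λ.d * Λ.d,
    σ.mem ((3 + Λ.n * Λ.d) + (p * (2 + Λ.d * Λ.d) + x)) = Λ.blk p x
  a3 : ∀ α < 16, ∀ x < Λ.F, ∀ y < Λ.D, ∀ z < Λ.D,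
    σ.mem (Λ.base + (32 * ((x * Λ.D + y) * Λ.D + z) + α)) = s.a3 α x y z
  a1 : ∀ α < 16, ∀ x < Λ.M, σ.mem (Λ.base + (32 * x + (16 + α))) = s.a1 α x
  out : ∀ x < Λ.M, σ.mem ((Λ.base + 32 * Λ.M) + x) = s.out x
  regB : ∀ r, σ.reg r ≤ Z
  memB : ∀ x, σ.mem x ≤ Z
  lo : Λ.low ≤ Z

/-! ### Expressions over the abstract state -/

inductive AExpr
  | lit (k : ℕ)
  | n
  | d
  | e
  | reg (r : ℕ)
  | alv (x y : AExpr)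
  | blk (p x : AExpr)
  | a3 (α : ℕ) (x y z : AExpr)
  | a1 (α : ℕ) (x : AExpr)
  | op (o : BinOp) (x y : AExpr)

namespace AExpr

def alvAddr (x y : Expr) : Expr :=
  .op .add (.lit 3) (.op .add (.op .mul x (.reg 5)) y)

def blkAddr (p x : Expr) : Expr :=
  .op .add (.op .add (.lit 3) (.op .mul (.reg 4) (.reg 5)))
    (.op .add (.op .mul p (.op .add (.lit 2) (.op .mul (.reg 5) (.reg 5)))) x)

def a3Addr (α : ℕ) (x y z : Expr) : Expr :=
  .op .add (.reg 2) (.op .add (.op .mul (.lit 32)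
    (.op .add (.op .mul (.op .add (.op .mul x (.reg 3)) y) (.reg 3)) z)) (.lit α))

def a1Addr (α : ℕ) (x : Expr) : Expr :=
  .op .add (.reg 2) (.op .add (.op .mul (.lit 32) x) (.lit (16 + α)))

def comp : AExpr → Expr
  | lit k => .lit k
  | n => .reg 4
  | d => .reg 5
  | e => .reg 6
  | reg r => .reg r
  | alv x y => .load (alvAddr x.comp y.comp)
  | blk p x => .load (blkAddr p.comp x.comp)
  | a3 α x y z => .load (a3Addr α x.comp y.comp z.comp)
  | a1 α x => .load (a1Addr α x.comp)
  | op o x y => .op o x.comp y.comp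

def val (Λ : Layout) (s : ASt) : AExpr → ℕ
  | lit k => k
  | n => Λ.n
  | d => Λ.d
  | e => Λ.e
  | reg r => s.reg r
  | alv x y => s.alv (x.val Λ s) (y.val Λ s)
  | blk p x => Λ.blk (p.val Λ s) (x.val Λ s)
  | a3 α x y z => s.a3 α (x.val Λ s) (y.val Λ s) (z.val Λ s)
  | a1 α x => s.a1 α (x.val Λ s)
  | op o x y => o.apply (x.val Λ s) (y.val Λ s)

/-- All array accesses are within the bounds of the arrays. -/
def Ok (Λ : Layout) (s : ASt) : AExpr → Prop
  | alv x y => (x.Ok Λ s ∧ y.Ok Λ s) ∧ x.val Λ s < Λ.n ∧ y.val Λ s < Λ.d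
  | blk p x => (p.Ok Λ s ∧ x.Ok Λ s) ∧ p.val Λ s < Λ.e ∧ x.val Λ s < 2 + Λ.d * Λ.d
  | a3 _ x y z => (x.Ok Λ s ∧ y.Ok Λ s ∧ z.Ok Λ s) ∧
      x.val Λ s < Λ.F ∧ y.val Λ s < Λ.D ∧ z.val Λ s < Λ.D
  | a1 _ x => x.Ok Λ s ∧ x.val Λ s < Λ.M
  | op _ x y => x.Ok Λ s ∧ y.Ok Λ s
  | _ => True

def wf : AExpr → Bool
  | lit k => decide (k ≤ 100)
  | n => true
  | d => true
  | e => true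
  | reg r => userReg r
  | alv x y => x.wf && y.wf
  | blk p x => p.wf && x.wf
  | a3 α x y z => decide (α < 16) && (x.wf && (y.wf && z.wf))
  | a1 α x => decide (α < 16) && x.wf
  | op _ x y => x.wf && y.wf

def fits (x : AExpr) : Bool := x.wf && decide (x.comp.cost ≤ 128)

/-- A syntactic check that the value is no larger than the entries of the state. -/
def flat : AExpr → Bool
  | op .add _ _ => false
  | op .mul _ _ => false
  | op .sub x _ => x.flat
  | _ => true

/-- A syntactic check that the value exceeds the entries of the state by at most one. -/
def tame : AExpr → Bool
  | op .add x (lit 1) => x.flat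
  | x => x.flat

theorem comp_smallLits {x : AExpr} (h : x.wf = true) : x.comp.smallLits = true := by
  induction x <;>
    simp_all [wf, comp, Expr.smallLits, alvAddr, blkAddr, a3Addr, a1Addr] <;> omega

end AExpr

theorem Layout.index_lt {Λ : Layout} (hΛ : Λ.Valid) {x y z : ℕ} (hx : x < Λ.F) (hy : y < Λ.D)
    (hz : z < Λ.D) : (x * Λ.D + y) * Λ.D + z < Λ.M := by
  have h1 : (x + 1) * Λ.D ≤ Λ.F * Λ.D := Nat.mul_le_mul_right _ hx
  have h2 : (x * Λ.D + y + 1) * Λ.D ≤ Λ.F * Λ.D * Λ.D := Nat.mul_le_mul_right _ (by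
    rw [add_mul] at h1; omega)
  have h3 := hΛ.len
  rw [add_mul] at h2
  omega

theorem index_inj {D x y z x' y' z' : ℕ} (hy : y < D) (hz : z < D) (hy' : y' < D) (hz' : z' < D)
    (h : (x * D + y) * D + z = (x' * D + y') * D + z') : x = x' ∧ y = y' ∧ z = z' := by
  have key : ∀ a b a' b' : ℕ, b < D → b' < D → a * D + b = a' * D + b' → a = a' ∧ b = b' := by
    intro a b a' b' hb hb' hab
    have hD : 0 < D := by omega
    have h1 : (a * D + b) / D = a := by
      rw [mul_comm, Nat.mul_add_div hD, Nat.div_eq_of_lt hb, add_zero]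
    have h2 : (a' * D + b') / D = a' := by
      rw [mul_comm, Nat.mul_add_div hD, Nat.div_eq_of_lt hb', add_zero]
    have h3 : a = a' := by rw [← h1, ← h2, hab]
    subst h3
    exact ⟨rfl, by omega⟩
  obtain ⟨h1, h2⟩ := key _ _ _ _ hz hz' h
  obtain ⟨h3, h4⟩ := key _ _ _ _ hy hy' h1
  exact ⟨h3, h4, h2⟩

theorem mul_add_lt_mul {n d x y : ℕ} (hx : x < n) (hy : y < d) : x * d + y < n * d := by
  have h1 : (x + 1) * d ≤ n * d := Nat.mul_le_mul_right _ hx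
  rw [add_mul] at h1
  omega

namespace AExpr

/-- `Ok` puts every address inside its array, and all arrays lie below `base + 33 * M`; no bound on
the values is needed for this. -/
theorem comp_spec {Λ : Layout} (hΛ : Λ.Valid) {σ : State} {s : ASt} {Z : ℕ} (hR : Rel Λ σ s Z)
    (x : AExpr) (hw : x.wf = true) (ho : x.Ok Λ s) :
    x.comp.tot σ = x.val Λ s ∧ x.comp.Safe Λ.L σ := by
  have hcells := hΛ.cells
  induction x with
  | lit k => exact ⟨rfl, trivial⟩
  | n => exact ⟨hR.r4, trivial⟩
  | d => exact ⟨hR.r5, trivial⟩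
  | e => exact ⟨hR.r6, trivial⟩
  | reg r => exact ⟨hR.reg r hw, trivial⟩
  | alv x y ihx ihy =>
    simp only [wf, Bool.and_eq_true] at hw
    obtain ⟨⟨ox, oy⟩, bx, bY⟩ := ho
    obtain ⟨tx, sx⟩ := ihx hw.1 ox
    obtain ⟨ty, sy⟩ := ihy hw.2 oy
    have h := mul_add_lt_mul bx bY
    simp only [comp, Expr.tot, Expr.Safe, alvAddr, BinOp.apply, tx, ty, hR.r5, val]
    refine ⟨hR.alv _ bx _ bY, ⟨trivial, ⟨sx, trivial⟩, sy⟩, ?_⟩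
    simp only [Layout.base] at hcells
    omega
  | blk p x ihx ihy =>
    simp only [wf, Bool.and_eq_true] at hw
    obtain ⟨⟨ox, oy⟩, bx, bY⟩ := ho
    obtain ⟨tx, sx⟩ := ihx hw.1 ox
    obtain ⟨ty, sy⟩ := ihy hw.2 oy
    have h := mul_add_lt_mul bx bY
    simp only [comp, Expr.tot, Expr.Safe, blkAddr, BinOp.apply, tx, ty, hR.r5, hR.r4, val]
    refine ⟨hR.blk _ bx _ bY, ?_⟩
    simp only [Layout.base] at hcells
    refine ⟨⟨⟨trivial, trivial, trivial⟩, ⟨sx, trivial, trivial, trivial⟩, sy⟩, ?_⟩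
    omega
  | a3 α x y z ihx ihy ihz =>
    simp only [wf, Bool.and_eq_true, decide_eq_true_eq] at hw
    obtain ⟨⟨ox, oy, oz⟩, bx, bY, bz⟩ := ho
    obtain ⟨tx, sx⟩ := ihx hw.2.1 ox
    obtain ⟨ty, sy⟩ := ihy hw.2.2.1 oy
    obtain ⟨tz, sz⟩ := ihz hw.2.2.2 oz
    have h := Λ.index_lt hΛ bx bY bz
    simp only [comp, Expr.tot, Expr.Safe, a3Addr, BinOp.apply, tx, ty, tz, hR.r2, hR.r3, val]
    refine ⟨hR.a3 _ hw.1 _ bx _ bY _ bz, ?_⟩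
    refine ⟨⟨trivial, ⟨trivial, ⟨⟨⟨sx, trivial⟩, sy⟩, trivial⟩, sz⟩, trivial⟩, ?_⟩
    omega
  | a1 α x ihx =>
    simp only [wf, Bool.and_eq_true, decide_eq_true_eq] at hw
    obtain ⟨ox, bx⟩ := ho
    obtain ⟨tx, sx⟩ := ihx hw.2 ox
    simp only [comp, Expr.tot, Expr.Safe, a1Addr, BinOp.apply, tx, hR.r2, val]
    refine ⟨hR.a1 _ hw.1 _ bx, ?_⟩
    refine ⟨⟨trivial, ⟨trivial, sx⟩, trivial⟩, ?_⟩
    omega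
  | op o x y ihx ihy =>
    simp only [wf, Bool.and_eq_true] at hw
    obtain ⟨tx, sx⟩ := ihx hw.1 ho.1
    obtain ⟨ty, sy⟩ := ihy hw.2 ho.2
    exact ⟨by simp only [comp, Expr.tot, val, tx, ty], sx, sy⟩

theorem comp_eval {Λ : Layout} (hΛ : Λ.Valid) {σ : State} {s : ASt} {Z : ℕ} (hR : Rel Λ σ s Z)
    (hZ : Z ≤ Λ.low + Λ.K) (x : AExpr) (hf : x.fits = true) (ho : x.Ok Λ s) :
    x.comp.eval Λ.L σ = some (x.val Λ s) := by
  simp only [fits, Bool.and_eq_true, decide_eq_true_eq] at hf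
  obtain ⟨h1, h2⟩ := comp_spec hΛ hR x hf.1 ho
  have h100 : 100 ≤ Z := le_trans (by simp [Layout.low]) hR.lo
  have hw : Z ^ 128 < Λ.L.words := lt_of_le_of_lt (Nat.pow_le_pow_left hZ _) hΛ.words
  rw [← h1]
  exact (Expr.eval_eq_tot h100 hR.regB hR.memB hw _ (comp_smallLits hf.1) h2 hf.2).1

/-- Reads, truncated subtractions and comparisons cannot exceed the bound on the entries; only
additions and multiplications can. -/
theorem val_le_of_flat {Λ : Layout} (hΛ : Λ.Valid) {σ : State} {s : ASt} {Z : ℕ}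
    (hR : Rel Λ σ s Z) (x : AExpr) (hw : x.wf = true) (hf : x.flat = true) (ho : x.Ok Λ s) :
    x.val Λ s ≤ Z := by
  have h100 : 100 ≤ Z := le_trans (by simp [Layout.low]) hR.lo
  obtain ⟨h1, -⟩ := comp_spec hΛ hR x hw ho
  induction x with
  | lit k => simp only [wf, decide_eq_true_eq] at hw; simp only [val]; omega
  | n => rw [← h1]; exact hR.regB _
  | d => rw [← h1]; exact hR.regB _
  | e => rw [← h1]; exact hR.regB _
  | reg r => rw [← h1]; exact hR.regB _
  | alv x y => rw [← h1]; exact hR.memB _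
  | blk p x => rw [← h1]; exact hR.memB _
  | a3 α x y z => rw [← h1]; exact hR.memB _
  | a1 α x => rw [← h1]; exact hR.memB _
  | op o x y ihx ihy =>
    simp only [wf, Bool.and_eq_true] at hw
    cases o with
    | add => simp [flat] at hf
    | mul => simp [flat] at hf
    | sub =>
      have := ihx hw.1 (by simpa [flat] using hf) ho.1 (comp_spec hΛ hR x hw.1 ho.1).1
      simp only [val, BinOp.apply]; omega
    | lt => simp only [val, BinOp.apply]; split <;> omega
    | eq => simp only [val, BinOp.apply]; split <;> omega

theorem val_le_of_tame {Λ : Layout} (hΛ : Λ.Valid) {σ : State} {s : ASt} {Z : ℕ}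
    (hR : Rel Λ σ s Z) (x : AExpr) (hw : x.wf = true) (hf : x.tame = true) (ho : x.Ok Λ s) :
    x.val Λ s ≤ Z + 1 := by
  unfold tame at hf
  split at hf
  · rename_i x
    simp only [wf, Bool.and_eq_true] at hw
    have := val_le_of_flat hΛ hR x hw.1 hf ho.1
    simp only [val, BinOp.apply]; omega
  · have := val_le_of_flat hΛ hR _ hw hf ho
    omega

end AExpr

/-! ### Statements without control flow -/

/-- The program `p` leads from the abstract state `s` to `s'` in at most 300 units of time. -/
def Prim (Λ : Layout) (p : Program) (s s' : ASt) : Prop :=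
  ∀ σ Z, Rel Λ σ s Z → Z ≤ Λ.low + Λ.K →
    ∃ t σ', t ≤ 300 ∧ Exec Λ.L p σ t σ' ∧ Rel Λ σ' s' (Z + 1)

theorem fits_cost {x : AExpr} (h : x.fits = true) : x.comp.cost ≤ 128 := by
  simp only [AExpr.fits, Bool.and_eq_true, decide_eq_true_eq] at h
  exact h.2

theorem fits_wf {x : AExpr} (h : x.fits = true) : x.wf = true := by
  simp only [AExpr.fits, Bool.and_eq_true] at h
  exact h.1

theorem Rel.setReg {Λ : Layout} {σ : State} {s : ASt} {Z v r : ℕ} (hR : Rel Λ σ s Z)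
    (hr : userReg r = true) (hv : v ≤ Z + 1) :
    Rel Λ ⟨Function.update σ.reg r v, σ.mem⟩ (s.setReg r v) (Z + 1) := by
  have hr' : r = 1 ∨ 7 ≤ r := by simpa [userReg] using hr
  have hne : ∀ i, i ≠ r → Function.update σ.reg r v i = σ.reg i := fun i hi =>
    Function.update_of_ne hi _ _
  constructor
  · exact (hne 0 (by omega)).trans hR.r0
  · exact (hne 2 (by omega)).trans hR.r2
  · exact (hne 3 (by omega)).trans hR.r3
  · exact (hne 4 (by omega)).trans hR.r4
  · exact (hne 5 (by omega)).trans hR.r5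
  · exact (hne 6 (by omega)).trans hR.r6
  · intro i hi
    simp only [ASt.setReg, Function.update_apply, hR.reg i hi]
  · exact hR.alv
  · exact hR.blk
  · exact hR.a3
  · exact hR.a1
  · exact hR.out
  · intro i
    have := hR.regB i
    simp only [Function.update_apply]
    split <;> omega
  · intro x; exact (hR.memB x).trans (Nat.le_succ _)
  · exact hR.lo.trans (Nat.le_succ _)

/-- For a value that is small for a reason which `tame` does not see, such as the number of a
reversed constraint. -/
theorem Prim.set_of_le {Λ : Layout} (hΛ : Λ.Valid) {r : ℕ} {x : AExpr} {s : ASt}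
    (hr : userReg r = true) (hf : x.fits = true) (ho : x.Ok Λ s) (hv : x.val Λ s ≤ Λ.low) :
    Prim Λ (.set r x.comp) s (s.setReg r (x.val Λ s)) := by
  intro σ Z hR hZ
  have h1 := fits_cost hf
  exact ⟨_, _, by omega, Exec.set σ r x.comp _ (AExpr.comp_eval hΛ hR hZ x hf ho),
    hR.setReg hr (by have := hR.lo; omega)⟩

theorem Prim.set {Λ : Layout} (hΛ : Λ.Valid) {r : ℕ} {x : AExpr} {s : ASt}
    (hr : userReg r = true) (hf : x.fits = true) (ht : x.tame = true) (ho : x.Ok Λ s) :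
    Prim Λ (.set r x.comp) s (s.setReg r (x.val Λ s)) := by
  intro σ Z hR hZ
  have h1 := fits_cost hf
  exact ⟨_, _, by omega, Exec.set σ r x.comp _ (AExpr.comp_eval hΛ hR hZ x hf ho),
    hR.setReg hr (AExpr.val_le_of_tame hΛ hR x (fits_wf hf) ht ho)⟩

/-- `hblk` says that the store misses the constraint blocks, which therefore never change; only the
other arrays have to be compared. -/
theorem Rel.setMem {Λ : Layout} {σ : State} {s s' : ASt} {Z v k : ℕ} (hR : Rel Λ σ s Z)
    (hv : v ≤ Z + 1) (hreg : s'.reg = s.reg)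
    (halv : ∀ x < Λ.n, ∀ y < Λ.d,
      Function.update σ.mem k v (3 + (x * Λ.d + y)) = s'.alv x y)
    (hblk : (3 + Λ.n * Λ.d) ≤ k → Λ.base ≤ k)
    (ha3 : ∀ α < 16, ∀ x < Λ.F, ∀ y < Λ.D, ∀ z < Λ.D,
      Function.update σ.mem k v (Λ.base + (32 * ((x * Λ.D + y) * Λ.D + z) + α)) = s'.a3 α x y z)
    (ha1 : ∀ α < 16, ∀ x < Λ.M,
      Function.update σ.mem k v (Λ.base + (32 * x + (16 + α))) = s'.a1 α x)
    (hout : ∀ x < Λ.M, Function.update σ.mem k v ((Λ.base + 32 * Λ.M) + x) = s'.out x) :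
    Rel Λ ⟨σ.reg, Function.update σ.mem k v⟩ s' (Z + 1) := by
  refine ⟨hR.r0, hR.r2, hR.r3, hR.r4, hR.r5, hR.r6, ?_, halv, ?_, ha3, ha1, hout, ?_, ?_, ?_⟩
  · intro r hr; rw [hreg]; exact hR.reg r hr
  · intro p hp x hx
    have h := mul_add_lt_mul hp hx
    rw [← hR.blk p hp x hx]
    refine Function.update_of_ne (fun h' => ?_) _ _
    have h2 : Λ.base = (3 + Λ.n * Λ.d) + Λ.e * (2 + Λ.d * Λ.d) := rfl
    omega
  · intro r; exact (hR.regB r).trans (Nat.le_succ _)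
  · intro x
    have := hR.memB x
    simp only [Function.update_apply]
    split <;> omega
  · exact hR.lo.trans (Nat.le_succ _)

def st3 (α : ℕ) (x y z v : AExpr) : Program := .store (AExpr.a3Addr α x.comp y.comp z.comp) v.comp
def st1 (α : ℕ) (x v : AExpr) : Program := .store (AExpr.a1Addr α x.comp) v.comp
def stAlv (x y v : AExpr) : Program := .store (AExpr.alvAddr x.comp y.comp) v.comp
def stOut (x v : AExpr) : Program := .store (.op .add (.reg 0) x.comp) v.comp

/-- Evaluation of an address, from the evaluation of the corresponding read. -/
theorem addr_eval {Λ : Layout} (hΛ : Λ.Valid) {σ : State} {s : ASt} {Z : ℕ} (hR : Rel Λ σ s Z)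
    (hZ : Z ≤ Λ.low + Λ.K) {a : Expr} (x : AExpr) (hx : x.comp = .load a) (hf : x.fits = true)
    (ho : x.Ok Λ s) : a.eval Λ.L σ = some (a.tot σ) ∧ a.tot σ < Λ.L.cells := by
  have hw := fits_wf hf
  have hc := fits_cost hf
  obtain ⟨-, h2⟩ := AExpr.comp_spec hΛ hR x hw ho
  have h100 : 100 ≤ Z := le_trans (by simp [Layout.low]) hR.lo
  have hW : Z ^ 128 < Λ.L.words := lt_of_le_of_lt (Nat.pow_le_pow_left hZ _) hΛ.words
  have hl := AExpr.comp_smallLits hw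
  rw [hx] at h2 hc hl
  simp only [Expr.cost] at hc
  exact ⟨(Expr.eval_eq_tot h100 hR.regB hR.memB hW a hl h2.1 (by omega)).1, h2.2⟩

theorem Layout.base_eq (Λ : Layout) :
    Λ.base = (3 + Λ.n * Λ.d) + Λ.e * (2 + Λ.d * Λ.d) := rfl

/-- A store into a three-dimensional array of a value not much larger than the entries. -/
theorem Prim.st3_of_bound {Λ : Layout} (hΛ : Λ.Valid) {α : ℕ} {x y z v : AExpr} {s : ASt}
    (hf : (AExpr.a3 α x y z).fits = true) (ho : (AExpr.a3 α x y z).Ok Λ s)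
    (hfv : v.fits = true) (hov : v.Ok Λ s)
    (hv : ∀ σ Z, Rel Λ σ s Z → v.val Λ s ≤ Z + 1) :
    Prim Λ (st3 α x y z v) s (s.set3 α (x.val Λ s) (y.val Λ s) (z.val Λ s) (v.val Λ s)) := by
  intro σ Z hR hZ
  have h1 := fits_cost hf
  have h2 := fits_cost hfv
  simp only [AExpr.comp, Expr.cost] at h1
  obtain ⟨ea, la⟩ := addr_eval hΛ hR hZ _ rfl hf ho
  have ev := AExpr.comp_eval hΛ hR hZ v hfv hov
  refine ⟨_, _, by omega, Exec.store σ _ v.comp _ _ ea la ev, ?_⟩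
  have hw := fits_wf hf
  simp only [AExpr.wf, Bool.and_eq_true, decide_eq_true_eq] at hw
  obtain ⟨⟨ox, oy, oz⟩, bx, bY, bz⟩ := ho
  have tx := (AExpr.comp_spec hΛ hR x hw.2.1 ox).1
  have ty := (AExpr.comp_spec hΛ hR y hw.2.2.1 oy).1
  have tz := (AExpr.comp_spec hΛ hR z hw.2.2.2 oz).1
  have hk : (AExpr.a3Addr α x.comp y.comp z.comp).tot σ = Λ.base +
      (32 * ((x.val Λ s * Λ.D + y.val Λ s) * Λ.D + z.val Λ s) + α) := by
    simp only [AExpr.a3Addr, Expr.tot, BinOp.apply, tx, ty, tz, hR.r2, hR.r3]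
  rw [hk]
  have hlt := Λ.index_lt hΛ bx bY bz
  have hb := Λ.base_eq
  refine hR.setMem (hv σ Z hR) rfl ?_ ?_ ?_ ?_ ?_
  · intro x' hx' y' hy'
    have := mul_add_lt_mul hx' hy'
    rw [Function.update_of_ne (by omega)]
    exact hR.alv x' hx' y' hy'
  · omega
  · intro α' hα' x' hx' y' hy' z' hz'
    by_cases hαα : α' = α
    · subst hαα
      simp only [ASt.set3, Function.update_self, upd3]
      by_cases h : x' = x.val Λ s ∧ y' = y.val Λ s ∧ z' = z.val Λ s
      · obtain ⟨rfl, rfl, rfl⟩ := h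
        simp
      · rw [if_neg h, Function.update_of_ne, hR.a3 _ hα' _ hx' _ hy' _ hz']
        intro h'
        exact h (index_inj hy' hz' bY bz (by omega))
    -- The arrays are interleaved with period 32, so different arrays occupy different residues.
    · simp only [ASt.set3, Function.update_of_ne hαα]
      rw [Function.update_of_ne (by omega), hR.a3 _ hα' _ hx' _ hy' _ hz']
  · intro α' hα' x' hx'
    rw [Function.update_of_ne (by omega), hR.a1 _ hα' _ hx']; rfl
  · intro x' hx'
    rw [Function.update_of_ne (by omega), hR.out _ hx']; rfl

theorem Prim.st3 {Λ : Layout} (hΛ : Λ.Valid) {α : ℕ} {x y z v : AExpr} {s : ASt}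
    (hf : (AExpr.a3 α x y z).fits = true) (ho : (AExpr.a3 α x y z).Ok Λ s)
    (hfv : v.fits = true) (ht : v.tame = true) (hov : v.Ok Λ s) :
    Prim Λ (st3 α x y z v) s (s.set3 α (x.val Λ s) (y.val Λ s) (z.val Λ s) (v.val Λ s)) :=
  Prim.st3_of_bound hΛ hf ho hfv hov fun _ _ hR =>
    AExpr.val_le_of_tame hΛ hR v (fits_wf hfv) ht hov

theorem Prim.st1 {Λ : Layout} (hΛ : Λ.Valid) {α : ℕ} {x v : AExpr} {s : ASt}
    (hf : (AExpr.a1 α x).fits = true) (ho : (AExpr.a1 α x).Ok Λ s)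
    (hfv : v.fits = true) (ht : v.tame = true) (hov : v.Ok Λ s) :
    Prim Λ (st1 α x v) s (s.set1 α (x.val Λ s) (v.val Λ s)) := by
  intro σ Z hR hZ
  have h1 := fits_cost hf
  have h2 := fits_cost hfv
  simp only [AExpr.comp, Expr.cost] at h1
  obtain ⟨ea, la⟩ := addr_eval hΛ hR hZ _ rfl hf ho
  have ev := AExpr.comp_eval hΛ hR hZ v hfv hov
  refine ⟨_, _, by omega, Exec.store σ _ v.comp _ _ ea la ev, ?_⟩
  have hw := fits_wf hf
  simp only [AExpr.wf, Bool.and_eq_true, decide_eq_true_eq] at hw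
  obtain ⟨ox, bx⟩ := ho
  have tx := (AExpr.comp_spec hΛ hR x hw.2 ox).1
  have hk : (AExpr.a1Addr α x.comp).tot σ = Λ.base + (32 * x.val Λ s + (16 + α)) := by
    simp only [AExpr.a1Addr, Expr.tot, BinOp.apply, tx, hR.r2]
  rw [hk]
  have hb := Λ.base_eq
  refine hR.setMem (AExpr.val_le_of_tame hΛ hR v (fits_wf hfv) ht hov) rfl ?_ ?_ ?_ ?_ ?_
  · intro x' hx' y' hy'
    have := mul_add_lt_mul hx' hy'
    rw [Function.update_of_ne (by omega)]
    exact hR.alv x' hx' y' hy'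
  · omega
  · intro α' hα' x' hx' y' hy' z' hz'
    rw [Function.update_of_ne (by omega), hR.a3 _ hα' _ hx' _ hy' _ hz']; rfl
  · intro α' hα' x' hx'
    by_cases hαα : α' = α
    · subst hαα
      simp only [ASt.set1, Function.update_self]
      by_cases h : x' = x.val Λ s
      · subst h; simp
      · rw [Function.update_of_ne h, Function.update_of_ne (by omega), hR.a1 _ hα' _ hx']
    · simp only [ASt.set1, Function.update_of_ne hαα]
      rw [Function.update_of_ne (by omega), hR.a1 _ hα' _ hx']
  · intro x' hx'
    rw [Function.update_of_ne (by omega), hR.out _ hx']; rfl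

theorem Prim.stAlv {Λ : Layout} (hΛ : Λ.Valid) {x y v : AExpr} {s : ASt}
    (hf : (AExpr.alv x y).fits = true) (ho : (AExpr.alv x y).Ok Λ s)
    (hfv : v.fits = true) (ht : v.tame = true) (hov : v.Ok Λ s) :
    Prim Λ (stAlv x y v) s (s.setAlv (x.val Λ s) (y.val Λ s) (v.val Λ s)) := by
  intro σ Z hR hZ
  have h1 := fits_cost hf
  have h2 := fits_cost hfv
  simp only [AExpr.comp, Expr.cost] at h1
  obtain ⟨ea, la⟩ := addr_eval hΛ hR hZ _ rfl hf ho
  have ev := AExpr.comp_eval hΛ hR hZ v hfv hov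
  refine ⟨_, _, by omega, Exec.store σ _ v.comp _ _ ea la ev, ?_⟩
  have hw := fits_wf hf
  simp only [AExpr.wf, Bool.and_eq_true] at hw
  obtain ⟨⟨ox, oy⟩, bx, bY⟩ := ho
  have tx := (AExpr.comp_spec hΛ hR x hw.1 ox).1
  have ty := (AExpr.comp_spec hΛ hR y hw.2 oy).1
  have hk : (AExpr.alvAddr x.comp y.comp).tot σ = 3 + (x.val Λ s * Λ.d + y.val Λ s) := by
    simp only [AExpr.alvAddr, Expr.tot, BinOp.apply, tx, ty, hR.r5]
  rw [hk]
  have hlt := mul_add_lt_mul bx bY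
  have hb := Λ.base_eq
  refine hR.setMem (AExpr.val_le_of_tame hΛ hR v (fits_wf hfv) ht hov) rfl ?_ ?_ ?_ ?_ ?_
  · intro x' hx' y' hy'
    simp only [ASt.setAlv, upd2]
    by_cases h : x' = x.val Λ s ∧ y' = y.val Λ s
    · obtain ⟨rfl, rfl⟩ := h
      simp
    · rw [if_neg h, Function.update_of_ne, hR.alv _ hx' _ hy']
      intro h'
      have hd : 0 < Λ.d := by omega
      have h3 : (x' * Λ.d + y') / Λ.d = x' := by
        rw [mul_comm, Nat.mul_add_div hd, Nat.div_eq_of_lt hy', add_zero]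
      have h4 : (x.val Λ s * Λ.d + y.val Λ s) / Λ.d = x.val Λ s := by
        rw [mul_comm, Nat.mul_add_div hd, Nat.div_eq_of_lt bY, add_zero]
      have h5 : x' * Λ.d + y' = x.val Λ s * Λ.d + y.val Λ s := by omega
      have h6 : x' = x.val Λ s := by rw [← h3, ← h4, h5]
      refine h ⟨h6, ?_⟩
      rw [h6] at h5
      omega
  · omega
  · intro α' hα' x' hx' y' hy' z' hz'
    rw [Function.update_of_ne (by omega), hR.a3 _ hα' _ hx' _ hy' _ hz']; rfl
  · intro α' hα' x' hx'
    rw [Function.update_of_ne (by omega), hR.a1 _ hα' _ hx']; rfl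
  · intro x' hx'
    rw [Function.update_of_ne (by omega), hR.out _ hx']; rfl

/-- The list of eliminations is never read by the program, so there is no read expression from which
to take the address. It is evaluated directly, and the bound 100 leaves room for adding register 0.
-/
theorem Prim.stOut {Λ : Layout} (hΛ : Λ.Valid) {x v : AExpr} {s : ASt}
    (hf : x.fits = true) (hf' : x.comp.cost ≤ 100) (ho : x.Ok Λ s) (hx : x.val Λ s < Λ.M)
    (hfv : v.fits = true) (ht : v.tame = true) (hov : v.Ok Λ s) :
    Prim Λ (stOut x v) s (s.setOut (x.val Λ s) (v.val Λ s)) := by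
  intro σ Z hR hZ
  have h2 := fits_cost hfv
  have hw := fits_wf hf
  obtain ⟨tx, sx⟩ := AExpr.comp_spec hΛ hR x hw ho
  have h100 : 100 ≤ Z := le_trans (by simp [Layout.low]) hR.lo
  have hW : Z ^ 128 < Λ.L.words := lt_of_le_of_lt (Nat.pow_le_pow_left hZ _) hΛ.words
  have hk : (Expr.op .add (.reg 0) x.comp).tot σ = (Λ.base + 32 * Λ.M) + x.val Λ s := by
    simp only [Expr.tot, BinOp.apply, tx, hR.r0]
  have ea := (Expr.eval_eq_tot h100 hR.regB hR.memB hW (.op .add (.reg 0) x.comp)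
    (by simp [Expr.smallLits, AExpr.comp_smallLits hw]) ⟨trivial, sx⟩
    (by simp only [Expr.cost]; omega)).1
  have la : (Expr.op .add (.reg 0) x.comp).tot σ < Λ.L.cells := by
    have := hΛ.cells; rw [hk]; omega
  have ev := AExpr.comp_eval hΛ hR hZ v hfv hov
  refine ⟨_, _, ?_, Exec.store σ _ v.comp _ _ ea la ev, ?_⟩
  · simp only [Expr.cost]; omega
  rw [hk]
  have hb := Λ.base_eq
  refine hR.setMem (AExpr.val_le_of_tame hΛ hR v (fits_wf hfv) ht hov) rfl ?_ ?_ ?_ ?_ ?_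
  · intro x' hx' y' hy'
    have := mul_add_lt_mul hx' hy'
    rw [Function.update_of_ne (by omega)]
    exact hR.alv x' hx' y' hy'
  · omega
  · intro α' hα' x' hx' y' hy' z' hz'
    have := Λ.index_lt hΛ hx' hy' hz'
    rw [Function.update_of_ne (by omega), hR.a3 _ hα' _ hx' _ hy' _ hz']; rfl
  · intro α' hα' x' hx'
    rw [Function.update_of_ne (by omega), hR.a1 _ hα' _ hx']; rfl
  · intro x' hx'
    simp only [ASt.setOut]
    by_cases h : x' = x.val Λ s
    · subst h; simp
    · rw [Function.update_of_ne h, Function.update_of_ne (by omega), hR.out _ hx']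

end RAM

namespace RAM

/-! ### Programs with credits -/

/-- Started in the abstract state `s` with `k` credits, the program `p` halts in a state `s'` with
`k'` credits left such that `Q s' k'`; a credit pays for 300 units of time. -/
def WP (Λ : Layout) (p : Program) (Q : ASt → ℕ → Prop) (s : ASt) (k : ℕ) : Prop :=
  k ≤ Λ.K → ∀ σ Z, Rel Λ σ s Z → Z + k ≤ Λ.low + Λ.K →
    ∃ t σ' s' k', Exec Λ.L p σ t σ' ∧ t + 300 * k' ≤ 300 * k ∧ Rel Λ σ' s' (Z + (k - k')) ∧ Q s' k'

theorem Rel.mono {Λ : Layout} {σ : State} {s : ASt} {Z Z' : ℕ} (hR : Rel Λ σ s Z) (h : Z ≤ Z') :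
    Rel Λ σ s Z' :=
  { hR with
    regB := fun r => (hR.regB r).trans h
    memB := fun x => (hR.memB x).trans h
    lo := hR.lo.trans h }

namespace WP

variable {Λ : Layout} {p q : Program} {Q Q' : ASt → ℕ → Prop} {s s' : ASt} {k : ℕ}

/-- Makes the global budget available in a proof; it is what limits the height of the stacks. -/
theorem of_le (h : k ≤ Λ.K → WP Λ p Q s k) : WP Λ p Q s k := fun hk => h hk hk

theorem imp (h : WP Λ p Q s k) (hQ : ∀ s' k', k' ≤ k → Q s' k' → Q' s' k') : WP Λ p Q' s k := by
  intro hk σ Z hR hZ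
  obtain ⟨t, σ', s', k', h1, h2, h3, h4⟩ := h hk σ Z hR hZ
  exact ⟨t, σ', s', k', h1, h2, h3, hQ _ _ (by omega) h4⟩

theorem prim (hk : 1 ≤ k) (h : Prim Λ p s s') (hQ : Q s' (k - 1)) : WP Λ p Q s k := by
  intro _ σ Z hR hZ
  obtain ⟨t, σ', h1, h2, h3⟩ := h σ Z hR (by omega)
  exact ⟨t, σ', s', k - 1, h2, by omega, h3.mono (by omega), hQ⟩

theorem skip (hk : 1 ≤ k) (hQ : Q s (k - 1)) : WP Λ .skip Q s k := by
  intro _ σ Z hR hZ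
  exact ⟨1, σ, s, k - 1, Exec.skip σ, by omega, hR.mono (by omega), hQ⟩

theorem seq (h : WP Λ p (fun s' k' => WP Λ q Q s' k') s k) : WP Λ (.seq p q) Q s k := by
  intro hk σ Z hR hZ
  obtain ⟨t, σ₁, s₁, k₁, h1, h2, h3, h4⟩ := h hk σ Z hR hZ
  obtain ⟨t', σ₂, s₂, k₂, h5, h6, h7, h8⟩ := h4 (by omega) σ₁ _ h3 (by omega)
  exact ⟨_, σ₂, s₂, k₂, Exec.seq _ _ _ _ _ _ _ h1 h5, by omega, h7.mono (by omega), h8⟩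

theorem prim_seq (hk : 1 ≤ k) (h : Prim Λ p s s') (hQ : WP Λ q Q s' (k - 1)) :
    WP Λ (.seq p q) Q s k := seq (prim hk h hQ)

theorem ite (hΛ : Λ.Valid) {x : AExpr} (hk : 1 ≤ k) (hf : x.fits = true) (ho : x.Ok Λ s)
    (h1 : x.val Λ s ≠ 0 → WP Λ p Q s (k - 1)) (h0 : x.val Λ s = 0 → WP Λ q Q s (k - 1)) :
    WP Λ (.ite x.comp p q) Q s k := by
  intro hK σ Z hR hZ
  have hc := fits_cost hf
  have he := AExpr.comp_eval hΛ hR (by omega) x hf ho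
  by_cases hx : x.val Λ s = 0
  · obtain ⟨t, σ', s', k', h2, h3, h4, h5⟩ := h0 hx (by omega) σ Z hR (by omega)
    rw [hx] at he
    exact ⟨_, σ', s', k', Exec.iteFalse _ _ _ _ _ _ he h2, by omega, h4.mono (by omega), h5⟩
  · obtain ⟨t, σ', s', k', h2, h3, h4, h5⟩ := h1 hx (by omega) σ Z hR (by omega)
    exact ⟨_, σ', s', k', Exec.iteTrue _ _ _ _ _ _ _ he hx h2, by omega, h4.mono (by omega), h5⟩

/-- The rule for loops. Termination follows from the consumption of credits. -/
theorem while_rule (hΛ : Λ.Valid) {x : AExpr} (hf : x.fits = true) (Inv : ASt → ℕ → Prop)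
    (h : ∀ s k, Inv s k → 1 ≤ k ∧ x.Ok Λ s ∧ (x.val Λ s ≠ 0 → WP Λ p Inv s (k - 1)) ∧
      (x.val Λ s = 0 → Q s (k - 1)))
    (hs : Inv s k) : WP Λ (.while x.comp p) Q s k := by
  have hc := fits_cost hf
  induction k using Nat.strong_induction_on generalizing s with
  | _ k ih =>
    intro hK σ Z hR hZ
    obtain ⟨hk, ho, h1, h0⟩ := h s k hs
    have he := AExpr.comp_eval hΛ hR (by omega) x hf ho
    by_cases hx : x.val Λ s = 0
    · rw [hx] at he
      exact ⟨_, σ, s, k - 1, Exec.whileFalse _ _ _ he, by omega, hR.mono (by omega), h0 hx⟩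
    · obtain ⟨t, σ₁, s₁, k₁, h2, h3, h4, h5⟩ := h1 hx (by omega) σ Z hR (by omega)
      obtain ⟨t', σ₂, s₂, k₂, h6, h7, h8, h9⟩ :=
        ih k₁ (by omega) h5 (by omega) σ₁ _ h4 (by omega)
      exact ⟨_, σ₂, s₂, k₂, Exec.whileTrue _ _ _ _ _ _ _ _ he hx h2 h6, by omega,
        h8.mono (by omega), h9⟩

end WP

/-- `for r = 0, …, N - 1 do p`. -/
def forTo (r : ℕ) (N : AExpr) (p : Program) : Program :=
  .seq (.set r (AExpr.lit 0).comp) (.while (AExpr.op .lt (.reg r) N).comp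
    (.seq p (.set r (AExpr.op .add (.reg r) (.lit 1)).comp)))

/-- The rule for counting loops whose body spends `c` credits besides those freed by a decrease
of the potential `φ`. -/
theorem WP.forTo {Λ : Layout} (hΛ : Λ.Valid) {r : ℕ} {N : AExpr} {p : Program} {s : ASt} {k : ℕ}
    (φ : ASt → ℕ) (c B : ℕ) (Inv : ℕ → ASt → Prop)
    (hr : userReg r = true) (hf : (AExpr.op .lt (.reg r) N).fits = true)
    (hN : ∀ s, N.val Λ s = B ∧ N.Ok Λ s)
    (hφ : ∀ s v, φ (s.setReg r v) = φ s)
    (hbody : ∀ i s k, i < B → s.reg r = i → Inv i s → φ s + c ≤ k →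
      WP Λ p (fun s' k' => s'.reg r = i ∧ Inv (i + 1) (s'.setReg r (i + 1)) ∧
        φ s' + k ≤ φ s + c + k') s k)
    (h0 : Inv 0 (s.setReg r 0)) (hk : φ s + (B * (c + 2) + 2) ≤ k) :
    WP Λ (forTo r N p) (fun s' k' => s'.reg r = B ∧ Inv B s' ∧
      φ s' + k ≤ φ s + (B * (c + 2) + 2) + k') s k := by
  have hfr : (AExpr.op .add (.reg r) (.lit 1)).fits = true := by
    simp [AExpr.fits, AExpr.wf, AExpr.comp, Expr.cost, hr]
  refine WP.prim_seq (by omega) (Prim.set hΛ hr (by rfl) (by rfl) trivial) ?_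
  -- The invariant holds two inequalities: the credits left suffice for the remaining rounds, and
  -- not too many have been spent. A round pays two credits besides its body, for the test and the
  -- increment.
  refine WP.while_rule hΛ hf (fun s' k' => s'.reg r ≤ B ∧ Inv (s'.reg r) s' ∧
    φ s' + (B - s'.reg r) * (c + 2) + 1 ≤ k' ∧
    φ s' + k + (B - s'.reg r) * (c + 2) ≤ φ s + (B * (c + 2) + 1) + k') ?_ ?_
  · rintro s₁ k₁ ⟨hi, hInv, hk1, hk2⟩
    refine ⟨by omega, ⟨trivial, (hN s₁).2⟩, ?_, ?_⟩
    · intro hlt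
      have hlt' : s₁.reg r < B := by
        by_contra hge
        apply hlt
        simp only [AExpr.val, BinOp.apply, (hN s₁).1]
        exact if_neg hge
      obtain ⟨m, hm⟩ : ∃ m, B - s₁.reg r = m + 1 := ⟨B - s₁.reg r - 1, by omega⟩
      have hm' : B - (s₁.reg r + 1) = m := by omega
      rw [hm, add_mul, one_mul] at hk1 hk2
      have hb := hbody _ s₁ (k₁ - 1) hlt' rfl hInv (by omega)
      refine WP.seq (WP.imp hb ?_)
      rintro s₂ k₂ hk₂ ⟨h1, h2, h3⟩
      refine WP.prim (by omega) (Prim.set hΛ hr hfr (by rfl) ⟨trivial, trivial⟩) ?_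
      have hv : (AExpr.op .add (.reg r) (.lit 1)).val Λ s₂ = s₁.reg r + 1 := by
        simp only [AExpr.val, BinOp.apply, h1]
      rw [hv]
      have hrr : (s₂.setReg r (s₁.reg r + 1)).reg r = s₁.reg r + 1 := by
        simp [ASt.setReg]
      rw [hrr, hφ, hm']
      exact ⟨by omega, h2, by omega, by omega⟩
    · intro hge
      have hge' : s₁.reg r = B := by
        by_contra hne
        have hlt : s₁.reg r < B := by omega
        have : (AExpr.op .lt (.reg r) N).val Λ s₁ = 1 := by
          simp only [AExpr.val, BinOp.apply, (hN s₁).1]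
          exact if_pos hlt
        omega
      rw [hge'] at hInv hk1 hk2
      simp only [Nat.sub_self, zero_mul] at hk1 hk2
      exact ⟨hge', hInv, by omega⟩
  · have hrr : (s.setReg r ((AExpr.lit 0).val Λ s)).reg r = 0 := by
      simp [ASt.setReg, AExpr.val]
    rw [hrr, hφ, Nat.sub_zero]
    exact ⟨Nat.zero_le _, h0, by omega, by omega⟩

/-! ### Reading an abstract state after an update. -/

@[simp] theorem ASt.setReg_reg (s : ASt) (r v r' : ℕ) :
    (s.setReg r v).reg r' = if r' = r then v else s.reg r' := by
  simp [ASt.setReg, Function.update_apply]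
@[simp] theorem ASt.setReg_alv (s : ASt) (r v : ℕ) : (s.setReg r v).alv = s.alv := rfl
@[simp] theorem ASt.setReg_out (s : ASt) (r v : ℕ) : (s.setReg r v).out = s.out := rfl
@[simp] theorem ASt.setReg_a3 (s : ASt) (r v : ℕ) : (s.setReg r v).a3 = s.a3 := rfl
@[simp] theorem ASt.setReg_a1 (s : ASt) (r v : ℕ) : (s.setReg r v).a1 = s.a1 := rfl
@[simp] theorem ASt.set3_reg (s : ASt) (α x y z v : ℕ) : (s.set3 α x y z v).reg = s.reg := rfl
@[simp] theorem ASt.set3_alv (s : ASt) (α x y z v : ℕ) : (s.set3 α x y z v).alv = s.alv := rfl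
@[simp] theorem ASt.set3_a3 (s : ASt) (α x y z v β : ℕ) : (s.set3 α x y z v).a3 β =
    if β = α then upd3 (s.a3 α) x y z v else s.a3 β := by
  simp only [ASt.set3, Function.update_apply]
@[simp] theorem ASt.set1_reg (s : ASt) (α x v : ℕ) : (s.set1 α x v).reg = s.reg := rfl
@[simp] theorem ASt.set1_a1 (s : ASt) (α x v β : ℕ) : (s.set1 α x v).a1 β =
    if β = α then Function.update (s.a1 α) x v else s.a1 β := by
  simp only [ASt.set1, Function.update_apply]
@[simp] theorem ASt.setAlv_reg (s : ASt) (x y v : ℕ) : (s.setAlv x y v).reg = s.reg := rfl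
@[simp] theorem ASt.setAlv_alv (s : ASt) (x y v : ℕ) :
    (s.setAlv x y v).alv = upd2 s.alv x y v := rfl
@[simp] theorem ASt.setAlv_out (s : ASt) (x y v : ℕ) : (s.setAlv x y v).out = s.out := rfl
@[simp] theorem ASt.setAlv_a1 (s : ASt) (x y v : ℕ) : (s.setAlv x y v).a1 = s.a1 := rfl
@[simp] theorem ASt.setOut_reg (s : ASt) (x v : ℕ) : (s.setOut x v).reg = s.reg := rfl
@[simp] theorem ASt.setOut_alv (s : ASt) (x v : ℕ) : (s.setOut x v).alv = s.alv := rfl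
@[simp] theorem ASt.setOut_out (s : ASt) (x v : ℕ) :
    (s.setOut x v).out = Function.update s.out x v := rfl
@[simp] theorem ASt.setOut_a1 (s : ASt) (x v : ℕ) : (s.setOut x v).a1 = s.a1 := rfl

end RAM

namespace RAM

/-! ### The invariant of the algorithm -/

/-- A constraint network with its constraints in both orientations: the oriented constraint
`f < E` leads from the variable `src f` to the variable `dst f`. -/
structure Net where
  n : ℕ
  d : ℕ
  E : ℕ
  src : ℕ → ℕ
  dst : ℕ → ℕ
  R : ℕ → ℕ → ℕ → Bool

namespace Net

/-- The constraints at `x_i` that still prevent the substitution of `a` for `b`. -/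
def act (X : Net) (W : ℕ → ℕ → ℕ → ℕ) (i b a : ℕ) : Finset ℕ :=
  (Finset.range X.E).filter fun f => X.src f = i ∧ W f b a ≠ 0

/-- The relation between the arrays of the algorithm: `A` marks the values that are left,
`W f b a` counts the obstructions to the substitution of `a` for `b` in the constraint `f`,
`N` and `SM` are the number and the sum (plus one each) of the constraints in which there are any,
`G i b a = f + 1` if `f` is the only such constraint, `S f b c` counts the values `a` supporting `c`
that may replace `b` under the condition `f`, and `ns`, `cq` are the candidates waiting to be
examined. The triples in `P` have been examined, the pairs in `Pend` need not be in `cq`. -/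
structure Inv (X : Net) (P : ℕ → ℕ → ℕ → Prop) (Pend : ℕ → ℕ → Prop) (A : ℕ → ℕ → ℕ)
    (W N SM G S : ℕ → ℕ → ℕ → ℕ) (ns : ℕ → ℕ → ℕ → Prop) (cq : ℕ → ℕ → Prop) : Prop where
  diag : ∀ f < X.E, ∀ b < X.d, W f b b = 0
  cnt : ∀ i < X.n, ∀ b < X.d, ∀ a < X.d, N i b a = (X.act W i b a).card
  sum : ∀ i < X.n, ∀ b < X.d, ∀ a < X.d, SM i b a = ∑ f ∈ X.act W i b a, (f + 1)
  supp : ∀ f < X.E, ∀ b < X.d, ∀ c < X.d, S f b c =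
    ((Finset.range X.d).filter fun a => G (X.src f) b a = f + 1 ∧ X.R f a c = true).card
  good : ∀ i < X.n, ∀ b < X.d, ∀ a < X.d, G i b a ≠ 0 → A i a = 1 ∧ a ≠ b ∧
    ∃ g < X.E, X.src g = i ∧ G i b a = g + 1 ∧ ∀ f < X.E, X.src f = i → f ≠ g → W f b a = 0
  found : ∀ i < X.n, ∀ b < X.d, ∀ a < X.d, P i b a → N i b a = 1 → A i a = 1 → G i b a ≠ 0
  fresh : ∀ i < X.n, ∀ b < X.d, ∀ a < X.d, (2 ≤ N i b a ∨ (¬ P i b a ∧ 1 ≤ N i b a)) →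
    G i b a = 0
  nsMem : ∀ i < X.n, ∀ b < X.d, ∀ a < X.d, P i b a → N i b a = 0 → A i a = 1 → A i b = 1 →
    a ≠ b → ns i b a
  nsIn : ∀ i b a, ns i b a → i < X.n ∧ b < X.d ∧ a < X.d ∧ N i b a = 0
  cMem : ∀ f < X.E, ∀ b < X.d, A (X.src f) b = 1 →
    (∀ c < X.d, A (X.dst f) c = 1 → X.R f b c = true → S f b c ≠ 0) → cq f b ∨ Pend f b
  cIn : ∀ f b, cq f b → f < X.E ∧ b < X.d

variable {X : Net} {P P' : ℕ → ℕ → ℕ → Prop} {Pend Pend' : ℕ → ℕ → Prop} {A : ℕ → ℕ → ℕ}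
  {W N SM G S : ℕ → ℕ → ℕ → ℕ} {ns ns' : ℕ → ℕ → ℕ → Prop} {cq cq' : ℕ → ℕ → Prop}

theorem mem_act {i b a f : ℕ} : f ∈ X.act W i b a ↔ f < X.E ∧ X.src f = i ∧ W f b a ≠ 0 := by
  simp [act]

/-! ### Preservation of the invariant under the elementary updates. -/

namespace Inv

theorem imp (h : Inv X P Pend A W N SM G S ns cq) (hP : ∀ i b a, P i b a ↔ P' i b a)
    (hPend : ∀ f b, f < X.E → b < X.d → Pend f b → Pend' f b) :
    Inv X P' Pend' A W N SM G S ns cq := by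
  have : P = P' := by funext i b a; exact propext (hP i b a)
  subst this
  exact { h with
    cMem := fun f hf b hb h1 h2 => (h.cMem f hf b hb h1 h2).imp_right (hPend f b hf hb) }

/-- With two or more obstructing constraints, or with one but an `a` already eliminated, examining
the triple leaves nothing to record. -/
theorem event_none {i b a : ℕ} (h : Inv X P Pend A W N SM G S ns cq)
    (h1 : N i b a ≠ 0) (h2 : N i b a = 1 → A i a ≠ 1)
    (hP' : ∀ i' b' a', P' i' b' a' ↔ P i' b' a' ∨ (i' = i ∧ b' = b ∧ a' = a)) :
    Inv X P' Pend A W N SM G S ns cq := by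
  refine { h with found := ?_, fresh := ?_, nsMem := ?_ }
  · intro i' hi' b' hb' a' ha' hp hn hA
    rcases (hP' _ _ _).1 hp with hp | ⟨rfl, rfl, rfl⟩
    · exact h.found _ hi' _ hb' _ ha' hp hn hA
    · exact absurd hA (h2 hn)
  · intro i' hi' b' hb' a' ha' hn
    refine h.fresh _ hi' _ hb' _ ha' (hn.imp_right fun ⟨h3, h4⟩ => ⟨fun h5 => h3 ?_, h4⟩)
    exact (hP' _ _ _).2 (Or.inl h5)
  · intro i' hi' b' hb' a' ha' hp hn hA hB hab
    rcases (hP' _ _ _).1 hp with hp | ⟨rfl, rfl, rfl⟩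
    · exact h.nsMem _ hi' _ hb' _ ha' hp hn hA hB hab
    · exact absurd hn h1

/-- The triple is recorded whether or not `a` and `b` survive and differ; this is tested when it
reaches the top of the stack. -/
theorem event_zero {i b a : ℕ} (h : Inv X P Pend A W N SM G S ns cq) (hi : i < X.n) (hb : b < X.d)
    (ha : a < X.d) (h1 : N i b a = 0)
    (hP' : ∀ i' b' a', P' i' b' a' ↔ P i' b' a' ∨ (i' = i ∧ b' = b ∧ a' = a))
    (hns : ∀ i' b' a', ns' i' b' a' ↔ ns i' b' a' ∨ (i' = i ∧ b' = b ∧ a' = a)) :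
    Inv X P' Pend A W N SM G S ns' cq := by
  refine { h with found := ?_, fresh := ?_, nsMem := ?_, nsIn := ?_ }
  · intro i' hi' b' hb' a' ha' hp hn hA
    rcases (hP' _ _ _).1 hp with hp | ⟨rfl, rfl, rfl⟩
    · exact h.found _ hi' _ hb' _ ha' hp hn hA
    · omega
  · intro i' hi' b' hb' a' ha' hn
    refine h.fresh _ hi' _ hb' _ ha' (hn.imp_right fun ⟨h3, h4⟩ => ⟨fun h5 => h3 ?_, h4⟩)
    exact (hP' _ _ _).2 (Or.inl h5)
  · intro i' hi' b' hb' a' ha' hp hn hA hB hab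
    rcases (hP' _ _ _).1 hp with hp | hp
    · exact (hns _ _ _).2 (Or.inl (h.nsMem _ hi' _ hb' _ ha' hp hn hA hB hab))
    · exact (hns _ _ _).2 (Or.inr hp)
  · intro i' b' a' hn
    rcases (hns _ _ _).1 hn with hn | ⟨rfl, rfl, rfl⟩
    · exact h.nsIn _ _ _ hn
    · exact ⟨hi, hb, ha, h1⟩

/-- If only one constraint is left then its number can be read off from `SM`. -/
theorem exists_unique {i b a : ℕ} (h : Inv X P Pend A W N SM G S ns cq) (hi : i < X.n)
    (hb : b < X.d) (ha : a < X.d) (h1 : N i b a = 1) :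
    ∃ g < X.E, X.src g = i ∧ SM i b a = g + 1 ∧ W g b a ≠ 0 ∧
      ∀ f < X.E, X.src f = i → f ≠ g → W f b a = 0 := by
  have hc := h.cnt i hi b hb a ha
  rw [h1] at hc
  obtain ⟨g, hg⟩ := Finset.card_eq_one.1 hc.symm
  have hmem : g ∈ X.act W i b a := by rw [hg]; exact Finset.mem_singleton_self g
  obtain ⟨m1, m2, m3⟩ := mem_act.1 hmem
  refine ⟨g, m1, m2, ?_, m3, ?_⟩
  · rw [h.sum i hi b hb a ha, hg, Finset.sum_singleton]
  · intro f hf hs hne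
    by_contra hW
    have : f ∈ X.act W i b a := mem_act.2 ⟨hf, hs, hW⟩
    rw [hg, Finset.mem_singleton] at this
    exact hne this

/-- By `fresh`, `G i b a` was 0, so `a` is a new member of the sets counted by `S g b c` and these
counts rise by one. Only the condition `(g, b)` can become true in this way, and it enters `cq'`. -/
theorem event_one {i b a g : ℕ} {S' : ℕ → ℕ → ℕ → ℕ} (h : Inv X P Pend A W N SM G S ns cq)
    (hi : i < X.n) (hb : b < X.d) (ha : a < X.d) (h1 : N i b a = 1) (hA : A i a = 1)
    (hnP : ¬ P i b a) (hg : g + 1 = SM i b a)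
    (hP' : ∀ i' b' a', P' i' b' a' ↔ P i' b' a' ∨ (i' = i ∧ b' = b ∧ a' = a))
    (hcq : ∀ f' b', cq' f' b' ↔ cq f' b' ∨ (f' = g ∧ b' = b))
    (hS : ∀ f b' c, S' f b' c = S f b' c +
      if f = g ∧ b' = b ∧ c < X.d ∧ X.R g a c = true then 1 else 0) :
    Inv X P' Pend A W N SM (upd3 G i b a (g + 1)) S' ns cq' := by
  obtain ⟨g', hg'E, hsrc, hSM, hWg, huniq⟩ := h.exists_unique hi hb ha h1
  obtain rfl : g' = g := by omega
  have hG0 : G i b a = 0 := h.fresh _ hi _ hb _ ha (Or.inr ⟨hnP, by omega⟩)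
  have hab : a ≠ b := by
    rintro rfl
    exact hWg (h.diag _ hg'E _ hb)
  refine { h with supp := ?_, good := ?_, found := ?_, fresh := ?_, nsMem := ?_, cMem := ?_, cIn := ?_ }
  · intro f hf b' hb' c hc
    rw [hS, h.supp f hf b' hb' c hc]
    by_cases hfb : f = g' ∧ b' = b
    · obtain ⟨rfl, rfl⟩ := hfb
      by_cases hR : X.R f a c = true
      · rw [if_pos ⟨rfl, rfl, hc, hR⟩]
        have : ((Finset.range X.d).filter fun a' =>
            upd3 G i b' a (f + 1) (X.src f) b' a' = f + 1 ∧ X.R f a' c = true) =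
            insert a ((Finset.range X.d).filter fun a' =>
              G (X.src f) b' a' = f + 1 ∧ X.R f a' c = true) := by
          ext a'
          simp only [Finset.mem_filter, Finset.mem_insert, Finset.mem_range, upd3, hsrc, true_and]
          by_cases h' : a' = a
          · subst h'; simp [ha, hR]
          · simp [h']
        rw [this, Finset.card_insert_of_notMem]
        simp [hsrc, hG0]
      · rw [if_neg (by simp [hR]), add_zero]
        congr 1
        ext a'
        rw [Finset.mem_filter, Finset.mem_filter]
        simp only [Finset.mem_range, upd3, hsrc, true_and]
        by_cases h' : a' = a
        · subst h'; simp [hR]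
        · simp [h']
    · rw [if_neg (by tauto), add_zero]
      congr 1
      ext a'
      rw [Finset.mem_filter, Finset.mem_filter]
      simp only [Finset.mem_range, upd3]
      by_cases h' : X.src f = i ∧ b' = b ∧ a' = a
      · obtain ⟨h2, rfl, rfl⟩ := h'
        have : f ≠ g' := fun h3 => hfb ⟨h3, rfl⟩
        rw [if_pos ⟨h2, rfl, rfl⟩, h2, hG0]
        constructor
        · rintro ⟨_, h3, _⟩; omega
        · rintro ⟨_, h3, _⟩; omega
      · rw [if_neg h']
  · intro i' hi' b' hb' a' ha' hne
    simp only [upd3] at hne ⊢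
    by_cases h' : i' = i ∧ b' = b ∧ a' = a
    · obtain ⟨rfl, rfl, rfl⟩ := h'
      exact ⟨hA, hab, g', hg'E, hsrc, by simp, huniq⟩
    · rw [if_neg h'] at hne ⊢
      exact h.good _ hi' _ hb' _ ha' hne
  · intro i' hi' b' hb' a' ha' hp hn hA'
    simp only [upd3]
    by_cases h' : i' = i ∧ b' = b ∧ a' = a
    · rw [if_pos h']; omega
    · rw [if_neg h']
      exact h.found _ hi' _ hb' _ ha' (((hP' _ _ _).1 hp).resolve_right h') hn hA'
  · intro i' hi' b' hb' a' ha' hn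
    simp only [upd3]
    by_cases h' : i' = i ∧ b' = b ∧ a' = a
    · have := (hP' _ _ _).2 (Or.inr h')
      obtain ⟨rfl, rfl, rfl⟩ := h'
      rcases hn with hn | ⟨h3, -⟩
      · omega
      · exact absurd this h3
    · rw [if_neg h']
      refine h.fresh _ hi' _ hb' _ ha' (hn.imp_right fun ⟨h3, h4⟩ => ⟨fun h5 => h3 ?_, h4⟩)
      exact (hP' _ _ _).2 (Or.inl h5)
  · intro i' hi' b' hb' a' ha' hp hn hA' hB hne
    rcases (hP' _ _ _).1 hp with hp | ⟨rfl, rfl, rfl⟩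
    · exact h.nsMem _ hi' _ hb' _ ha' hp hn hA' hB hne
    · omega
  · intro f hf b' hb' hB hall
    by_cases hfb : f = g' ∧ b' = b
    · exact Or.inl ((hcq _ _).2 (Or.inr hfb))
    · refine (h.cMem f hf b' hb' hB fun c hc h2 h3 => ?_).imp_left fun h4 => (hcq _ _).2 (Or.inl h4)
      have := hall c hc h2 h3
      rwa [hS, if_neg (by tauto), add_zero] at this
  · intro f b' hm
    rcases (hcq _ _).1 hm with hm | ⟨rfl, rfl⟩
    · exact h.cIn _ _ hm
    · exact ⟨hg'E, hb⟩

/-- The invariant depends on `W` only through its zeros, and a counter that stays positive creates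
none. -/
theorem dec_pos {f b a : ℕ} (h : Inv X P Pend A W N SM G S ns cq) (hf : f < X.E)
    (hW : 2 ≤ W f b a) : Inv X P Pend A (upd3 W f b a (W f b a - 1)) N SM G S ns cq := by
  have hz : ∀ f' b' a', upd3 W f b a (W f b a - 1) f' b' a' = 0 ↔ W f' b' a' = 0 := by
    intro f' b' a'
    simp only [upd3]
    split
    · rename_i h'; obtain ⟨rfl, rfl, rfl⟩ := h'; omega
    · rfl
  have hact : ∀ i b' a', X.act (upd3 W f b a (W f b a - 1)) i b' a' = X.act W i b' a' := by
    intro i b' a'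
    ext f'
    simp only [mem_act, ne_eq, hz]
  refine { h with diag := ?_, cnt := ?_, sum := ?_, good := ?_ }
  · intro f' hf' b' hb'
    exact (hz _ _ _).2 (h.diag f' hf' b' hb')
  · intro i hi b' hb' a' ha'
    rw [hact]; exact h.cnt i hi b' hb' a' ha'
  · intro i hi b' hb' a' ha'
    rw [hact]; exact h.sum i hi b' hb' a' ha'
  · intro i hi b' hb' a' ha' hne
    obtain ⟨h1, h2, g, h3, h4, h5, h6⟩ := h.good i hi b' hb' a' ha' hne
    exact ⟨h1, h2, g, h3, h4, h5, fun f' hf' hs hne => (hz _ _ _).2 (h6 f' hf' hs hne)⟩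

theorem act_upd_zero {f b a i : ℕ} (hs : X.src f = i) (i' b' a' : ℕ) :
    X.act (upd3 W f b a 0) i' b' a' =
      if i' = i ∧ b' = b ∧ a' = a then (X.act W i b a).erase f else X.act W i' b' a' := by
  split
  · rename_i h'
    obtain ⟨rfl, rfl, rfl⟩ := h'
    ext f'
    simp only [mem_act, Finset.mem_erase, upd3]
    by_cases hff : f' = f
    · subst hff; simp
    · simp [hff]
  · rename_i h'
    ext f'
    simp only [mem_act, upd3]
    by_cases hff : f' = f ∧ b' = b ∧ a' = a
    · obtain ⟨rfl, rfl, rfl⟩ := hff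
      have : X.src f' ≠ i' := fun h2 => h' ⟨by rw [← h2, hs], rfl, rfl⟩
      simp [this]
    · simp [hff]

/-- The triple loses its status of being examined, and an event has to follow. `fresh` survives
because a new `N ≥ 1` comes from an old `N ≥ 2`, for which `G` was 0. -/
theorem dec_zero {f b a i : ℕ} (h : Inv X (fun _ _ _ => True) Pend A W N SM G S ns cq)
    (hf : f < X.E) (hi : i < X.n) (hb : b < X.d) (ha : a < X.d) (hs : X.src f = i)
    (hW : W f b a ≠ 0) :
    Inv X (fun i' b' a' => ¬ (i' = i ∧ b' = b ∧ a' = a)) Pend A (upd3 W f b a 0)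
      (upd3 N i b a (N i b a - 1)) (upd3 SM i b a (SM i b a - (f + 1))) G S ns cq ∧
      N i b a ≠ 0 := by
  have hmem : f ∈ X.act W i b a := mem_act.2 ⟨hf, hs, hW⟩
  have hN : N i b a ≠ 0 := by
    rw [h.cnt i hi b hb a ha]
    exact Finset.card_ne_zero_of_mem hmem
  have hle : ∀ i' b' a', upd3 N i b a (N i b a - 1) i' b' a' ≤ N i' b' a' := by
    intro i' b' a'
    simp only [upd3]
    split
    · rename_i h'; obtain ⟨rfl, rfl, rfl⟩ := h'; omega
    · exact le_rfl
  have hzW : ∀ f' b' a', W f' b' a' = 0 → upd3 W f b a 0 f' b' a' = 0 := by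
    intro f' b' a' h0
    simp only [upd3]
    split
    · rfl
    · exact h0
  refine ⟨{ h with diag := ?_, cnt := ?_, sum := ?_, good := ?_, found := ?_, fresh := ?_, nsMem := ?_, nsIn := ?_ }, hN⟩
  · intro f' hf' b' hb'
    exact hzW _ _ _ (h.diag f' hf' b' hb')
  · intro i' hi' b' hb' a' ha'
    rw [act_upd_zero hs]
    simp only [upd3]
    split
    · rw [Finset.card_erase_of_mem hmem, h.cnt i hi b hb a ha]
    · exact h.cnt i' hi' b' hb' a' ha'
  · intro i' hi' b' hb' a' ha'
    rw [act_upd_zero hs]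
    simp only [upd3]
    split
    · rw [h.sum i hi b hb a ha, ← Finset.add_sum_erase _ _ hmem]
      omega
    · exact h.sum i' hi' b' hb' a' ha'
  · intro i' hi' b' hb' a' ha' hne
    obtain ⟨h1, h2, g, h3, h4, h5, h6⟩ := h.good i' hi' b' hb' a' ha' hne
    exact ⟨h1, h2, g, h3, h4, h5, fun f' hf' hs hne => hzW _ _ _ (h6 f' hf' hs hne)⟩
  · intro i' hi' b' hb' a' ha' hp hn hA
    simp only [upd3, if_neg hp] at hn
    exact h.found i' hi' b' hb' a' ha' trivial hn hA
  · intro i' hi' b' hb' a' ha' hn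
    refine h.fresh i' hi' b' hb' a' ha' (Or.inl ?_)
    rcases hn with hn | ⟨hp, hn⟩
    · exact hn.trans (hle _ _ _)
    · have hp' := not_not.1 hp
      simp only [upd3, if_pos hp'] at hn
      obtain ⟨rfl, rfl, rfl⟩ := hp'
      omega
  · intro i' hi' b' hb' a' ha' hp hn hA hB hab
    simp only [upd3, if_neg hp] at hn
    exact h.nsMem i' hi' b' hb' a' ha' trivial hn hA hB hab
  · intro i' b' a' hm
    obtain ⟨h1, h2, h3, h4⟩ := h.nsIn i' b' a' hm
    have := hle i' b' a'
    exact ⟨h1, h2, h3, by omega⟩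

/-- The effect of an elimination on `A`, `G` and `S` alone. Adjusting `W` can wait, since the
invariant does not tie `W` to `A`. As `S` only decreases here, a condition can become true only if
its conditioning variable lost a value; these conditions become pending. -/
theorem kill {j c : ℕ} {G' S' : ℕ → ℕ → ℕ → ℕ}
    (h : Inv X (fun _ _ _ => True) (fun _ _ => False) A W N SM G S ns cq) (hj : j < X.n)
    (hc : c < X.d) (hG : ∀ i b a, G' i b a = if b < X.d ∧ i = j ∧ a = c then 0 else G i b a)
    (hS : ∀ f < X.E, ∀ b < X.d, ∀ c' < X.d, S' f b c' = S f b c' -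
      if G j b c = f + 1 ∧ X.R f c c' = true then 1 else 0) :
    Inv X (fun _ _ _ => True) (fun f _ => X.dst f = j) (upd2 A j c 0) W N SM G' S' ns cq := by
  have hA : ∀ i a, upd2 A j c 0 i a = 1 → A i a = 1 ∧ ¬ (i = j ∧ a = c) := by
    intro i a
    simp only [upd2]
    split
    · omega
    · rename_i h'; exact fun h2 => ⟨h2, h'⟩
  refine { h with supp := ?_, good := ?_, found := ?_, fresh := ?_, nsMem := ?_, cMem := ?_ }
  · intro f hf b hb c' hc'
    rw [hS f hf b hb c' hc', h.supp f hf b hb c' hc']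
    by_cases hcase : G j b c = f + 1 ∧ X.R f c c' = true
    · rw [if_pos hcase]
      obtain ⟨-, -, g, -, hg1, hg2, -⟩ := h.good j hj b hb c hc (by omega)
      obtain rfl : g = f := by omega
      have hm : c ∈ (Finset.range X.d).filter fun a =>
          G (X.src g) b a = g + 1 ∧ X.R g a c' = true := by
        simp [hc, hg1, hcase]
      rw [← Finset.card_erase_of_mem hm]
      congr 1
      ext a
      simp only [Finset.mem_erase, Finset.mem_filter, Finset.mem_range, hG, hb, true_and, hg1]
      by_cases hac : a = c
      · simp [hac]
      · simp [hac]
    · rw [if_neg hcase, Nat.sub_zero]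
      congr 1
      ext a
      simp only [Finset.mem_filter, Finset.mem_range, hG, hb, true_and]
      by_cases hac : X.src f = j ∧ a = c
      · obtain ⟨h1, rfl⟩ := hac
        rw [if_pos ⟨h1, rfl⟩, h1]
        constructor
        · rintro ⟨_, h3, h4⟩; exact absurd ⟨h3, h4⟩ hcase
        · rintro ⟨_, h3, _⟩; omega
      · rw [if_neg hac]
  · intro i hi b hb a ha hne
    rw [hG] at hne ⊢
    by_cases hac : i = j ∧ a = c
    · exact absurd (if_pos ⟨hb, hac⟩) hne
    · rw [if_neg (by tauto)] at hne ⊢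
      obtain ⟨h1, h2⟩ := h.good i hi b hb a ha hne
      refine ⟨?_, h2⟩
      simp only [upd2, if_neg hac, h1]
  · intro i hi b hb a ha _ hn hA'
    obtain ⟨h1, h2⟩ := hA _ _ hA'
    rw [hG, if_neg (by tauto)]
    exact h.found i hi b hb a ha trivial hn h1
  · intro i hi b hb a ha hn
    rw [hG, h.fresh i hi b hb a ha hn]
    exact ite_self 0
  · intro i hi b hb a ha _ hn hA1 hA2 hab
    exact h.nsMem i hi b hb a ha trivial hn (hA _ _ hA1).1 (hA _ _ hA2).1 hab
  · intro f hf b hb hB hall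
    by_cases hdst : X.dst f = j
    · exact Or.inr hdst
    · refine (h.cMem f hf b hb (hA _ _ hB).1 fun c' hc' h1 h2 => ?_).imp_right False.elim
      have h3 := hall c' hc' (by simp only [upd2, hdst, false_and, if_false]; exact h1) h2
      rw [hS f hf b hb c' hc'] at h3
      omega

theorem push_c {f b : ℕ} (h : Inv X P Pend A W N SM G S ns cq) (hf : f < X.E) (hb : b < X.d)
    (hcq : ∀ f' b', cq' f' b' ↔ cq f' b' ∨ (f' = f ∧ b' = b))
    (hPend : ∀ f' b', Pend f' b' → Pend' f' b' ∨ (f' = f ∧ b' = b)) :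
    Inv X P Pend' A W N SM G S ns cq' := by
  refine { h with cMem := ?_, cIn := ?_ }
  · intro f' hf' b' hb' h1 h2
    rcases h.cMem f' hf' b' hb' h1 h2 with h3 | h3
    · exact Or.inl ((hcq _ _).2 (Or.inl h3))
    · rcases hPend _ _ h3 with h4 | h4
      · exact Or.inr h4
      · exact Or.inl ((hcq _ _).2 (Or.inr h4))
  · intro f' b' hm
    rcases (hcq _ _).1 hm with hm | ⟨rfl, rfl⟩
    · exact h.cIn _ _ hm
    · exact ⟨hf, hb⟩

theorem pop_ns {i b a : ℕ} (h : Inv X P Pend A W N SM G S ns cq)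
    (hd : ¬ (A i a = 1 ∧ A i b = 1 ∧ a ≠ b)) (h1 : ∀ i' b' a', ns' i' b' a' → ns i' b' a')
    (h2 : ∀ i' b' a', ns i' b' a' → ns' i' b' a' ∨ (i' = i ∧ b' = b ∧ a' = a)) :
    Inv X P Pend A W N SM G S ns' cq := by
  refine { h with nsMem := ?_, nsIn := fun i' b' a' hm => h.nsIn _ _ _ (h1 _ _ _ hm) }
  intro i' hi' b' hb' a' ha' hp hn hA hB hab
  rcases h2 _ _ _ (h.nsMem i' hi' b' hb' a' ha' hp hn hA hB hab) with h3 | ⟨rfl, rfl, rfl⟩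
  · exact h3
  · exact absurd ⟨hA, hB, hab⟩ hd

/-- An entry that fails now may be dropped: whatever could make it hold later puts it back on the
stack. -/
theorem pop_c {f b : ℕ} (h : Inv X P Pend A W N SM G S ns cq)
    (hd : ¬ (A (X.src f) b = 1 ∧
      ∀ c < X.d, A (X.dst f) c = 1 → X.R f b c = true → S f b c ≠ 0))
    (h1 : ∀ f' b', cq' f' b' → cq f' b')
    (h2 : ∀ f' b', cq f' b' → cq' f' b' ∨ (f' = f ∧ b' = b)) :
    Inv X P Pend A W N SM G S ns cq' := by
  refine { h with cMem := ?_, cIn := fun f' b' hm => h.cIn _ _ (h1 _ _ hm) }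
  intro f' hf' b' hb' hB hall
  rcases h.cMem f' hf' b' hb' hB hall with h3 | h3
  · rcases h2 _ _ h3 with h4 | ⟨rfl, rfl⟩
    · exact Or.inl h4
    · exact absurd ⟨hB, hall⟩ hd
  · exact Or.inr h3

end Inv

end Net

end RAM

namespace RAM

/-! ### The program: examination of a triple -/

namespace AExpr
abbrev add (x y : AExpr) : AExpr := .op .add x y
abbrev sub (x y : AExpr) : AExpr := .op .sub x y
abbrev mul (x y : AExpr) : AExpr := .op .mul x y
abbrev lt (x y : AExpr) : AExpr := .op .lt x y
abbrev eq (x y : AExpr) : AExpr := .op .eq x y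
end AExpr

abbrev set (r : ℕ) (x : AExpr) : Program := .set r x.comp
abbrev cond (x : AExpr) (p q : Program) : Program := .ite x.comp p q
abbrev loop (x : AExpr) (p : Program) : Program := .while x.comp p

namespace AExpr
abbrev zero : AExpr := .lit 0
abbrev one : AExpr := .lit 1
abbrev aSrc (f : AExpr) : AExpr := .a3 0 f zero zero
abbrev aDst (f : AExpr) : AExpr := .a3 1 f zero zero
abbrev aRel (f a c : AExpr) : AExpr := .a3 2 f a c
abbrev aHead (i : AExpr) : AExpr := .a3 3 i zero zero
abbrev aNext (f : AExpr) : AExpr := .a3 4 f zero zero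
abbrev aW (f b a : AExpr) : AExpr := .a3 5 f b a
abbrev aN (i b a : AExpr) : AExpr := .a3 6 i b a
abbrev aSM (i b a : AExpr) : AExpr := .a3 7 i b a
abbrev aG (i b a : AExpr) : AExpr := .a3 8 i b a
abbrev aS (f b c : AExpr) : AExpr := .a3 9 f b c
end AExpr

open AExpr

/-- Put the pair held by the registers `r` and `r'` on the stack of conditions. -/
def pushC (r r' : ℕ) : Program :=
  .seq (st1 3 (.reg 8) (.reg r)) <| .seq (st1 4 (.reg 8) (.reg r')) <|
    set 8 (add (.reg 8) one)

/-- Put the triple in the registers 15, 13, 14 on the stack of substitutions. -/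
def pushNS : Program :=
  .seq (st1 0 (.reg 7) (.reg 15)) <| .seq (st1 1 (.reg 7) (.reg 13)) <|
    .seq (st1 2 (.reg 7) (.reg 14)) <| set 7 (add (.reg 7) one)

/-- Registers 13, 14 and 16 hold `b`, its new replacement `a` and the condition: each `c` compatible
with `a` gains a support. -/
def addSupports : Program :=
  forTo 17 .d (cond (aRel (.reg 16) (.reg 14) (.reg 17))
    (st3 9 (.reg 16) (.reg 13) (.reg 17) (add (aS (.reg 16) (.reg 13) (.reg 17)) one)) .skip)

/-- Examine the triple `(i, b, a)` in the registers 15, 13, 14. -/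
def event : Program :=
  cond (eq (aN (.reg 15) (.reg 13) (.reg 14)) zero) pushNS <|
    cond (mul (eq (aN (.reg 15) (.reg 13) (.reg 14)) one) (.alv (.reg 15) (.reg 14)))
      (.seq (set 16 (sub (aSM (.reg 15) (.reg 13) (.reg 14)) one)) <|
        .seq (st3 8 (.reg 15) (.reg 13) (.reg 14) (add (.reg 16) one)) <|
        .seq (pushC 16 13) addSupports) .skip

/-- The stack of substitutions, as a set. -/
def nsSet (s : ASt) (i b a : ℕ) : Prop :=
  ∃ x < s.reg 7, s.a1 0 x = i ∧ s.a1 1 x = b ∧ s.a1 2 x = a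

/-- The stack of conditions, as a set. -/
def cSet (s : ASt) (f b : ℕ) : Prop := ∃ x < s.reg 8, s.a1 3 x = f ∧ s.a1 4 x = b

def SInv (X : Net) (P : ℕ → ℕ → ℕ → Prop) (Pend : ℕ → ℕ → Prop) (s : ASt) : Prop :=
  X.Inv P Pend s.alv (s.a3 5) (s.a3 6) (s.a3 7) (s.a3 8) (s.a3 9) (nsSet s) (cSet s)

/-- The list of constraints below `g` with source `i`, in decreasing order, is linked: this is the
first of them, plus one, or `0`. -/
def Net.prv (X : Net) (i : ℕ) : ℕ → ℕ
  | 0 => 0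
  | g + 1 => if X.src g = i then g + 1 else X.prv i g

/-- The arrays that describe the network. -/
structure Stat (X : Net) (s : ASt) : Prop where
  src : ∀ f < X.E, s.a3 0 f 0 0 = X.src f
  dst : ∀ f < X.E, s.a3 1 f 0 0 = X.dst f
  rel : ∀ f < X.E, ∀ a < X.d, ∀ c < X.d, s.a3 2 f a c = (X.R f a c).toNat
  head : ∀ i < X.n, s.a3 3 i 0 0 = X.prv i X.E
  next : ∀ f < X.E, s.a3 4 f 0 0 = X.prv (X.src f) f

/-- The constraint `f` with its orientation reversed. -/
def Net.rev (X : Net) (f : ℕ) : ℕ := if f < X.E / 2 then f + X.E / 2 else f - X.E / 2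

structure Fits (Λ : Layout) (X : Net) : Prop where
  n : X.n = Λ.n
  d : X.d = Λ.d
  E : X.E = 2 * Λ.e
  src : ∀ f < X.E, X.src f < X.n
  dst : ∀ f < X.E, X.dst f < X.n
  src_rev : ∀ f < X.E, X.src (X.rev f) = X.dst f
  dst_rev : ∀ f < X.E, X.dst (X.rev f) = X.src f
  cap : Λ.K + 128 * Λ.D ≤ 32 * Λ.D * Λ.M
  valid : Λ.Valid

/-- The registers outside `rs` and the arrays outside `as` are unchanged. -/
structure Same (rs as : List ℕ) (s s' : ASt) : Prop where
  reg : ∀ r, r ∉ rs → s'.reg r = s.reg r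
  a3 : ∀ α, α ∉ as → s'.a3 α = s.a3 α
  alv : s'.alv = s.alv
  out : s'.out = s.out

theorem Same.refl (rs as : List ℕ) (s : ASt) : Same rs as s s :=
  ⟨fun _ _ => rfl, fun _ _ => rfl, rfl, rfl⟩

theorem Same.trans {rs as : List ℕ} {s s' s'' : ASt} (h : Same rs as s s') (h' : Same rs as s' s'') :
    Same rs as s s'' :=
  ⟨fun r hr => (h'.reg r hr).trans (h.reg r hr), fun α hα => (h'.a3 α hα).trans (h.a3 α hα),
    h'.alv.trans h.alv, h'.out.trans h.out⟩

theorem Same.mono {rs rs' as as' : List ℕ} {s s' : ASt} (h : Same rs as s s') (h1 : rs ⊆ rs')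
    (h2 : as ⊆ as') : Same rs' as' s s' :=
  ⟨fun r hr => h.reg r fun h' => hr (h1 h'), fun α hα => h.a3 α fun h' => hα (h2 h'), h.alv, h.out⟩

theorem Same.stat {X : Net} {rs as : List ℕ} {s s' : ASt} (h : Same rs as s s') (hS : Stat X s)
    (h1 : ∀ α < 5, α ∉ as) : Stat X s' := by
  constructor
  · rw [h.a3 0 (h1 0 (by omega))]; exact hS.src
  · rw [h.a3 1 (h1 1 (by omega))]; exact hS.dst
  · rw [h.a3 2 (h1 2 (by omega))]; exact hS.rel
  · rw [h.a3 3 (h1 3 (by omega))]; exact hS.head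
  · rw [h.a3 4 (h1 4 (by omega))]; exact hS.next

/-- The credits attached to the entries of the stacks and of the list of eliminations. -/
def tok (Λ : Layout) (s : ASt) : ℕ := 32 * Λ.D * (s.reg 7 + s.reg 8 + 2 * s.reg 1)

/-- Array bounds follow from credits: objects owning `32 * D` credits each cannot outnumber what the
budget `K` allows, and `cap` compares this with `M`. An elimination counts twice in `tok` because it
fills two cells. -/
theorem Fits.lt_len {Λ : Layout} {X : Net} (hX : Fits Λ X) {x k : ℕ} (h : 32 * Λ.D * x ≤ k)
    (hk : k ≤ Λ.K) : x + 4 ≤ Λ.M := by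
  have h1 := hX.cap
  have h2 : 32 * Λ.D * (x + 4) ≤ 32 * Λ.D * Λ.M := by rw [mul_add]; omega
  exact Nat.le_of_mul_le_mul_left h2 (by simp [Layout.D])

theorem tok_le {Λ : Layout} {s : ASt} {r : ℕ} (hr : r = 7 ∨ r = 8 ∨ r = 1) :
    32 * Λ.D * s.reg r ≤ tok Λ s := by
  apply Nat.mul_le_mul_left
  rcases hr with rfl | rfl | rfl <;> omega

theorem tok_eq {Λ : Layout} {s s' : ASt} (h7 : s'.reg 7 = s.reg 7) (h8 : s'.reg 8 = s.reg 8)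
    (h1 : s'.reg 1 = s.reg 1) : tok Λ s' = tok Λ s := by
  simp only [tok, h7, h8, h1]

/-- Three credits are spent; the other `32 * D` are deposited with the new entry and recovered when
it is popped. -/
theorem pushC_spec {Λ : Layout} {X : Net} (hX : Fits Λ X) {r r' : ℕ} {s : ASt} {k : ℕ}
    (hr : userReg r = true) (hr' : userReg r' = true)
    (hk : tok Λ s + (32 * Λ.D + 3) ≤ k) :
    WP Λ (pushC r r') (fun s' k' => Same [8] [] s s' ∧ nsSet s' = nsSet s ∧
      (∀ f b, cSet s' f b ↔ cSet s f b ∨ (f = s.reg r ∧ b = s.reg r')) ∧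
      tok Λ s' + k ≤ tok Λ s + (32 * Λ.D + 3) + k') s k := by
  refine WP.of_le fun hK => ?_
  have hM : s.reg 8 + 4 ≤ Λ.M := hX.lt_len ((tok_le (by simp)).trans (by omega)) hK
  have hf : (AExpr.reg r).fits = true := by simp [fits, wf, hr, comp, Expr.cost]
  have hf' : (AExpr.reg r').fits = true := by simp [fits, wf, hr', comp, Expr.cost]
  refine WP.prim_seq (by omega) (Prim.st1 hX.valid (by rfl) ⟨trivial, ?_⟩ hf (by rfl) trivial) ?_
  · simp only [val]; omega
  refine WP.prim_seq (by omega) (Prim.st1 hX.valid (by rfl) ⟨trivial, ?_⟩ hf' (by rfl) trivial) ?_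
  · simp only [val, ASt.set1_reg]; omega
  refine WP.prim (by omega) (Prim.set hX.valid (by rfl) (by rfl) (by rfl) ⟨trivial, trivial⟩) ?_
  simp only [val, ASt.set1_reg, BinOp.apply]
  refine ⟨⟨?_, fun _ _ => rfl, rfl, rfl⟩, ?_, ?_, ?_⟩
  · intro q hq
    have : q ≠ 8 := by simpa using hq
    simp [this]
  · funext i b a
    simp [nsSet]
  · intro f b
    simp only [cSet, ASt.setReg_reg, if_true, ASt.setReg_a1, ASt.set1_a1, ASt.set1_reg]
    norm_num
    constructor
    · rintro ⟨x, hx, h1, h2⟩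
      by_cases hx8 : x = s.reg 8
      · subst hx8
        right
        simpa [eq_comm] using And.intro h1 h2
      · left
        refine ⟨x, by omega, ?_, ?_⟩
        · simpa [Function.update_of_ne hx8] using h1
        · simpa [Function.update_of_ne hx8] using h2
    · rintro (⟨x, hx, h1, h2⟩ | ⟨rfl, rfl⟩)
      · have hx8 : x ≠ s.reg 8 := by omega
        refine ⟨x, by omega, ?_, ?_⟩
        · simpa [Function.update_of_ne hx8] using h1
        · simpa [Function.update_of_ne hx8] using h2
      · exact ⟨s.reg 8, by omega, by simp, by simp⟩
  · have : tok Λ (((s.set1 3 (s.reg 8) (s.reg r)).set1 4 (s.reg 8) (s.reg r')).setReg 8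
        (s.reg 8 + 1)) = tok Λ s + 32 * Λ.D := by
      simp [tok]; ring
    rw [this]; omega

theorem pushNS_spec {Λ : Layout} {X : Net} (hX : Fits Λ X) {s : ASt} {k : ℕ}
    (hk : tok Λ s + (32 * Λ.D + 4) ≤ k) :
    WP Λ pushNS (fun s' k' => Same [7] [] s s' ∧ cSet s' = cSet s ∧
      (∀ i b a, nsSet s' i b a ↔ nsSet s i b a ∨ (i = s.reg 15 ∧ b = s.reg 13 ∧ a = s.reg 14)) ∧
      tok Λ s' + k ≤ tok Λ s + (32 * Λ.D + 4) + k') s k := by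
  refine WP.of_le fun hK => ?_
  have hM : s.reg 7 + 4 ≤ Λ.M := hX.lt_len ((tok_le (by simp)).trans (by omega)) hK
  refine WP.prim_seq (by omega)
    (Prim.st1 hX.valid (by rfl) ⟨trivial, ?_⟩ (by rfl) (by rfl) trivial) ?_
  · simp only [val]; omega
  refine WP.prim_seq (by omega)
    (Prim.st1 hX.valid (by rfl) ⟨trivial, ?_⟩ (by rfl) (by rfl) trivial) ?_
  · simp only [val, ASt.set1_reg]; omega
  refine WP.prim_seq (by omega)
    (Prim.st1 hX.valid (by rfl) ⟨trivial, ?_⟩ (by rfl) (by rfl) trivial) ?_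
  · simp only [val, ASt.set1_reg]; omega
  refine WP.prim (by omega) (Prim.set hX.valid (by rfl) (by rfl) (by rfl) ⟨trivial, trivial⟩) ?_
  simp only [val, ASt.set1_reg, BinOp.apply]
  refine ⟨⟨?_, fun _ _ => rfl, rfl, rfl⟩, ?_, ?_, ?_⟩
  · intro q hq
    have : q ≠ 7 := by simpa using hq
    simp [this]
  · funext f b
    simp [cSet]
  · intro i b a
    simp only [nsSet, ASt.setReg_reg, if_true, ASt.setReg_a1, ASt.set1_a1, ASt.set1_reg]
    norm_num
    constructor
    · rintro ⟨x, hx, h1, h2, h3⟩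
      by_cases hx8 : x = s.reg 7
      · subst hx8
        right
        simpa [eq_comm] using And.intro h1 (And.intro h2 h3)
      · left
        refine ⟨x, by omega, ?_, ?_, ?_⟩
        · simpa [Function.update_of_ne hx8] using h1
        · simpa [Function.update_of_ne hx8] using h2
        · simpa [Function.update_of_ne hx8] using h3
    · rintro (⟨x, hx, h1, h2, h3⟩ | ⟨rfl, rfl, rfl⟩)
      · have hx8 : x ≠ s.reg 7 := by omega
        refine ⟨x, by omega, ?_, ?_, ?_⟩
        · simpa [Function.update_of_ne hx8] using h1
        · simpa [Function.update_of_ne hx8] using h2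
        · simpa [Function.update_of_ne hx8] using h3
      · exact ⟨s.reg 7, by omega, by simp, by simp, by simp⟩
  · have : tok Λ ((((s.set1 0 (s.reg 7) (s.reg 15)).set1 1 (s.reg 7) (s.reg 13)).set1 2
        (s.reg 7) (s.reg 14)).setReg 7 (s.reg 7 + 1)) = tok Λ s + 32 * Λ.D := by
      simp [tok]; ring
    rw [this]; omega

theorem addSupports_spec {Λ : Layout} {X : Net} (hX : Fits Λ X) {s : ASt} {k g b a : ℕ}
    (hS : Stat X s) (hg : g < X.E) (hb : b < X.d) (ha : a < X.d)
    (h16 : s.reg 16 = g) (h13 : s.reg 13 = b) (h14 : s.reg 14 = a) (hk : 4 * Λ.D ≤ k) :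
    WP Λ addSupports (fun s' k' => Same [17] [9] s s' ∧ s'.a1 = s.a1 ∧
      (∀ f b' c, s'.a3 9 f b' c = s.a3 9 f b' c +
        if f = g ∧ b' = b ∧ c < X.d ∧ X.R g a c = true then 1 else 0) ∧
      k ≤ 4 * Λ.D + k') s k := by
  have hd := hX.d
  have hE := hX.E
  have hD : Λ.D = Λ.d + 1 := rfl
  have hF : Λ.F = Λ.n + 2 * Λ.e := rfl
  refine WP.imp (WP.forTo hX.valid (fun _ => 0) 2 Λ.d (fun c s₁ => Same [17] [9] s s₁ ∧
    s₁.a1 = s.a1 ∧ ∀ f b' c', s₁.a3 9 f b' c' = s.a3 9 f b' c' +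
        if f = g ∧ b' = b ∧ c' < c ∧ X.R g a c' = true then 1 else 0)
    (by rfl) (by rfl) (fun _ => ⟨rfl, trivial, ⟩) (fun _ _ => rfl) ?_ ?_ ?_) ?_
  · rintro c s₁ k₁ hc h17 ⟨hsame, ha1, hinv⟩ hk₁
    have e16 : s₁.reg 16 = g := (hsame.reg 16 (by decide)).trans h16
    have e13 : s₁.reg 13 = b := (hsame.reg 13 (by decide)).trans h13
    have e14 : s₁.reg 14 = a := (hsame.reg 14 (by decide)).trans h14
    have hrel : s₁.a3 2 g a c = (X.R g a c).toNat :=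
      (hsame.stat hS (by decide)).rel g hg a ha c (by omega)
    refine WP.ite hX.valid (by omega) (by rfl) ?_ ?_ ?_
    · simp only [Ok, val, e16, e14, h17]; simp; omega
    · intro hv
      simp only [val, e16, e14, h17, hrel] at hv
      have hR : X.R g a c = true := by simpa using hv
      refine WP.prim (by omega) (Prim.st3 hX.valid (by rfl) ?_ (by rfl) (by rfl) ?_) ?_
      · simp only [Ok, val, e16, e13, h17]; simp; omega
      · simp only [Ok, val, e16, e13, h17]; simp; omega
      · simp only [val, e16, e13, h17, BinOp.apply]
        refine ⟨by simpa using h17, ⟨⟨?_, ?_, hsame.alv, hsame.out⟩, ha1, ?_⟩, by omega⟩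
        · intro q hq
          have : q ≠ 17 := by simpa using hq
          simp [this, hsame.reg q hq]
        · intro α hα
          have : α ≠ 9 := by simpa using hα
          simp [this, hsame.a3 α hα]
        · intro f b' c'
          simp only [ASt.setReg_a3, ASt.set3_a3, if_true, upd3]
          by_cases h' : f = g ∧ b' = b ∧ c' = c
          · obtain ⟨rfl, rfl, rfl⟩ := h'
            simp [hinv, hR]
          · rw [if_neg h', hinv]
            congr 1
            refine if_congr ?_ rfl rfl
            constructor
            · rintro ⟨h1, h2, h3, h4⟩; exact ⟨h1, h2, by omega, h4⟩
            · rintro ⟨h1, h2, h3, h4⟩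
              exact ⟨h1, h2, by by_contra h5; exact h' ⟨h1, h2, by omega⟩, h4⟩
    · intro hv
      simp only [val, e16, e14, h17, hrel] at hv
      have hR : ¬ X.R g a c = true := by simpa using hv
      refine WP.skip (by omega) ⟨h17, ⟨⟨?_, fun α hα => hsame.a3 α hα, hsame.alv, hsame.out⟩, ha1, ?_⟩, by omega⟩
      · intro q hq
        have : q ≠ 17 := by simpa using hq
        simp [this, hsame.reg q hq]
      · intro f b' c'
        simp only [ASt.setReg_a3]
        rw [hinv]
        congr 1
        refine if_congr ?_ rfl rfl
        constructor
        · rintro ⟨h1, h2, h3, h4⟩; exact ⟨h1, h2, by omega, h4⟩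
        · rintro ⟨h1, h2, h3, h4⟩
          refine ⟨h1, h2, ?_, h4⟩
          by_contra h5
          obtain rfl : c' = c := by omega
          exact hR h4
  · refine ⟨⟨?_, fun _ _ => rfl, rfl, rfl⟩, rfl, ?_⟩
    · intro q hq
      have : q ≠ 17 := by simpa using hq
      simp [this]
    · intro f b' c'
      simp
  · show 0 + _ ≤ k
    omega
  · rintro s' k' hk' ⟨-, ⟨h1, h2, h3⟩, h4⟩
    rw [hd]
    exact ⟨h1, h2, h3, by omega⟩

/-- A triple with `N ≥ 2` costs only the tests. Otherwise `44 * D` covers the deposit of the pushed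
entry and the loop over the supports. -/
theorem event_spec {Λ : Layout} {X : Net} (hX : Fits Λ X) {P P' : ℕ → ℕ → ℕ → Prop}
    {Pend : ℕ → ℕ → Prop} {s : ASt} {k i b a : ℕ} (hS : Stat X s) (hI : SInv X P Pend s)
    (hi : i < X.n) (hb : b < X.d) (ha : a < X.d)
    (h15 : s.reg 15 = i) (h13 : s.reg 13 = b) (h14 : s.reg 14 = a)
    (hA : s.alv i a ≤ 1) (hnP : ¬ P i b a)
    (hP' : ∀ i' b' a', P' i' b' a' ↔ P i' b' a' ∨ (i' = i ∧ b' = b ∧ a' = a))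
    (hk : tok Λ s + (4 + if s.a3 6 i b a ≤ 1 then 44 * Λ.D else 0) ≤ k) :
    WP Λ event (fun s' k' => SInv X P' Pend s' ∧ Same [7, 8, 16, 17] [8, 9] s s' ∧
      tok Λ s' + k ≤ tok Λ s + (4 + if s.a3 6 i b a ≤ 1 then 44 * Λ.D else 0) + k') s k := by
  have hn := hX.n
  have hd := hX.d
  have hE := hX.E
  have hD : Λ.D = Λ.d + 1 := rfl
  have hF : Λ.F = Λ.n + 2 * Λ.e := rfl
  refine WP.ite hX.valid (by omega) (by rfl) ?_ ?_ ?_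
  · simp only [Ok, val, h15, h13, h14]; simp; omega
  · intro hv
    simp only [val, h15, h13, h14, BinOp.apply] at hv
    have h0 : s.a3 6 i b a = 0 := by by_contra h'; exact hv (if_neg h')
    rw [h0, if_pos (by omega)] at hk ⊢
    refine WP.imp (pushNS_spec hX (by omega)) ?_
    rintro s' k' hk' ⟨h1, h2, h3, h4⟩
    refine ⟨?_, h1.mono (by decide) (by decide), by omega⟩
    have := hI.event_zero (ns' := nsSet s') hi hb ha h0 hP' (by intro i' b' a'; rw [h3, h15, h13, h14])
    simp only [SInv]
    rw [h1.alv, h2, h1.a3 5 (by decide), h1.a3 6 (by decide), h1.a3 7 (by decide),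
      h1.a3 8 (by decide), h1.a3 9 (by decide)]
    exact this
  · intro hv
    simp only [val, h15, h13, h14, BinOp.apply] at hv
    have h0 : s.a3 6 i b a ≠ 0 := by
      intro h'; rw [if_pos h'] at hv; omega
    refine WP.ite hX.valid (by omega) (by rfl) ?_ ?_ ?_
    · simp only [Ok, val, h15, h13, h14]; simp; omega
    · intro hv
      simp only [val, h15, h13, h14, BinOp.apply] at hv
      have h1 : s.a3 6 i b a = 1 := by
        by_contra h'; rw [if_neg h', zero_mul] at hv; exact hv rfl
      have hA1 : s.alv i a = 1 := by
        have : s.alv i a ≠ 0 := by intro h'; rw [h', mul_zero] at hv; exact hv rfl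
        omega
      rw [h1, if_pos (by omega)] at hk ⊢
      obtain ⟨g, hgE, hsrc, hSM, -⟩ := hI.exists_unique hi hb ha h1
      refine WP.prim_seq (by omega) (Prim.set hX.valid (by rfl) (by rfl) (by rfl) ?_) ?_
      · simp only [Ok, val, h15, h13, h14]; simp; omega
      simp only [val, h15, h13, h14, BinOp.apply, hSM, Nat.add_sub_cancel]
      refine WP.prim_seq (by omega) (Prim.st3 hX.valid (by rfl) ?_ (by rfl) (by rfl) ⟨trivial, trivial⟩) ?_
      · simp [Ok, val, h15, h13, h14]; omega
      have e15 : (s.setReg 16 g).reg 15 = i := by simp [h15]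
      have e13 : (s.setReg 16 g).reg 13 = b := by simp [h13]
      have e14 : (s.setReg 16 g).reg 14 = a := by simp [h14]
      have e16 : (s.setReg 16 g).reg 16 = g := by simp
      simp only [val, e15, e13, e14, e16, BinOp.apply]
      have htok : tok Λ ((s.setReg 16 g).set3 8 i b a (g + 1)) = tok Λ s := tok_eq rfl rfl rfl
      refine WP.seq (WP.imp (pushC_spec hX (by rfl) (by rfl)
        (by rw [htok]; omega)) ?_)
      rintro s₂ k₂ hk₂ ⟨q1, q2, q3, q4⟩
      rw [htok] at q4
      have hS0 : Stat X ((s.setReg 16 g).set3 8 i b a (g + 1)) :=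
        ⟨hS.src, hS.dst, hS.rel, hS.head, hS.next⟩
      refine WP.imp (addSupports_spec hX (g := g) (b := b) (a := a) (q1.stat hS0 (by decide)) hgE hb ha
        (by rw [q1.reg 16 (by decide)]; simp) (by rw [q1.reg 13 (by decide)]; simpa using h13)
        (by rw [q1.reg 14 (by decide)]; simpa using h14) (by omega)) ?_
      rintro s₃ k₃ hk₃ ⟨r1, r2, r3, r4⟩
      have hns : nsSet s₃ = nsSet s := by
        have : nsSet s₃ = nsSet s₂ := by
          funext i b a; simp only [nsSet, r2, r1.reg 7 (by decide)]
        rw [this, q2]; rfl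
      have hcs : cSet s₃ = cSet s₂ := by
        funext f b; simp only [cSet, r2, r1.reg 8 (by decide)]
      refine ⟨?_, ⟨?_, ?_, ?_, ?_⟩, ?_⟩
      · have := hI.event_one (g := g) (S' := s₃.a3 9) (cq' := cSet s₃) hi hb ha h1 hA1 hnP hSM.symm hP'
          (fun f' b' => by rw [hcs, q3]; simp only [ASt.set3_reg, e16, e13]; rfl)
          (fun f b' c => by rw [r3, q1.a3 9 (by decide)]; rfl)
        simp only [SInv]
        rw [hns, r1.alv, q1.alv, r1.a3 5 (by decide), r1.a3 6 (by decide), r1.a3 7 (by decide),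
          r1.a3 8 (by decide), q1.a3 5 (by decide), q1.a3 6 (by decide), q1.a3 7 (by decide),
          q1.a3 8 (by decide)]
        simpa using this
      · intro r hr
        have hr' : r ≠ 7 ∧ r ≠ 8 ∧ r ≠ 16 ∧ r ≠ 17 := by simpa using hr
        rw [r1.reg r (by simp [hr']), q1.reg r (by simp [hr'])]
        simp [hr']
      · intro α hα
        have hα' : α ≠ 8 ∧ α ≠ 9 := by simpa using hα
        rw [r1.a3 α (by simp [hα']), q1.a3 α (by simp)]
        simp [hα']
      · rw [r1.alv, q1.alv]; rfl
      · rw [r1.out, q1.out]; rfl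
      · have : tok Λ s₃ = tok Λ s₂ := tok_eq (r1.reg 7 (by decide)) (r1.reg 8 (by decide))
          (r1.reg 1 (by decide))
        omega
    · intro hv
      simp only [val, h15, h13, h14, BinOp.apply] at hv
      refine WP.skip (by omega) ⟨hI.event_none h0 ?_ hP', Same.refl _ _ _, by omega⟩
      intro h1 h2
      rw [h2, if_pos h1] at hv
      omega

end RAM

namespace RAM

open AExpr

/-! ### Potential -/

/-- The potential of the counters. Truncation at 2 suffices because expensive work occurs only when
`N` drops to 1 or to 0. -/
def sumN (n d : ℕ) (N : ℕ → ℕ → ℕ → ℕ) : ℕ :=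
  ∑ i ∈ Finset.range n, ∑ b ∈ Finset.range d, ∑ a ∈ Finset.range d, min (N i b a) 2

theorem sumN_dec {n d : ℕ} {N : ℕ → ℕ → ℕ → ℕ} {i b a : ℕ} (hi : i < n) (hb : b < d) (ha : a < d)
    (hN : N i b a ≠ 0) :
    sumN n d (upd3 N i b a (N i b a - 1)) + (if N i b a ≤ 2 then 1 else 0) = sumN n d N := by
  have key : ∀ (m x : ℕ) (f g : ℕ → ℕ) (δ : ℕ), x < m → (∀ y, y ≠ x → f y = g y) →
      f x + δ = g x → (∑ y ∈ Finset.range m, f y) + δ = ∑ y ∈ Finset.range m, g y := by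
    intro m x f g δ hx hne he
    have hx' := Finset.mem_range.2 hx
    rw [← Finset.add_sum_erase _ f hx', ← Finset.add_sum_erase _ g hx', ← he]
    have : ∑ y ∈ (Finset.range m).erase x, f y = ∑ y ∈ (Finset.range m).erase x, g y :=
      Finset.sum_congr rfl fun y hy => hne y (Finset.ne_of_mem_erase hy)
    omega
  refine key n i _ _ _ hi (fun y hy => ?_) (key d b _ _ _ hb (fun y hy => ?_)
    (key d a _ _ _ ha (fun y hy => ?_) ?_))
  · simp [upd3, hy]
  · simp [upd3, hy]
  · simp [upd3, hy]
  · simp only [upd3, and_self, if_true]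
    split <;> omega

/-- The credits held by the state. -/
def pot (Λ : Layout) (s : ASt) : ℕ := tok Λ s + 48 * Λ.D * sumN Λ.n Λ.d (s.a3 6)

theorem pot_setReg {Λ : Layout} {s : ASt} {r v : ℕ} (hr : r ≠ 7 ∧ r ≠ 8 ∧ r ≠ 1) :
    pot Λ (s.setReg r v) = pot Λ s := by
  have : tok Λ (s.setReg r v) = tok Λ s :=
    tok_eq (by simp [hr.1.symm]) (by simp [hr.2.1.symm]) (by simp [hr.2.2.symm])
  simp only [pot, this, ASt.setReg_a3]

theorem SInv.setReg {X : Net} {P : ℕ → ℕ → ℕ → Prop} {Pend : ℕ → ℕ → Prop} {s : ASt} {r v : ℕ}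
    (h : SInv X P Pend s) (h7 : r ≠ 7) (h8 : r ≠ 8) : SInv X P Pend (s.setReg r v) := by
  have h1 : nsSet (s.setReg r v) = nsSet s := by
    funext i b a; simp [nsSet, h7.symm]
  have h2 : cSet (s.setReg r v) = cSet s := by
    funext f b; simp [cSet, h8.symm]
  simp only [SInv, h1, h2]
  exact h

theorem Stat.setReg {X : Net} {s : ASt} (h : Stat X s) (r v : ℕ) : Stat X (s.setReg r v) :=
  ⟨h.src, h.dst, h.rel, h.head, h.next⟩

theorem Same.setReg {rs as : List ℕ} {s s' : ASt} {r v : ℕ} (h : Same rs as s s') (hr : r ∈ rs) :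
    Same rs as s (s'.setReg r v) := by
  refine ⟨fun q hq => ?_, h.a3, h.alv, h.out⟩
  have : q ≠ r := fun h' => hq (h' ▸ hr)
  simp [this, h.reg q hq]

@[simp] theorem nsSet_set3 (s : ASt) (α x y z v : ℕ) : nsSet (s.set3 α x y z v) = nsSet s := rfl
@[simp] theorem cSet_set3 (s : ASt) (α x y z v : ℕ) : cSet (s.set3 α x y z v) = cSet s := rfl

/-! ### The removal of an obstruction -/

/-- The pair `(b, a)` loses an obstruction in the constraint `f` when `c` is eliminated. -/
def Net.loss (X : Net) (c f b a : ℕ) : ℕ := if X.R f b c = true ∧ ¬ X.R f a c = true then 1 else 0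

/-- Account for the elimination of the value in register 11 in the triple `(f, b, a)` in the
registers 12, 13, 14; the source of `f` is in register 15. -/
def decW : Program :=
  cond (mul (aRel (.reg 12) (.reg 13) (.reg 11)) (sub one (aRel (.reg 12) (.reg 14) (.reg 11))))
    (.seq (st3 5 (.reg 12) (.reg 13) (.reg 14) (sub (aW (.reg 12) (.reg 13) (.reg 14)) one)) <|
      cond (aW (.reg 12) (.reg 13) (.reg 14)) .skip <|
      .seq (st3 6 (.reg 15) (.reg 13) (.reg 14) (sub (aN (.reg 15) (.reg 13) (.reg 14)) one)) <|
      .seq (st3 7 (.reg 15) (.reg 13) (.reg 14)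
        (sub (aSM (.reg 15) (.reg 13) (.reg 14)) (add (.reg 12) one))) event) .skip

theorem upd3_sub_zero (W : ℕ → ℕ → ℕ → ℕ) (f b a : ℕ) : upd3 W f b a (W f b a - 0) = W := by
  funext f' b' a'
  simp only [upd3]
  split
  · rename_i h; obtain ⟨rfl, rfl, rfl⟩ := h; rfl
  · rfl

/-- Constant amortised cost: when `N` drops to at most 1, `sumN` drops by one and frees `48 * D`
credits, more than the `44 * D` needed by `event`. -/
theorem decW_spec {Λ : Layout} {X : Net} (hX : Fits Λ X)
    {Pend : ℕ → ℕ → Prop} {s : ASt} {k f b a c : ℕ} (hS : Stat X s)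
    (hI : SInv X (fun _ _ _ => True) Pend s)
    (hf : f < X.E) (hb : b < X.d) (ha : a < X.d) (hc : c < X.d)
    (h11 : s.reg 11 = c) (h12 : s.reg 12 = f) (h13 : s.reg 13 = b) (h14 : s.reg 14 = a)
    (h15 : s.reg 15 = X.src f)
    (hA : ∀ i < X.n, ∀ a < X.d, s.alv i a ≤ 1) (hW : X.loss c f b a ≤ s.a3 5 f b a)
    (hk : pot Λ s + 9 ≤ k) :
    WP Λ decW (fun s' k' => SInv X (fun _ _ _ => True) Pend s' ∧
      Same [7, 8, 16, 17] [5, 6, 7, 8, 9] s s' ∧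
      s'.a3 5 = upd3 (s.a3 5) f b a (s.a3 5 f b a - X.loss c f b a) ∧
      pot Λ s' + k ≤ pot Λ s + 9 + k') s k := by
  have hn := hX.n
  have hd := hX.d
  have hE := hX.E
  have hD : Λ.D = Λ.d + 1 := rfl
  have hF : Λ.F = Λ.n + 2 * Λ.e := rfl
  have hi := hX.src f hf
  have hr1 := hS.rel f hf b hb c hc
  have hr2 := hS.rel f hf a ha c hc
  refine WP.ite hX.valid (by omega) (by rfl) ?_ ?_ ?_
  · simp only [Ok, val, h12, h13, h11, h14]; simp; omega
  · intro hv
    simp only [val, h12, h13, h11, h14, hr1, hr2, BinOp.apply] at hv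
    have hloss : X.loss c f b a = 1 := by
      refine if_pos ⟨?_, ?_⟩
      · by_contra h; simp [h] at hv
      · intro h; simp [h] at hv
    rw [hloss] at hW ⊢
    refine WP.prim_seq (by omega) (Prim.st3 hX.valid (by rfl) ?_ (by rfl) (by rfl) ?_) ?_
    · simp only [Ok, val, h12, h13, h14]; simp; omega
    · simp only [Ok, val, h12, h13, h14]; simp; omega
    simp only [val, h12, h13, h14, BinOp.apply]
    refine WP.ite hX.valid (by omega) (by rfl) ?_ ?_ ?_
    · simp [Ok, val, h12, h13, h14]; omega
    · intro hv
      simp only [val, h12, h13, h14, ASt.set3_reg, ASt.set3_a3, if_true, upd3, and_self] at hv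
      refine WP.skip (by omega) ⟨?_, ⟨fun _ _ => rfl, ?_, rfl, rfl⟩, by simp, ?_⟩
      · have := hI.dec_pos (b := b) (a := a) hf (by omega)
        simpa [SInv] using this
      · intro α hα
        have : α ≠ 5 := by intro h; simp [h] at hα
        simp [this]
      · have : pot Λ (s.set3 5 f b a (s.a3 5 f b a - 1)) = pot Λ s := by
          simp [pot, tok]
        omega
    · intro hv
      simp only [val, h12, h13, h14, ASt.set3_reg, ASt.set3_a3, if_true, upd3, and_self] at hv
      have hW1 : s.a3 5 f b a - 1 = 0 := hv
      rw [hW1]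
      refine WP.prim_seq (by omega) (Prim.st3 hX.valid (by rfl) ?_ (by rfl) (by rfl) ?_) ?_
      · simp [Ok, val, h15, h13, h14]; omega
      · simp [Ok, val, h15, h13, h14]; omega
      simp only [val, h15, h13, h14, BinOp.apply, ASt.set3_reg]
      refine WP.prim_seq (by omega) (Prim.st3 hX.valid (by rfl) ?_ (by rfl) (by rfl) ?_) ?_
      · simp [Ok, val, h15, h13, h14]; omega
      · simp [Ok, val, h15, h13, h14]; omega
      simp only [val, h12, h15, h13, h14, BinOp.apply, ASt.set3_reg]
      obtain ⟨hI1, hN0⟩ := hI.dec_zero (i := X.src f) hf hi hb ha rfl (by omega : s.a3 5 f b a ≠ 0)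
      have e6 : (s.set3 5 f b a 0).a3 6 = s.a3 6 := by simp
      have e7 : ((s.set3 5 f b a 0).set3 6 (X.src f) b a (s.a3 6 (X.src f) b a - 1)).a3 7 = s.a3 7 := by
        simp
      rw [e6, e7]
      set s₁ := ((s.set3 5 f b a 0).set3 6 (X.src f) b a (s.a3 6 (X.src f) b a - 1)).set3 7
        (X.src f) b a (s.a3 7 (X.src f) b a - (f + 1)) with hs₁
      have g6 : s₁.a3 6 = upd3 (s.a3 6) (X.src f) b a (s.a3 6 (X.src f) b a - 1) := by
        simp [hs₁]
      have g5 : s₁.a3 5 = upd3 (s.a3 5) f b a 0 := by simp [hs₁]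
      have g7 : s₁.a3 7 = upd3 (s.a3 7) (X.src f) b a (s.a3 7 (X.src f) b a - (f + 1)) := by
        simp [hs₁]
      -- Between the change of `N` and the event, this triple is the only one not examined.
      have hI2 : SInv X (fun i' b' a' => ¬ (i' = X.src f ∧ b' = b ∧ a' = a)) Pend s₁ := by
        simp only [SInv, g5, g6, g7]
        simpa [hs₁] using hI1
      have hS2 : Stat X s₁ := by
        constructor
        · simpa [hs₁] using hS.src
        · simpa [hs₁] using hS.dst
        · simpa [hs₁] using hS.rel
        · simpa [hs₁] using hS.head
        · simpa [hs₁] using hS.next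
      have ht : tok Λ s₁ = tok Λ s := tok_eq rfl rfl rfl
      have hg : s₁.a3 6 (X.src f) b a = s.a3 6 (X.src f) b a - 1 := by simp [g6, upd3]
      have hsum := sumN_dec (n := Λ.n) (d := Λ.d) (N := s.a3 6) (i := X.src f) (b := b) (a := a)
        (by omega) (by omega) (by omega) hN0
      rw [← g6] at hsum
      have hpot : pot Λ s₁ + (if s₁.a3 6 (X.src f) b a ≤ 1 then 44 * Λ.D else 0) ≤ pot Λ s := by
        simp only [pot, ht, ← hsum]
        rw [hg]
        by_cases h2 : s.a3 6 (X.src f) b a ≤ 2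
        · rw [if_pos h2, if_pos (by omega), mul_add]; omega
        · rw [if_neg h2, if_neg (by omega), add_zero, add_zero]
      simp only [pot] at hk hpot ⊢
      refine WP.imp (event_spec hX (P' := fun _ _ _ => True) hS2 hI2 hi hb ha
        (by simpa [hs₁] using h15) (by simpa [hs₁] using h13) (by simpa [hs₁] using h14)
        (by simpa [hs₁] using hA _ hi _ ha) (fun h => h ⟨rfl, rfl, rfl⟩)
        (fun i' b' a' => by simp [Classical.em, or_comm]) (by omega)) ?_
      rintro s' k' hk' ⟨q1, q2, q3⟩
      have q6 : s'.a3 6 = s₁.a3 6 := q2.a3 6 (by decide)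
      refine ⟨q1, ⟨?_, ?_, ?_, ?_⟩, ?_, ?_⟩
      · intro r hr
        rw [q2.reg r hr]; rfl
      · intro α hα
        have hα' : α ≠ 5 ∧ α ≠ 6 ∧ α ≠ 7 ∧ α ≠ 8 ∧ α ≠ 9 := by simpa using hα
        rw [q2.a3 α (by simp [hα'])]
        simp [hs₁, hα']
      · rw [q2.alv]; rfl
      · rw [q2.out]; rfl
      · rw [q2.a3 5 (by decide), g5]
      · rw [q6]
        omega
  · intro hv
    simp only [val, h12, h13, h11, h14, hr1, hr2, BinOp.apply] at hv
    have hloss : X.loss c f b a = 0 := by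
      refine if_neg ?_
      rintro ⟨h1, h2⟩
      simp [h1, h2] at hv
    rw [hloss, upd3_sub_zero]
    exact WP.skip (by omega) ⟨hI, Same.refl _ _ _, rfl, by omega⟩

/-! ### The loop over the constraints at a variable -/

def forEdges (p : Program) : Program :=
  .seq (set 18 (aHead (.reg 10))) <| loop (.reg 18) <|
    .seq p (set 18 (aNext (sub (.reg 18) one)))

/-- The number of constraints below `g` with source `j`. -/
def Net.deg (X : Net) (j g : ℕ) : ℕ := ((Finset.range g).filter fun f => X.src f = j).card

theorem Net.deg_succ (X : Net) (j g : ℕ) :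
    X.deg j (g + 1) = X.deg j g + if X.src g = j then 1 else 0 := by
  simp only [Net.deg, Finset.range_add_one, Finset.filter_insert]
  split
  · rw [Finset.card_insert_of_notMem (by simp)]
  · rfl

/-- A link of the list skips the constraints with other sources. A property `T` stable under such
skips is carried down from one member of the list to the next, while `deg` counts the members still
ahead. -/
theorem Net.prv_cases (X : Net) (j : ℕ) {T : ℕ → Prop} {m : ℕ}
    (hT : ∀ g < m, X.src g ≠ j → T (g + 1) → T g) (g : ℕ) (hg : g ≤ m) :
    (X.prv j g = 0 → T g → T 0) ∧ (X.prv j g ≠ 0 → ∃ h < g, X.prv j g = h + 1 ∧ X.src h = j ∧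
      X.deg j g = X.deg j h + 1 ∧ (T g → T (h + 1))) := by
  induction g with
  | zero => exact ⟨fun _ h => h, fun h => absurd rfl h⟩
  | succ g ih =>
    obtain ⟨h1, h2⟩ := ih (by omega)
    rw [Net.deg_succ]
    simp only [Net.prv]
    by_cases hs : X.src g = j
    · simp only [if_pos hs]
      exact ⟨fun h => by omega, fun _ => ⟨g, by omega, rfl, hs, rfl, id⟩⟩
    · simp only [if_neg hs]
      have h3 := hT g (by omega) hs
      refine ⟨fun h4 h5 => h1 h4 (h3 h5), fun h4 => ?_⟩
      obtain ⟨h, q1, q2, q3, q4, q5⟩ := h2 h4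
      exact ⟨h, by omega, q2, q3, q4, fun h6 => q5 (h3 h6)⟩

/-- `Inv g` describes the state once the constraints numbered `g` or more have been treated, so the
index descends with the list; `hskip` passes over constraints that are not in it. -/
theorem WP.forEdges {Λ : Layout} {X : Net} (hX : Fits Λ X) {p : Program} {s : ASt} {k j : ℕ}
    (φ : ASt → ℕ) (c : ℕ) (Inv : ℕ → ASt → Prop) (hj : j < X.n)
    (hφ : ∀ s v, φ (s.setReg 18 v) = φ s)
    (hskip : ∀ g s, g < X.E → X.src g ≠ j → Inv (g + 1) s → Inv g s)
    (hbody : ∀ g s k, g < X.E → X.src g = j → s.reg 18 = g + 1 → Inv (g + 1) s → φ s + c ≤ k →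
      WP Λ p (fun s' k' => s'.reg 18 = g + 1 ∧ Stat X s' ∧ Inv g (s'.setReg 18 (X.prv j g)) ∧
        φ s' + k ≤ φ s + c + k') s k)
    (h10 : s.reg 10 = j) (hS : Stat X s) (h0 : Inv X.E (s.setReg 18 (X.prv j X.E)))
    (hk : φ s + (X.deg j X.E * (c + 2) + 2) ≤ k) :
    WP Λ (forEdges p) (fun s' k' => Inv 0 s' ∧
      φ s' + k ≤ φ s + (X.deg j X.E * (c + 2) + 2) + k') s k := by
  have hn := hX.n
  have hE := hX.E
  have hD : Λ.D = Λ.d + 1 := rfl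
  have hF : Λ.F = Λ.n + 2 * Λ.e := rfl
  refine WP.prim_seq (by omega) (Prim.set hX.valid (by rfl) (by rfl) (by rfl) ?_) ?_
  · simp only [Ok, val, h10]; simp; omega
  simp only [val, h10, hS.head j hj]
  refine WP.while_rule hX.valid (by rfl) (fun s' k' => ∃ g ≤ X.E, s'.reg 18 = X.prv j g ∧
    Inv g s' ∧ φ s' + X.deg j g * (c + 2) + 1 ≤ k' ∧
    φ s' + k + X.deg j g * (c + 2) ≤ φ s + (X.deg j X.E * (c + 2) + 1) + k') ?_ ?_
  · rintro s₁ k₁ ⟨g, hg, h18, hInv, hk1, hk2⟩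
    obtain ⟨c0, c1⟩ := X.prv_cases j (T := fun g => Inv g s₁) (m := X.E)
      (fun g hg => hskip g s₁ hg) g hg
    refine ⟨by omega, trivial, ?_, ?_⟩
    · intro hv
      simp only [val, h18] at hv
      obtain ⟨h, hhg, hprv, hsrc, hdeg, himp⟩ := c1 hv
      rw [hdeg, add_mul, one_mul] at hk1 hk2
      refine WP.seq (WP.imp (hbody h s₁ (k₁ - 1) (by omega) hsrc (by omega) (himp hInv) (by omega)) ?_)
      rintro s₂ k₂ hk₂ ⟨q1, q2, q3, q4⟩
      refine WP.prim (by omega) (Prim.set hX.valid (by rfl) (by rfl) (by rfl) ?_) ?_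
      · simp only [Ok, val, q1, BinOp.apply]; simp; omega
      have hv2 : (aNext (sub (.reg 18) one)).val Λ s₂ = X.prv j h := by
        simp only [val, q1, BinOp.apply, Nat.add_sub_cancel]
        rw [q2.next h (by omega), hsrc]
      rw [hv2]
      refine ⟨h, by omega, by simp, q3, ?_, ?_⟩
      · rw [hφ]; omega
      · rw [hφ]; omega
    · intro hv
      simp only [val, h18] at hv
      exact ⟨c0 hv hInv, by omega⟩
  · refine ⟨X.E, le_rfl, by simp, h0, ?_, ?_⟩
    · rw [hφ]; omega
    · rw [hφ]; omega

end RAM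

namespace RAM

open AExpr

/-! ### The elimination of a value -/

def decRow : Program := forTo 14 .d decW

/-- All conditions `(f, b)` are pushed again, because the value lost by the destination of `f` may
have been the last one without support. -/
def touch : Program := forTo 13 .d (.seq (pushC 12 13) decRow)

def revExpr (h : AExpr) : AExpr :=
  sub (add h (mul .e (lt h .e))) (mul .e (sub one (lt h .e)))

/-- The list at `x_j` runs through the constraints with source `x_j`, but the elimination affects
those with destination `x_j`, which are their reversals. -/
def edgeBody : Program :=
  .seq (set 12 (revExpr (sub (.reg 18) one))) <| .seq (set 15 (aSrc (.reg 12))) touch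

theorem decRow_spec {Λ : Layout} {X : Net} (hX : Fits Λ X)
    {Pend : ℕ → ℕ → Prop} {s : ASt} {k f b c : ℕ} (hS : Stat X s)
    (hI : SInv X (fun _ _ _ => True) Pend s)
    (hf : f < X.E) (hb : b < X.d) (hc : c < X.d)
    (h11 : s.reg 11 = c) (h12 : s.reg 12 = f) (h13 : s.reg 13 = b) (h15 : s.reg 15 = X.src f)
    (hA : ∀ i < X.n, ∀ a < X.d, s.alv i a ≤ 1) (hW : ∀ a < X.d, X.loss c f b a ≤ s.a3 5 f b a)
    (hk : pot Λ s + (11 * Λ.d + 2) ≤ k) :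
    WP Λ decRow (fun s' k' => SInv X (fun _ _ _ => True) Pend s' ∧
      Same [7, 8, 14, 16, 17] [5, 6, 7, 8, 9] s s' ∧
      (∀ f' b' a', s'.a3 5 f' b' a' = s.a3 5 f' b' a' -
        if f' = f ∧ b' = b ∧ a' < X.d then X.loss c f b a' else 0) ∧
      pot Λ s' + k ≤ pot Λ s + (11 * Λ.d + 2) + k') s k := by
  have hd := hX.d
  refine WP.imp (WP.forTo hX.valid (pot Λ) 9 Λ.d (fun a s₁ =>
    SInv X (fun _ _ _ => True) Pend s₁ ∧ Same [7, 8, 14, 16, 17] [5, 6, 7, 8, 9] s s₁ ∧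
    ∀ f' b' a', s₁.a3 5 f' b' a' = s.a3 5 f' b' a' -
        if f' = f ∧ b' = b ∧ a' < a then X.loss c f b a' else 0)
    (by rfl) (by rfl) (fun _ => ⟨rfl, trivial⟩) (fun _ _ => pot_setReg (by decide)) ?_ ?_ ?_) ?_
  · rintro a s₁ k₁ ha h14 ⟨q1, q2, q3⟩ hk₁
    have hW1 : s₁.a3 5 f b a = s.a3 5 f b a := by
      rw [q3, if_neg (by omega), Nat.sub_zero]
    refine WP.imp (decW_spec hX (c := c) (q2.stat hS (by decide)) q1 hf hb (a := a) (by omega) hc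
      ((q2.reg 11 (by decide)).trans h11) ((q2.reg 12 (by decide)).trans h12)
      ((q2.reg 13 (by decide)).trans h13) h14 ((q2.reg 15 (by decide)).trans h15)
      (by rw [q2.alv]; exact hA) (by rw [hW1]; exact hW a (by omega)) hk₁) ?_
    rintro s' k' hk' ⟨r1, r2, r3, r4⟩
    refine ⟨(r2.reg 14 (by decide)).trans h14, ⟨r1.setReg (by decide) (by decide),
      (q2.trans (r2.mono (by decide) (by decide))).setReg (by decide), ?_⟩, r4⟩
    intro f' b' a'
    rw [ASt.setReg_a3, r3, hW1]
    simp only [upd3]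
    by_cases h' : f' = f ∧ b' = b ∧ a' = a
    · obtain ⟨rfl, rfl, rfl⟩ := h'
      simp
    · rw [if_neg h', q3]
      congr 1
      refine if_congr ?_ rfl rfl
      constructor
      · rintro ⟨h1, h2, h3⟩; exact ⟨h1, h2, by omega⟩
      · rintro ⟨h1, h2, h3⟩
        exact ⟨h1, h2, by by_contra h5; exact h' ⟨h1, h2, by omega⟩⟩
  · refine ⟨hI.setReg (by decide) (by decide), (Same.refl _ _ _).setReg (by decide), ?_⟩
    intro f' b' a'
    simp
  · omega
  · rintro s' k' hk' ⟨-, ⟨h1, h2, h3⟩, h4⟩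
    rw [hd]
    exact ⟨h1, h2, h3, by omega⟩

theorem touch_spec {Λ : Layout} {X : Net} (hX : Fits Λ X)
    {Pend : ℕ → ℕ → Prop} {s : ASt} {k f c : ℕ} (hS : Stat X s)
    (hI : SInv X (fun _ _ _ => True) Pend s) (hf : f < X.E) (hc : c < X.d)
    (h11 : s.reg 11 = c) (h12 : s.reg 12 = f) (h15 : s.reg 15 = X.src f)
    (hA : ∀ i < X.n, ∀ a < X.d, s.alv i a ≤ 1)
    (hW : ∀ b < X.d, ∀ a < X.d, X.loss c f b a ≤ s.a3 5 f b a)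
    (hk : pot Λ s + 43 * (Λ.D * Λ.D) ≤ k) :
    WP Λ touch (fun s' k' => SInv X (fun _ _ _ => True) (fun f' b' => Pend f' b' ∧ f' ≠ f) s' ∧
      Same [7, 8, 13, 14, 16, 17] [5, 6, 7, 8, 9] s s' ∧
      (∀ f' b' a', s'.a3 5 f' b' a' = s.a3 5 f' b' a' -
        if f' = f ∧ b' < X.d ∧ a' < X.d then X.loss c f b' a' else 0) ∧
      pot Λ s' + k ≤ pot Λ s + 43 * (Λ.D * Λ.D) + k') s k := by
  have hd := hX.d
  have hD : Λ.D = Λ.d + 1 := rfl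
  have hcost : Λ.d * (43 * Λ.D + 2) + 2 ≤ 43 * (Λ.D * Λ.D) := by
    rw [hD]; ring_nf; omega
  refine WP.imp (WP.forTo hX.valid (pot Λ) (43 * Λ.D) Λ.d (fun b s₁ =>
    SInv X (fun _ _ _ => True) (fun f' b' => Pend f' b' ∧ ¬ (f' = f ∧ b' < b)) s₁ ∧
    Same [7, 8, 13, 14, 16, 17] [5, 6, 7, 8, 9] s s₁ ∧
    ∀ f' b' a', s₁.a3 5 f' b' a' = s.a3 5 f' b' a' -
        if f' = f ∧ b' < b ∧ a' < X.d then X.loss c f b' a' else 0)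
    (by rfl) (by rfl) (fun _ => ⟨rfl, trivial⟩) (fun _ _ => pot_setReg (by decide)) ?_ ?_ ?_) ?_
  · rintro b s₁ k₁ hb h13 ⟨q1, q2, q3⟩ hk₁
    have hW1 : ∀ a, s₁.a3 5 f b a = s.a3 5 f b a := by
      intro a
      rw [q3, if_neg (by omega), Nat.sub_zero]
    simp only [pot] at hk₁
    refine WP.seq (WP.imp (pushC_spec hX (by rfl) (by rfl) (by omega)) ?_)
    rintro s₂ k₂ hk₂ ⟨p1, p2, p3, p4⟩
    have e12 : s₁.reg 12 = f := (q2.reg 12 (by decide)).trans h12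
    have hI2 : SInv X (fun _ _ _ => True) (fun f' b' => Pend f' b' ∧ ¬ (f' = f ∧ b' < b + 1)) s₂ := by
      have := q1.push_c (cq' := cSet s₂)
        (Pend' := fun f' b' => Pend f' b' ∧ ¬ (f' = f ∧ b' < b + 1)) (b := b) hf (by omega)
        (fun f' b' => by rw [p3, e12, h13]) ?_
      · simp only [SInv, p1.alv, p2, p1.a3 5 (by decide), p1.a3 6 (by decide), p1.a3 7 (by decide),
          p1.a3 8 (by decide), p1.a3 9 (by decide)]
        exact this
      · rintro f' b' ⟨h1, h2⟩
        by_cases h3 : f' = f ∧ b' = b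
        · exact Or.inr h3
        · refine Or.inl ⟨h1, ?_⟩
          rintro ⟨h4, h5⟩
          exact h2 ⟨h4, by by_contra h6; exact h3 ⟨h4, by omega⟩⟩
    have p6 : s₂.a3 6 = s₁.a3 6 := p1.a3 6 (by decide)
    refine WP.imp (decRow_spec hX (c := c) (b := b) (p1.stat (q2.stat hS (by decide)) (by decide)) hI2 hf
      (by omega) hc (by rw [p1.reg 11 (by decide), q2.reg 11 (by decide), h11])
      (by rw [p1.reg 12 (by decide), e12]) (by rw [p1.reg 13 (by decide), h13])
      (by rw [p1.reg 15 (by decide), q2.reg 15 (by decide), h15])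
      (by rw [p1.alv, q2.alv]; exact hA)
      (fun a ha => by rw [p1.a3 5 (by decide), hW1]; exact hW b (by omega) a ha)
      (by simp only [pot, p6]; omega)) ?_
    rintro s' k' hk' ⟨r1, r2, r3, r4⟩
    refine ⟨?_, ⟨r1.setReg (by decide) (by decide),
      ((q2.trans (p1.mono (by decide) (by decide))).trans
        (r2.mono (by decide) (by decide))).setReg (by decide), ?_⟩, ?_⟩
    · rw [r2.reg 13 (by decide), p1.reg 13 (by decide), h13]
    · intro f' b' a'
      rw [ASt.setReg_a3, r3, p1.a3 5 (by decide)]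
      by_cases h' : f' = f ∧ b' = b ∧ a' < X.d
      · obtain ⟨rfl, rfl, h3⟩ := h'
        rw [hW1, if_pos ⟨rfl, rfl, h3⟩, if_pos ⟨rfl, by omega, h3⟩]
      · rw [if_neg h', Nat.sub_zero, q3]
        congr 1
        refine if_congr ?_ rfl rfl
        constructor
        · rintro ⟨h1, h2, h3⟩; exact ⟨h1, by omega, h3⟩
        · rintro ⟨h1, h2, h3⟩
          exact ⟨h1, by by_contra h5; exact h' ⟨h1, by omega, h3⟩, h3⟩
    · simp only [pot, p6] at r4 ⊢
      omega
  · refine ⟨?_, (Same.refl _ _ _).setReg (by decide), ?_⟩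
    · refine SInv.setReg (Net.Inv.imp hI (fun _ _ _ => Iff.rfl) ?_) (by decide) (by decide)
      exact fun f' b' _ _ h => ⟨h, by omega⟩
    · intro f' b' a'
      simp
  · omega
  · rintro s' k' hk' ⟨-, ⟨h1, h2, h3⟩, h4⟩
    refine ⟨Net.Inv.imp h1 (fun _ _ _ => Iff.rfl) ?_, h2, ?_, by omega⟩
    · rintro f' b' _ hb' ⟨h5, h6⟩
      exact ⟨h5, fun h7 => h6 ⟨h7, by omega⟩⟩
    · rw [hd] at h3 ⊢
      exact h3

/-! ### Reversal of the oriented constraints. -/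

theorem Net.rev_lt {Λ : Layout} {X : Net} (hX : Fits Λ X) {f : ℕ} (hf : f < X.E) :
    X.rev f < X.E := by
  have := hX.E
  simp only [Net.rev]
  split <;> omega

theorem Net.rev_rev {Λ : Layout} {X : Net} (hX : Fits Λ X) {f : ℕ} (hf : f < X.E) :
    X.rev (X.rev f) = f := by
  have := hX.E
  simp only [Net.rev]
  split <;> split <;> omega

theorem revExpr_val {Λ : Layout} {X : Net} (hX : Fits Λ X) {s : ASt} {x : AExpr} {h : ℕ}
    (hx : x.val Λ s = h) : (revExpr x).val Λ s = X.rev h := by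
  have := hX.E
  have h2 : X.E / 2 = Λ.e := by omega
  simp only [revExpr, val, BinOp.apply, hx, Net.rev, h2]
  split <;> simp

/-- Reversal is an involution exchanging source and destination. Hence each constraint with
destination `x_j` is met exactly once, at the step of its reversal, and the pending pairs, those
with `X.rev f < g`, disappear as `g` descends to 0. -/
theorem edges_spec {Λ : Layout} {X : Net} (hX : Fits Λ X) {s : ASt} {k j c : ℕ} (hS : Stat X s)
    (hI : SInv X (fun _ _ _ => True) (fun f _ => X.dst f = j) s) (hj : j < X.n) (hc : c < X.d)
    (h10 : s.reg 10 = j) (h11 : s.reg 11 = c)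
    (hA : ∀ i < X.n, ∀ a < X.d, s.alv i a ≤ 1)
    (hW : ∀ f < X.E, X.dst f = j → ∀ b < X.d, ∀ a < X.d, X.loss c f b a ≤ s.a3 5 f b a)
    (hk : pot Λ s + (X.deg j X.E * (43 * (Λ.D * Λ.D) + 4) + 2) ≤ k) :
    WP Λ (forEdges edgeBody) (fun s' k' =>
      SInv X (fun _ _ _ => True) (fun _ _ => False) s' ∧
      Same [7, 8, 12, 13, 14, 15, 16, 17, 18] [5, 6, 7, 8, 9] s s' ∧
      (∀ f < X.E, ∀ b < X.d, ∀ a < X.d, s'.a3 5 f b a = s.a3 5 f b a -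
        if X.dst f = j then X.loss c f b a else 0) ∧
      pot Λ s' + k ≤ pot Λ s + (X.deg j X.E * (43 * (Λ.D * Λ.D) + 4) + 2) + k') s k := by
  have hn := hX.n
  have hd := hX.d
  have hE := hX.E
  have hD : Λ.D = Λ.d + 1 := rfl
  have hF : Λ.F = Λ.n + 2 * Λ.e := rfl
  refine WP.imp (WP.forEdges hX (pot Λ) (43 * (Λ.D * Λ.D) + 2) (fun g s₁ =>
    SInv X (fun _ _ _ => True) (fun f _ => X.dst f = j ∧ X.rev f < g) s₁ ∧
    Same [7, 8, 12, 13, 14, 15, 16, 17, 18] [5, 6, 7, 8, 9] s s₁ ∧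
      (∀ f < X.E, ∀ b < X.d, ∀ a < X.d, s₁.a3 5 f b a = s.a3 5 f b a -
        if X.dst f = j ∧ g ≤ X.rev f then X.loss c f b a else 0))
    hj (fun _ _ => pot_setReg (by decide)) ?_ ?_ h10 hS ?_ ?_) ?_
  · rintro g s₁ hg hsrc ⟨q1, q2, q3⟩
    have key : ∀ f < X.E, X.dst f = j → X.rev f ≠ g := by
      rintro f hf hdst rfl
      exact hsrc (by rw [hX.src_rev f hf, hdst])
    refine ⟨q1.imp (fun _ _ _ => Iff.rfl) ?_, q2, ?_⟩
    · rintro f _ hf _ ⟨h1, h2⟩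
      have := key f hf h1
      exact ⟨h1, by omega⟩
    · intro f hf b hb a ha
      rw [q3 f hf b hb a ha]
      congr 1
      refine if_congr ?_ rfl rfl
      constructor
      · rintro ⟨h1, h2⟩; exact ⟨h1, by omega⟩
      · rintro ⟨h1, h2⟩
        have := key f hf h1
        exact ⟨h1, by omega⟩
  · rintro g s₁ k₁ hg hsrc h18 ⟨q1, q2, q3⟩ hk₁
    have hrl := Net.rev_lt hX hg
    have hrr := Net.rev_rev hX hg
    have hdr : X.dst (X.rev g) = j := by rw [hX.dst_rev g hg, hsrc]
    have hS1 : Stat X s₁ := q2.stat hS (by decide)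
    have hval : (revExpr (sub (.reg 18) one)).val Λ s₁ = X.rev g :=
      revExpr_val hX (by simp only [val, BinOp.apply, h18]; omega)
    -- `revExpr` contains an addition of `e`, so it is not `tame`; its value is bounded by the
    -- number of oriented constraints instead.
    refine WP.prim_seq (by omega) (Prim.set_of_le hX.valid (by rfl) (by rfl) ?_ ?_) ?_
    · simp [Ok, revExpr]
    · rw [hval]
      have h1 := hX.valid.len
      have h2 : Λ.F * 1 * 1 ≤ Λ.F * Λ.D * Λ.D := by gcongr <;> omega
      simp only [Layout.low]; omega
    rw [hval]
    refine WP.prim_seq (by omega) (Prim.set hX.valid (by rfl) (by rfl) (by rfl) ?_) ?_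
    · simp [Ok, val]; omega
    have hval2 : (aSrc (.reg 12)).val Λ (s₁.setReg 12 (X.rev g)) = X.src (X.rev g) := by
      simp only [val, ASt.setReg_a3, ASt.setReg_reg, if_true]
      exact hS1.src _ hrl
    rw [hval2]
    set s₂ := (s₁.setReg 12 (X.rev g)).setReg 15 (X.src (X.rev g)) with hs₂
    have t2 : Same [7, 8, 12, 13, 14, 15, 16, 17, 18] [5, 6, 7, 8, 9] s s₂ :=
      (q2.setReg (by decide)).setReg (by decide)
    have hp2 : pot Λ s₂ = pot Λ s₁ := by rw [hs₂, pot_setReg (by decide), pot_setReg (by decide)]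
    have hI2 := (q1.setReg (r := 12) (v := X.rev g) (by decide) (by decide)).setReg (r := 15)
      (v := X.src (X.rev g)) (by decide) (by decide)
    rw [← hs₂] at hI2
    refine WP.imp (touch_spec hX (f := X.rev g) (c := c) ((hS1.setReg _ _).setReg _ _) hI2 hrl hc
      (by rw [t2.reg 11 (by decide), h11]) (by simp [hs₂]) (by simp [hs₂])
      (by rw [t2.alv]; exact hA) ?_ (by rw [hp2]; omega)) ?_
    · intro b hb a ha
      have : s₂.a3 5 = s₁.a3 5 := rfl
      rw [this, q3 _ hrl b hb a ha, if_neg (by rw [hrr]; omega), Nat.sub_zero]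
      exact hW _ hrl hdr b hb a ha
    · rintro s' k' hk' ⟨r1, r2, r3, r4⟩
      refine ⟨?_, r2.stat ((hS1.setReg _ _).setReg _ _) (by decide), ⟨?_,
        (t2.trans (r2.mono (by decide) (by decide))).setReg (by decide), ?_⟩, by omega⟩
      · rw [r2.reg 18 (by decide)]; simp [hs₂, h18]
      · refine SInv.setReg (Net.Inv.imp r1 (fun _ _ _ => Iff.rfl) ?_) (by decide) (by decide)
        rintro f _ hf _ ⟨⟨h1, h2⟩, h3⟩
        refine ⟨h1, ?_⟩
        have : X.rev f ≠ g := by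
          rintro rfl
          exact h3 (Net.rev_rev hX hf).symm
        omega
      · intro f hf b hb a ha
        have e5 : s₂.a3 5 = s₁.a3 5 := rfl
        rw [ASt.setReg_a3, r3, e5, q3 f hf b hb a ha]
        by_cases hfg : f = X.rev g
        · subst hfg
          rw [hrr, if_neg (by omega), if_pos ⟨rfl, hb, ha⟩, if_pos ⟨hdr, le_rfl⟩]
          omega
        · rw [if_neg (fun h' : f = X.rev g ∧ b < X.d ∧ a < X.d => hfg h'.1), Nat.sub_zero]
          congr 1
          refine if_congr ?_ rfl rfl
          have : X.rev f ≠ g := by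
            rintro rfl
            exact hfg (Net.rev_rev hX hf).symm
          constructor
          · rintro ⟨h1, h2⟩; exact ⟨h1, by omega⟩
          · rintro ⟨h1, h2⟩; exact ⟨h1, by omega⟩
  · refine ⟨SInv.setReg (Net.Inv.imp hI (fun _ _ _ => Iff.rfl) ?_) (by decide) (by decide),
      (Same.refl _ _ _).setReg (by decide), ?_⟩
    · exact fun f _ hf _ h => ⟨h, Net.rev_lt hX hf⟩
    · intro f hf b hb a ha
      have := Net.rev_lt hX hf
      rw [if_neg (by omega)]; rfl
  · omega
  · rintro s' k' hk' ⟨⟨h1, h2, h3⟩, h4⟩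
    refine ⟨h1.imp (fun _ _ _ => Iff.rfl) ?_, h2, ?_, by omega⟩
    · rintro f b _ _ ⟨-, h5⟩; omega
    · intro f hf b hb a ha
      rw [h3 f hf b hb a ha]
      simp

end RAM

namespace RAM

open AExpr

/-! ### Withdrawal of the supports given by a value, and its complete elimination. -/

def subSupports : Program :=
  forTo 17 .d (cond (aRel (.reg 16) (.reg 11) (.reg 17))
    (st3 9 (.reg 16) (.reg 13) (.reg 17) (sub (aS (.reg 16) (.reg 13) (.reg 17)) one)) .skip)

/-- Cancel the supports given by the value in register 11 of the variable in register 10. -/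
def clear : Program :=
  forTo 13 .d <| .seq (set 16 (aG (.reg 10) (.reg 13) (.reg 11))) <|
    cond (.reg 16) (.seq (st3 8 (.reg 10) (.reg 13) (.reg 11) zero) <|
      .seq (set 16 (sub (.reg 16) one)) subSupports) .skip

/-- Eliminate the value in register 11 from the domain of the variable in register 10. -/
def elim : Program :=
  .seq clear <| .seq (stAlv (.reg 10) (.reg 11) zero) <|
    .seq (stOut (add (.reg 1) (.reg 1)) (.reg 10)) <|
    .seq (stOut (add (add (.reg 1) (.reg 1)) one) (.reg 11)) <|
    .seq (set 1 (add (.reg 1) one)) <| forEdges edgeBody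

theorem subSupports_spec {Λ : Layout} {X : Net} (hX : Fits Λ X) {s : ASt} {k g b c : ℕ}
    (hS : Stat X s) (hg : g < X.E) (hb : b < X.d) (hc : c < X.d)
    (h16 : s.reg 16 = g) (h13 : s.reg 13 = b) (h11 : s.reg 11 = c) (hk : 4 * Λ.D ≤ k) :
    WP Λ subSupports (fun s' k' => Same [17] [9] s s' ∧ s'.a1 = s.a1 ∧
      (∀ f b' c', s'.a3 9 f b' c' = s.a3 9 f b' c' -
        if f = g ∧ b' = b ∧ c' < X.d ∧ X.R g c c' = true then 1 else 0) ∧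
      k ≤ 4 * Λ.D + k') s k := by
  have hd := hX.d
  have hE := hX.E
  have hD : Λ.D = Λ.d + 1 := rfl
  have hF : Λ.F = Λ.n + 2 * Λ.e := rfl
  refine WP.imp (WP.forTo hX.valid (fun _ => 0) 2 Λ.d (fun x s₁ => Same [17] [9] s s₁ ∧
    s₁.a1 = s.a1 ∧ ∀ f b' c', s₁.a3 9 f b' c' = s.a3 9 f b' c' -
        if f = g ∧ b' = b ∧ c' < x ∧ X.R g c c' = true then 1 else 0)
    (by rfl) (by rfl) (fun _ => ⟨rfl, trivial⟩) (fun _ _ => rfl) ?_ ?_ ?_) ?_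
  · rintro x s₁ k₁ hx h17 ⟨hsame, ha1, hinv⟩ hk₁
    have e16 : s₁.reg 16 = g := (hsame.reg 16 (by decide)).trans h16
    have e13 : s₁.reg 13 = b := (hsame.reg 13 (by decide)).trans h13
    have e11 : s₁.reg 11 = c := (hsame.reg 11 (by decide)).trans h11
    have hrel : s₁.a3 2 g c x = (X.R g c x).toNat :=
      (hsame.stat hS (by decide)).rel g hg c hc x (by omega)
    refine WP.ite hX.valid (by omega) (by rfl) ?_ ?_ ?_
    · simp only [Ok, val, e16, e11, h17]; simp; omega
    · intro hv
      simp only [val, e16, e11, h17, hrel] at hv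
      have hR : X.R g c x = true := by simpa using hv
      refine WP.prim (by omega) (Prim.st3 hX.valid (by rfl) ?_ (by rfl) (by rfl) ?_) ?_
      · simp only [Ok, val, e16, e13, h17]; simp; omega
      · simp only [Ok, val, e16, e13, h17]; simp; omega
      · simp only [val, e16, e13, h17, BinOp.apply]
        refine ⟨by simpa using h17, ⟨⟨?_, ?_, hsame.alv, hsame.out⟩, ha1, ?_⟩, by omega⟩
        · intro q hq
          have : q ≠ 17 := by simpa using hq
          simp [this, hsame.reg q hq]
        · intro α hα
          have : α ≠ 9 := by simpa using hα
          simp [this, hsame.a3 α hα]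
        · intro f b' c'
          simp only [ASt.setReg_a3, ASt.set3_a3, if_true, upd3]
          by_cases h' : f = g ∧ b' = b ∧ c' = x
          · obtain ⟨rfl, rfl, rfl⟩ := h'
            simp [hinv, hR]
          · rw [if_neg h', hinv]
            congr 1
            refine if_congr ?_ rfl rfl
            constructor
            · rintro ⟨h1, h2, h3, h4⟩; exact ⟨h1, h2, by omega, h4⟩
            · rintro ⟨h1, h2, h3, h4⟩
              exact ⟨h1, h2, by by_contra h5; exact h' ⟨h1, h2, by omega⟩, h4⟩
    · intro hv
      simp only [val, e16, e11, h17, hrel] at hv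
      have hR : ¬ X.R g c x = true := by simpa using hv
      refine WP.skip (by omega) ⟨h17, ⟨hsame.setReg (by decide), ha1, ?_⟩, by omega⟩
      intro f b' c'
      simp only [ASt.setReg_a3]
      rw [hinv]
      congr 1
      refine if_congr ?_ rfl rfl
      constructor
      · rintro ⟨h1, h2, h3, h4⟩; exact ⟨h1, h2, by omega, h4⟩
      · rintro ⟨h1, h2, h3, h4⟩
        refine ⟨h1, h2, ?_, h4⟩
        by_contra h5
        obtain rfl : c' = x := by omega
        exact hR h4
  · refine ⟨(Same.refl _ _ _).setReg (by decide), rfl, ?_⟩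
    intro f b' c'
    simp
  · show 0 + _ ≤ k
    omega
  · rintro s' k' hk' ⟨-, ⟨h1, h2, h3⟩, h4⟩
    rw [hd]
    exact ⟨h1, h2, h3, by omega⟩

/-- `G` names the only constraint in which `c` counts as a replacement of `b`, so one row of `S` at
most has to be corrected for each `b`. -/
theorem clear_spec {Λ : Layout} {X : Net} (hX : Fits Λ X) {s : ASt} {k j c : ℕ}
    (hS : Stat X s) (hj : j < X.n) (hc : c < X.d) (h10 : s.reg 10 = j) (h11 : s.reg 11 = c)
    (hG : ∀ b < X.d, s.a3 8 j b c ≠ 0 → ∃ g < X.E, s.a3 8 j b c = g + 1)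
    (hk : 4 * (Λ.D * Λ.D) + 6 * Λ.D ≤ k) :
    WP Λ clear (fun s' k' => Same [13, 16, 17] [8, 9] s s' ∧ s'.a1 = s.a1 ∧
      (∀ i b a, s'.a3 8 i b a = if b < X.d ∧ i = j ∧ a = c then 0 else s.a3 8 i b a) ∧
      (∀ f b c', s'.a3 9 f b c' = s.a3 9 f b c' -
        if b < X.d ∧ c' < X.d ∧ s.a3 8 j b c = f + 1 ∧ X.R f c c' = true then 1 else 0) ∧
      k ≤ 4 * (Λ.D * Λ.D) + 6 * Λ.D + k') s k := by
  have hn := hX.n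
  have hd := hX.d
  have hE := hX.E
  have hD : Λ.D = Λ.d + 1 := rfl
  have hF : Λ.F = Λ.n + 2 * Λ.e := rfl
  have hcost : Λ.d * (4 * Λ.D + 4 + 2) + 2 ≤ 4 * (Λ.D * Λ.D) + 6 * Λ.D := by
    rw [hD]; ring_nf; omega
  refine WP.imp (WP.forTo hX.valid (fun _ => 0) (4 * Λ.D + 4) Λ.d (fun β s₁ =>
    Same [13, 16, 17] [8, 9] s s₁ ∧ s₁.a1 = s.a1 ∧
    (∀ i b a, s₁.a3 8 i b a = if b < β ∧ i = j ∧ a = c then 0 else s.a3 8 i b a) ∧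
    (∀ f b c', s₁.a3 9 f b c' = s.a3 9 f b c' -
        if b < β ∧ c' < X.d ∧ s.a3 8 j b c = f + 1 ∧ X.R f c c' = true then 1 else 0))
    (by rfl) (by rfl) (fun _ => ⟨rfl, trivial⟩) (fun _ _ => rfl) ?_ ?_ ?_) ?_
  · rintro b s₁ k₁ hb h13 ⟨q1, q2, q3, q4⟩ hk₁
    have e10 : s₁.reg 10 = j := (q1.reg 10 (by decide)).trans h10
    have e11 : s₁.reg 11 = c := (q1.reg 11 (by decide)).trans h11
    have eG : s₁.a3 8 j b c = s.a3 8 j b c := by rw [q3, if_neg (by omega)]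
    refine WP.prim_seq (by omega) (Prim.set hX.valid (by rfl) (by rfl) (by rfl) ?_) ?_
    · simp only [Ok, val, e10, e11, h13]; simp; omega
    simp only [val, e10, e11, h13, eG]
    refine WP.ite hX.valid (by omega) (by rfl) trivial ?_ ?_
    · intro hv
      simp only [val, ASt.setReg_reg, if_true] at hv
      obtain ⟨g, hg, hgv⟩ := hG b (by omega) hv
      refine WP.prim_seq (by omega) (Prim.st3 hX.valid (by rfl) ?_ (by rfl) (by rfl) trivial) ?_
      · simp [Ok, val, e10, e11, h13]; omega
      refine WP.prim_seq (by omega) (Prim.set hX.valid (by rfl) (by rfl) (by rfl) ⟨trivial, trivial⟩) ?_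
      simp only [val, ASt.setReg_reg, ASt.set3_reg, BinOp.apply, if_true, hgv, Nat.add_sub_cancel]
      norm_num only [e10, e11, h13, if_false]
      set s₂ := ((s₁.setReg 16 (g + 1)).set3 8 j b c 0).setReg 16 g with hs₂
      have t2 : Same [13, 16, 17] [8, 9] s s₂ := by
        refine ⟨?_, ?_, q1.alv, q1.out⟩
        · intro r hr
          have hr' : r ≠ 13 ∧ r ≠ 16 ∧ r ≠ 17 := by simpa using hr
          simp [hs₂, hr', q1.reg r hr]
        · intro α hα
          have hα' : α ≠ 8 ∧ α ≠ 9 := by simpa using hα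
          simp [hs₂, hα', q1.a3 α hα]
      have e13 : s₂.reg 13 = b := by simp [hs₂, h13]
      refine WP.imp (subSupports_spec hX (g := g) (b := b) (c := c) (t2.stat hS (by decide)) hg
        (by omega) hc (by simp [hs₂]) e13 (by rw [t2.reg 11 (by decide), h11]) (by omega)) ?_
      rintro s' k' hk' ⟨r1, r2, r3, r4⟩
      refine ⟨(r1.reg 13 (by decide)).trans e13, ⟨(t2.trans (r1.mono (by decide)
        (by decide))).setReg (by decide), r2.trans q2, ?_, ?_⟩, by omega⟩
      · intro i b' a
        rw [ASt.setReg_a3, r1.a3 8 (by decide)]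
        simp only [hs₂, ASt.setReg_a3, ASt.set3_a3, if_true, upd3]
        by_cases h' : i = j ∧ b' = b ∧ a = c
        · rw [if_pos h', if_pos ⟨by omega, h'.1, h'.2.2⟩]
        · rw [if_neg h', q3]
          refine if_congr ?_ rfl rfl
          constructor
          · rintro ⟨h1, h2, h3⟩; exact ⟨by omega, h2, h3⟩
          · rintro ⟨h1, h2, h3⟩
            exact ⟨by by_contra h5; exact h' ⟨h2, by omega, h3⟩, h2, h3⟩
      · intro f b' c'
        have e9 : s₂.a3 9 = s₁.a3 9 := by simp [hs₂]
        rw [ASt.setReg_a3, r3, e9, q4]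
        by_cases hbb : b' = b
        · subst hbb
          rw [if_neg (by omega), Nat.sub_zero]
          congr 1
          refine if_congr ?_ rfl rfl
          constructor
          · rintro ⟨rfl, -, h3, h4⟩; exact ⟨by omega, h3, hgv, h4⟩
          · rintro ⟨-, h3, h4, h5⟩
            obtain rfl : f = g := by omega
            exact ⟨rfl, rfl, h3, h5⟩
        · rw [if_neg (fun h' : f = g ∧ b' = b ∧ c' < X.d ∧ X.R g c c' = true => hbb h'.2.1),
            Nat.sub_zero]
          congr 1
          refine if_congr ?_ rfl rfl
          constructor
          · rintro ⟨h1, h2⟩; exact ⟨by omega, h2⟩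
          · rintro ⟨h1, h2⟩; exact ⟨by omega, h2⟩
    · intro hv
      simp only [val, ASt.setReg_reg, if_true] at hv
      refine WP.skip (by omega) ⟨by simpa using h13, ⟨(q1.setReg (by decide)).setReg (by decide), q2,
        ?_, ?_⟩, by omega⟩
      · intro i b' a
        rw [ASt.setReg_a3, ASt.setReg_a3, q3]
        by_cases h' : b' = b ∧ i = j ∧ a = c
        · obtain ⟨rfl, rfl, rfl⟩ := h'
          simp [hv]
        · refine if_congr ?_ rfl rfl
          constructor
          · rintro ⟨h1, h2⟩; exact ⟨by omega, h2⟩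
          · rintro ⟨h1, h2⟩
            exact ⟨by by_contra h5; exact h' ⟨by omega, h2⟩, h2⟩
      · intro f b' c'
        rw [ASt.setReg_a3, ASt.setReg_a3, q4]
        congr 1
        refine if_congr ?_ rfl rfl
        constructor
        · rintro ⟨h1, h2⟩; exact ⟨by omega, h2⟩
        · rintro ⟨h1, h2, h3, h4⟩
          refine ⟨?_, h2, h3, h4⟩
          by_contra h5
          obtain rfl : b' = b := by omega
          omega
  · refine ⟨(Same.refl _ _ _).setReg (by decide), rfl, ?_, ?_⟩
    · intro i b a; simp
    · intro f b c'; simp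
  · show 0 + _ ≤ k
    omega
  · rintro s' k' hk' ⟨-, ⟨h1, h2, h3, h4⟩, h5⟩
    rw [← hd] at h3 h4
    exact ⟨h1, h2, h3, h4, by omega⟩

/-- The cost is proportional to the degree of the variable plus one. It includes the `64 * D`
credits deposited with the new entry of the list of eliminations. -/
theorem elim_spec {Λ : Layout} {X : Net} (hX : Fits Λ X) {s : ASt} {k j c : ℕ}
    (hS : Stat X s) (hI : SInv X (fun _ _ _ => True) (fun _ _ => False) s)
    (hj : j < X.n) (hc : c < X.d) (h10 : s.reg 10 = j) (h11 : s.reg 11 = c)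
    (hA : ∀ i < X.n, ∀ a < X.d, s.alv i a ≤ 1)
    (hW : ∀ f < X.E, X.dst f = j → ∀ b < X.d, ∀ a < X.d, X.loss c f b a ≤ s.a3 5 f b a)
    (hk : pot Λ s + 80 * (Λ.D * Λ.D) * (X.deg j X.E + 1) ≤ k) :
    WP Λ elim (fun s' k' => Stat X s' ∧ SInv X (fun _ _ _ => True) (fun _ _ => False) s' ∧
      s'.alv = upd2 s.alv j c 0 ∧ s'.reg 1 = s.reg 1 + 1 ∧
      s'.out = Function.update (Function.update s.out (2 * s.reg 1) j) (2 * s.reg 1 + 1) c ∧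
      (∀ f < X.E, ∀ b < X.d, ∀ a < X.d, s'.a3 5 f b a = s.a3 5 f b a -
        if X.dst f = j then X.loss c f b a else 0) ∧
      pot Λ s' + k ≤ pot Λ s + 80 * (Λ.D * Λ.D) * (X.deg j X.E + 1) + k') s k := by
  refine WP.of_le fun hK => ?_
  have hn := hX.n
  have hd := hX.d
  have hE := hX.E
  have hD : Λ.D = Λ.d + 1 := rfl
  have hF : Λ.F = Λ.n + 2 * Λ.e := rfl
  have hDD : Λ.D ≤ Λ.D * Λ.D := Nat.le_mul_of_pos_left _ (by omega)
  have hM : 2 * s.reg 1 + 4 ≤ Λ.M := by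
    refine hX.lt_len (k := k) ?_ hK
    have : 32 * Λ.D * (2 * s.reg 1) ≤ tok Λ s := Nat.mul_le_mul_left _ (by omega)
    simp only [pot] at hk
    omega
  have hcost : 4 * (Λ.D * Λ.D) + 6 * Λ.D + 4 + 64 * Λ.D +
      (X.deg j X.E * (43 * (Λ.D * Λ.D) + 4) + 2) ≤ 80 * (Λ.D * Λ.D) * (X.deg j X.E + 1) := by
    have h1 : X.deg j X.E * (43 * (Λ.D * Λ.D) + 4) ≤ X.deg j X.E * (80 * (Λ.D * Λ.D)) :=
      Nat.mul_le_mul_left _ (by omega)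
    have h2 : 80 * (Λ.D * Λ.D) * (X.deg j X.E + 1) =
      X.deg j X.E * (80 * (Λ.D * Λ.D)) + 80 * (Λ.D * Λ.D) := by ring
    omega
  refine WP.seq (WP.imp (clear_spec hX hS hj hc h10 h11 ?_ (by omega)) ?_)
  · intro b hb h0
    obtain ⟨-, -, g, hg, -, h1, -⟩ := hI.good j hj b hb c hc h0
    exact ⟨g, hg, h1⟩
  rintro s₁ k₁ hk₁ ⟨q1, q2, q3, q4, q5⟩
  have e10 : s₁.reg 10 = j := (q1.reg 10 (by decide)).trans h10
  have e11 : s₁.reg 11 = c := (q1.reg 11 (by decide)).trans h11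
  have e1 : s₁.reg 1 = s.reg 1 := q1.reg 1 (by decide)
  refine WP.prim_seq (by omega) (Prim.stAlv hX.valid (by rfl) ?_ (by rfl) (by rfl) trivial) ?_
  · simp [Ok, val, e10, e11]; omega
  simp only [val, e10, e11]
  refine WP.prim_seq (by omega) (Prim.stOut hX.valid (by rfl) (by decide) ⟨trivial, trivial⟩ ?_
    (by rfl) (by rfl) trivial) ?_
  · simp only [val, ASt.setAlv_reg, BinOp.apply, e1]; omega
  simp only [val, ASt.setAlv_reg, BinOp.apply, e1, e10]
  refine WP.prim_seq (by omega) (Prim.stOut hX.valid (by rfl) (by decide)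
    ⟨⟨trivial, trivial⟩, trivial⟩ ?_ (by rfl) (by rfl) trivial) ?_
  · simp only [val, ASt.setAlv_reg, ASt.setOut_reg, BinOp.apply, e1]; omega
  simp only [val, ASt.setAlv_reg, ASt.setOut_reg, BinOp.apply, e1, e11]
  refine WP.prim_seq (by omega) (Prim.set hX.valid (by rfl) (by rfl) (by rfl) ⟨trivial, trivial⟩) ?_
  simp only [val, ASt.setAlv_reg, ASt.setOut_reg, BinOp.apply, e1]
  set s₂ := (((s₁.setAlv j c 0).setOut (s.reg 1 + s.reg 1) j).setOut (s.reg 1 + s.reg 1 + 1) c).setReg 1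
    (s.reg 1 + 1) with hs₂
  have hS1 : Stat X s₁ := q1.stat hS (by decide)
  have hS2 : Stat X s₂ := ⟨hS1.src, hS1.dst, hS1.rel, hS1.head, hS1.next⟩
  have hns : nsSet s₂ = nsSet s := by
    funext i b a; simp [nsSet, hs₂, q2, q1.reg 7 (by decide)]
  have hcs : cSet s₂ = cSet s := by
    funext f b; simp [cSet, hs₂, q2, q1.reg 8 (by decide)]
  have halv : s₂.alv = upd2 s.alv j c 0 := by simp [hs₂, q1.alv]
  have hI2 : SInv X (fun _ _ _ => True) (fun f _ => X.dst f = j) s₂ := by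
    have := hI.kill (G' := s₂.a3 8) (S' := s₂.a3 9) hj hc q3 (fun f hf b hb c' hc' => by
      have : s₂.a3 9 = s₁.a3 9 := rfl
      rw [this, q4]
      congr 1
      exact if_congr (by simp [hb, hc']) rfl rfl)
    simp only [SInv, hns, hcs, halv]
    have e5 : s₂.a3 5 = s.a3 5 := q1.a3 5 (by decide)
    have e6 : s₂.a3 6 = s.a3 6 := q1.a3 6 (by decide)
    have e7 : s₂.a3 7 = s.a3 7 := q1.a3 7 (by decide)
    rw [e5, e6, e7]
    exact this
  have hpot : pot Λ s₂ = pot Λ s + 64 * Λ.D := by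
    have e6 : s₂.a3 6 = s.a3 6 := q1.a3 6 (by decide)
    have h7 : s₂.reg 7 = s.reg 7 := q1.reg 7 (by decide)
    have h8 : s₂.reg 8 = s.reg 8 := q1.reg 8 (by decide)
    have h1 : s₂.reg 1 = s.reg 1 + 1 := by simp [hs₂]
    simp only [pot, tok, e6, h7, h8, h1]
    ring
  refine WP.imp (edges_spec hX (c := c) hS2 hI2 hj hc (by simp [hs₂, e10]) (by simp [hs₂, e11]) ?_ ?_
    (by rw [hpot]; omega)) ?_
  · intro i hi a ha
    rw [halv]
    simp only [upd2]
    split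
    · omega
    · exact hA i hi a ha
  · intro f hf hdst b hb a ha
    have e5 : s₂.a3 5 = s.a3 5 := q1.a3 5 (by decide)
    rw [e5]
    exact hW f hf hdst b hb a ha
  · rintro s' k' hk' ⟨r1, r2, r3, r4⟩
    refine ⟨r2.stat hS2 (by decide), r1, r2.alv.trans halv, ?_, ?_, ?_, by omega⟩
    · rw [r2.reg 1 (by decide)]; simp [hs₂]
    · rw [r2.out]
      simp only [hs₂, ASt.setReg_out, ASt.setOut_out, ASt.setAlv_out, q1.out, two_mul]
    · have e5 : s₂.a3 5 = s.a3 5 := q1.a3 5 (by decide)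
      rw [e5] at r3
      exact r3

end RAM

namespace RAM

open AExpr

/-! ### The main loop -/

/-- Examine the top of the stack of substitutions. -/
def peekNS : Program :=
  .seq (set 10 (.a1 0 (sub (.reg 7) one))) <| .seq (set 11 (.a1 1 (sub (.reg 7) one))) <|
    .seq (set 14 (.a1 2 (sub (.reg 7) one))) <|
    cond (mul (mul (.alv (.reg 10) (.reg 11)) (.alv (.reg 10) (.reg 14)))
      (sub one (eq (.reg 14) (.reg 11)))) (set 9 one) (set 7 (sub (.reg 7) one))

/-- Register 9 is nonzero at the start iff the value itself survives; any compatible surviving value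
without support clears it. -/
def checkC : Program :=
  forTo 17 .d (cond (mul (mul (.alv (.reg 19) (.reg 17)) (aRel (.reg 12) (.reg 11) (.reg 17)))
    (eq (aS (.reg 12) (.reg 11) (.reg 17)) zero)) (set 9 zero) .skip)

/-- Examine the top of the stack of conditions. -/
def peekC : Program :=
  .seq (set 12 (.a1 3 (sub (.reg 8) one))) <| .seq (set 11 (.a1 4 (sub (.reg 8) one))) <|
    .seq (set 10 (aSrc (.reg 12))) <| .seq (set 19 (aDst (.reg 12))) <|
    .seq (set 9 (.alv (.reg 10) (.reg 11))) <| .seq checkC <|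
    cond (.reg 9) .skip (set 8 (sub (.reg 8) one))

/-- A candidate that passes the test is not popped: its value being eliminated, it fails when it is
examined again and is discarded then. Conditions are examined only when no substitution is waiting,
which gives the required priority. -/
def mainBody : Program :=
  .seq (set 9 zero) <| .seq (cond (.reg 7) peekNS peekC) (cond (.reg 9) elim .skip)

def mainLoop : Program := loop (add (.reg 7) (.reg 8)) mainBody

/-- The value `c` of `x_j` is to be eliminated next. -/
def Cand (X : Net) (s : ASt) (j c : ℕ) : Prop :=
  j < X.n ∧ c < X.d ∧ s.alv j c = 1 ∧
    ((∃ a < X.d, s.alv j a = 1 ∧ a ≠ c ∧ s.a3 6 j c a = 0) ∨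
      (s.reg 7 = 0 ∧ ∃ f < X.E, X.src f = j ∧
        ∀ c' < X.d, s.alv (X.dst f) c' = 1 → X.R f c c' = true → s.a3 9 f c c' ≠ 0))

abbrev MInv (X : Net) (s : ASt) : Prop := SInv X (fun _ _ _ => True) (fun _ _ => False) s

/-- Either the entry is popped and its credits pay for the round with `20 * D` to spare, or a
candidate is found, whose elimination will pay. -/
theorem peekNS_spec {Λ : Layout} {X : Net} (hX : Fits Λ X) {s : ASt} {k : ℕ}
    (hS : Stat X s) (hI : MInv X s) (hA : ∀ i < X.n, ∀ a < X.d, s.alv i a ≤ 1)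
    (h7 : s.reg 7 ≠ 0) (h9 : s.reg 9 = 0)
    (hM : s.reg 7 + 4 ≤ Λ.M) (hk : 13 * Λ.D ≤ k) :
    WP Λ peekNS (fun s' k' => Stat X s' ∧ MInv X s' ∧ s'.alv = s.alv ∧ s'.out = s.out ∧
      s'.reg 1 = s.reg 1 ∧ s'.a3 = s.a3 ∧
      ((s'.reg 9 = 0 ∧ tok Λ s' + k + 20 * Λ.D ≤ tok Λ s + k') ∨
        (s'.reg 9 ≠ 0 ∧ Cand X s' (s'.reg 10) (s'.reg 11) ∧ tok Λ s' = tok Λ s ∧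
          k ≤ k' + 10 * Λ.D))) s k := by
  have hn := hX.n
  have hd := hX.d
  have hD : Λ.D = Λ.d + 1 := rfl
  refine WP.prim_seq (by omega) (Prim.set hX.valid (by rfl) (by rfl) (by rfl) ?_) ?_
  · simp [Ok, val, BinOp.apply]; omega
  refine WP.prim_seq (by omega) (Prim.set hX.valid (by rfl) (by rfl) (by rfl) ?_) ?_
  · simp [Ok, val, BinOp.apply]; omega
  refine WP.prim_seq (by omega) (Prim.set hX.valid (by rfl) (by rfl) (by rfl) ?_) ?_
  · simp [Ok, val, BinOp.apply]; omega
  norm_num only [val, ASt.setReg_reg, ASt.setReg_a1, BinOp.apply, if_false]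
  have hmem : nsSet s (s.a1 0 (s.reg 7 - 1)) (s.a1 1 (s.reg 7 - 1)) (s.a1 2 (s.reg 7 - 1)) :=
    ⟨s.reg 7 - 1, by omega, rfl, rfl, rfl⟩
  obtain ⟨hj, hc, ha, hN⟩ := hI.nsIn _ _ _ hmem
  generalize hj' : s.a1 0 (s.reg 7 - 1) = j at *
  generalize hc' : s.a1 1 (s.reg 7 - 1) = c at *
  generalize ha' : s.a1 2 (s.reg 7 - 1) = a at *
  have hI1 : MInv X (((s.setReg 10 j).setReg 11 c).setReg 14 a) :=
    ((hI.setReg (by decide) (by decide)).setReg (by decide) (by decide)).setReg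
      (by decide) (by decide)
  have hS1 : Stat X (((s.setReg 10 j).setReg 11 c).setReg 14 a) :=
    ((hS.setReg _ _).setReg _ _).setReg _ _
  refine WP.ite hX.valid (by omega) (by rfl) ?_ ?_ ?_
  · simp [Ok, val]; omega
  · intro hv
    norm_num [val, BinOp.apply] at hv
    obtain ⟨⟨hv1, hv2⟩, hv3⟩ := hv
    refine WP.prim (by omega) (Prim.set hX.valid (by rfl) (by rfl) (by rfl) trivial) ?_
    refine ⟨hS1.setReg _ _, hI1.setReg (by decide) (by decide), rfl, rfl, rfl, rfl, Or.inr
      ⟨by simp [val], ?_, tok_eq rfl rfl rfl, by omega⟩⟩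
    norm_num only [ASt.setReg_reg, if_false, if_true]
    have := hA j hj c hc
    have := hA j hj a ha
    refine ⟨hj, hc, ?_, Or.inl ⟨a, ha, ?_, ?_, hN⟩⟩
    · simp only [ASt.setReg_alv]; omega
    · simp only [ASt.setReg_alv]; omega
    · rintro rfl; simp at hv3
  · intro hv
    norm_num [val, BinOp.apply] at hv
    refine WP.prim (by omega) (Prim.set hX.valid (by rfl) (by rfl) (by rfl) ⟨trivial, trivial⟩) ?_
    norm_num only [val, ASt.setReg_reg, BinOp.apply, if_false]
    refine ⟨hS1.setReg _ _, ?_, rfl, rfl, by simp, rfl, Or.inl ⟨by simp [h9], ?_⟩⟩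
    · have hpop := hI.pop_ns (i := j) (b := c) (a := a)
        (ns' := nsSet ((((s.setReg 10 j).setReg 11 c).setReg 14 a).setReg 7 (s.reg 7 - 1))) ?_ ?_ ?_
      · have hcs : cSet ((((s.setReg 10 j).setReg 11 c).setReg 14 a).setReg 7 (s.reg 7 - 1)) = cSet s := by
          funext f b; simp [cSet]
        simp only [MInv, SInv, hcs]
        exact hpop
      · rintro ⟨h1, h2, h3⟩
        simp [h1, h2, h3] at hv
      · rintro i' b' a' ⟨x, hx, h1, h2, h3⟩
        simp at hx
        exact ⟨x, by omega, h1, h2, h3⟩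
      · rintro i' b' a' ⟨x, hx, h1, h2, h3⟩
        by_cases hx7 : x = s.reg 7 - 1
        · subst hx7
          exact Or.inr ⟨by rw [← h1, hj'], by rw [← h2, hc'], by rw [← h3, ha']⟩
        · refine Or.inl ⟨x, ?_, h1, h2, h3⟩
          simp; omega
    · have : tok Λ ((((s.setReg 10 j).setReg 11 c).setReg 14 a).setReg 7 (s.reg 7 - 1)) + 32 * Λ.D =
          tok Λ s := by
        obtain ⟨m, hm⟩ : ∃ m, s.reg 7 = m + 1 := ⟨s.reg 7 - 1, by omega⟩
        simp [tok, hm]; ring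
      omega

theorem uncovered_ne_zero {x z : ℕ} {R : Bool} :
    x * R.toNat * (if z = 0 then 1 else 0) ≠ 0 ↔ x ≠ 0 ∧ R = true ∧ z = 0 := by
  cases R <;> by_cases h : z = 0 <;> simp [h]

theorem checkC_spec {Λ : Layout} {X : Net} (hX : Fits Λ X) {s : ASt} {k f c : ℕ}
    (hS : Stat X s) (hf : f < X.E) (hc : c < X.d) (h12 : s.reg 12 = f) (h11 : s.reg 11 = c)
    (h19 : s.reg 19 = X.dst f) (hA : ∀ i < X.n, ∀ a < X.d, s.alv i a ≤ 1) (hk : 4 * Λ.D ≤ k) :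
    WP Λ checkC (fun s' k' => Same [9, 17] [] s s' ∧ s'.a1 = s.a1 ∧
      (s'.reg 9 ≠ 0 ↔ s.reg 9 ≠ 0 ∧ ∀ c' < X.d, s.alv (X.dst f) c' = 1 → X.R f c c' = true →
        s.a3 9 f c c' ≠ 0) ∧ k ≤ 4 * Λ.D + k') s k := by
  have hn := hX.n
  have hd := hX.d
  have hE := hX.E
  have hD : Λ.D = Λ.d + 1 := rfl
  have hF : Λ.F = Λ.n + 2 * Λ.e := rfl
  refine WP.imp (WP.forTo hX.valid (fun _ => 0) 2 Λ.d (fun x s₁ => Same [9, 17] [] s s₁ ∧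
    s₁.a1 = s.a1 ∧ (s₁.reg 9 ≠ 0 ↔ s.reg 9 ≠ 0 ∧
      ∀ c' < x, s.alv (X.dst f) c' = 1 → X.R f c c' = true → s.a3 9 f c c' ≠ 0))
    (by rfl) (by rfl) (fun _ => ⟨rfl, trivial⟩) (fun _ _ => rfl) ?_ ?_ ?_) ?_
  · rintro x s₁ k₁ hx h17 ⟨q1, q2, q3⟩ hk₁
    have e12 : s₁.reg 12 = f := (q1.reg 12 (by decide)).trans h12
    have e11 : s₁.reg 11 = c := (q1.reg 11 (by decide)).trans h11
    have e19 : s₁.reg 19 = X.dst f := (q1.reg 19 (by decide)).trans h19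
    have hdst := hX.dst f hf
    have hrel : s₁.a3 2 f c x = (X.R f c x).toNat :=
      (q1.stat hS (by decide)).rel f hf c hc x (by omega)
    have hA1 := hA _ hdst x (by omega)
    refine WP.ite hX.valid (by omega) (by rfl) ?_ ?_ ?_
    · simp only [Ok, val, e12, e11, e19, h17]; simp; omega
    · intro hv
      simp only [val, BinOp.apply, e12, e11, e19, h17, hrel, q1.alv, q1.a3 9 (by decide)] at hv
      obtain ⟨v1, v2, v3⟩ := uncovered_ne_zero.1 hv
      refine WP.prim (by omega) (Prim.set hX.valid (by rfl) (by rfl) (by rfl) trivial) ?_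
      refine ⟨by simpa using h17, ⟨(q1.setReg (by decide)).setReg (by decide), q2, ?_⟩, by omega⟩
      norm_num only [ASt.setReg_reg, val, if_false, if_true]
      constructor
      · intro h; exact h.elim
      · rintro ⟨-, h⟩
        exact absurd v3 (h x (by omega) (by omega) v2)
    · intro hv
      simp only [val, BinOp.apply, e12, e11, e19, h17, hrel, q1.alv, q1.a3 9 (by decide)] at hv
      have hv' := mt uncovered_ne_zero.2 (not_not.2 hv)
      refine WP.skip (by omega) ⟨h17, ⟨q1.setReg (by decide), q2, ?_⟩, by omega⟩
      norm_num only [ASt.setReg_reg, if_false]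
      rw [q3]
      refine and_congr_right fun _ => ⟨fun h c' hc' h1 h2 => ?_, fun h c' hc' => h c' (by omega)⟩
      by_cases hcx : c' = x
      · subst hcx
        exact fun h3 => hv' ⟨by omega, h2, h3⟩
      · exact h c' (by omega) h1 h2
  · refine ⟨(Same.refl _ _ _).setReg (by decide), rfl, ?_⟩
    simp
  · show 0 + _ ≤ k
    omega
  · rintro s' k' hk' ⟨-, ⟨h1, h2, h3⟩, h4⟩
    rw [hd]
    exact ⟨h1, h2, h3, by omega⟩

theorem peekC_spec {Λ : Layout} {X : Net} (hX : Fits Λ X) {s : ASt} {k : ℕ}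
    (hS : Stat X s) (hI : MInv X s) (hA : ∀ i < X.n, ∀ a < X.d, s.alv i a ≤ 1)
    (h7 : s.reg 7 = 0) (h8 : s.reg 8 ≠ 0)
    (hM : s.reg 8 + 4 ≤ Λ.M) (hk : 13 * Λ.D ≤ k) :
    WP Λ peekC (fun s' k' => Stat X s' ∧ MInv X s' ∧ s'.alv = s.alv ∧ s'.out = s.out ∧
      s'.reg 1 = s.reg 1 ∧ s'.a3 = s.a3 ∧
      ((s'.reg 9 = 0 ∧ tok Λ s' + k + 20 * Λ.D ≤ tok Λ s + k') ∨
        (s'.reg 9 ≠ 0 ∧ Cand X s' (s'.reg 10) (s'.reg 11) ∧ tok Λ s' = tok Λ s ∧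
          k ≤ k' + 12 * Λ.D))) s k := by
  have hn := hX.n
  have hd := hX.d
  have hE := hX.E
  have hD : Λ.D = Λ.d + 1 := rfl
  have hF : Λ.F = Λ.n + 2 * Λ.e := rfl
  have hmem : cSet s (s.a1 3 (s.reg 8 - 1)) (s.a1 4 (s.reg 8 - 1)) :=
    ⟨s.reg 8 - 1, by omega, rfl, rfl⟩
  obtain ⟨hf, hc⟩ := hI.cIn _ _ hmem
  refine WP.prim_seq (by omega) (Prim.set hX.valid (by rfl) (by rfl) (by rfl) ?_) ?_
  · simp [Ok, val, BinOp.apply]; omega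
  refine WP.prim_seq (by omega) (Prim.set hX.valid (by rfl) (by rfl) (by rfl) ?_) ?_
  · simp [Ok, val, BinOp.apply]; omega
  norm_num only [val, ASt.setReg_reg, ASt.setReg_a1, BinOp.apply, if_false]
  generalize hf' : s.a1 3 (s.reg 8 - 1) = f at *
  generalize hc' : s.a1 4 (s.reg 8 - 1) = c at *
  have hsrc := hX.src f hf
  have hdst := hX.dst f hf
  refine WP.prim_seq (by omega) (Prim.set hX.valid (by rfl) (by rfl) (by rfl) ?_) ?_
  · simp [Ok, val]; omega
  norm_num only [val, ASt.setReg_reg, ASt.setReg_a3, if_false, if_true, hS.src f hf]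
  refine WP.prim_seq (by omega) (Prim.set hX.valid (by rfl) (by rfl) (by rfl) ?_) ?_
  · simp [Ok, val]; omega
  norm_num only [val, ASt.setReg_reg, ASt.setReg_a3, if_false, if_true, hS.dst f hf]
  refine WP.prim_seq (by omega) (Prim.set hX.valid (by rfl) (by rfl) (by rfl) ?_) ?_
  · simp [Ok, val]; omega
  norm_num only [val, ASt.setReg_reg, ASt.setReg_alv, if_false, if_true]
  set s₁ := ((((s.setReg 12 f).setReg 11 c).setReg 10 (X.src f)).setReg 19 (X.dst f)).setReg 9
    (s.alv (X.src f) c) with hs₁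
  have t1 : Same [9, 10, 11, 12, 17, 19] [] s s₁ :=
    (((((Same.refl _ _ _).setReg (by decide)).setReg (by decide)).setReg (by decide)).setReg
      (by decide)).setReg (by decide)
  have hS1 : Stat X s₁ := t1.stat hS (by decide)
  refine WP.seq (WP.imp (checkC_spec hX (f := f) (c := c) hS1 hf hc (by simp [hs₁]) (by simp [hs₁])
    (by simp [hs₁]) hA (by omega)) ?_)
  rintro s₂ k₂ hk₂ ⟨q1, q2, q3, q4⟩
  have e9 : s₁.reg 9 = s.alv (X.src f) c := by simp [hs₁]
  have t2 : Same [9, 10, 11, 12, 17, 19] [] s s₂ := t1.trans (q1.mono (by decide) (by decide))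
  have ha3 : s₂.a3 = s.a3 := by funext α; exact t2.a3 α (by simp)
  have ha1 : s₂.a1 = s.a1 := q2
  have hns : nsSet s₂ = nsSet s := by
    funext i b a; simp only [nsSet, ha1, t2.reg 7 (by decide)]
  have hcs : cSet s₂ = cSet s := by
    funext i b; simp only [cSet, ha1, t2.reg 8 (by decide)]
  have hI2 : MInv X s₂ := by
    simp only [MInv, SInv, hns, hcs, ha3, t2.alv]; exact hI
  have hS2 : Stat X s₂ := t2.stat hS (by decide)
  rw [e9] at q3
  have q3' : s₂.reg 9 ≠ 0 ↔ s.alv (X.src f) c ≠ 0 ∧ ∀ c' < X.d, s.alv (X.dst f) c' = 1 →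
      X.R f c c' = true → s.a3 9 f c c' ≠ 0 := q3
  have hA1 := hA _ hsrc c hc
  refine WP.ite hX.valid (by omega) (by rfl) trivial ?_ ?_
  · intro hv
    simp only [val] at hv
    obtain ⟨h1, h2⟩ := q3'.1 hv
    refine WP.skip (by omega) ⟨hS2, hI2, t2.alv, t2.out, t2.reg 1 (by decide), ha3, Or.inr
      ⟨hv, ?_, tok_eq (t2.reg 7 (by decide)) (t2.reg 8 (by decide)) (t2.reg 1 (by decide)), by omega⟩⟩
    have e10 : s₂.reg 10 = X.src f := (q1.reg 10 (by decide)).trans (by simp [hs₁])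
    have e11 : s₂.reg 11 = c := (q1.reg 11 (by decide)).trans (by simp [hs₁])
    rw [e10, e11]
    refine ⟨hsrc, hc, by rw [t2.alv]; omega, Or.inr ⟨by rw [t2.reg 7 (by decide), h7], f, hf, rfl, ?_⟩⟩
    rw [t2.alv, ha3]
    exact h2
  · intro hv
    simp only [val] at hv
    refine WP.prim (by omega) (Prim.set hX.valid (by rfl) (by rfl) (by rfl) ⟨trivial, trivial⟩) ?_
    have e8 : s₂.reg 8 = s.reg 8 := t2.reg 8 (by decide)
    simp only [val, BinOp.apply, e8]
    refine ⟨hS2.setReg _ _, ?_, t2.alv, t2.out, ?_, ha3, Or.inl ⟨by simpa using hv, ?_⟩⟩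
    · have hpop := hI2.pop_c (f := f) (b := c) (cq' := cSet (s₂.setReg 8 (s.reg 8 - 1))) ?_ ?_ ?_
      · have hns' : nsSet (s₂.setReg 8 (s.reg 8 - 1)) = nsSet s₂ := by
          funext i b a; simp [nsSet]
        simp only [MInv, SInv, hns']
        exact hpop
      · rintro ⟨h1, h2⟩
        rw [t2.alv] at h1 h2
        rw [ha3] at h2
        exact absurd hv (q3'.2 ⟨by omega, h2⟩)
      · rintro f' b' ⟨x, hx, h1, h2⟩
        simp at hx
        exact ⟨x, by omega, h1, h2⟩
      · rintro f' b' ⟨x, hx, h1, h2⟩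
        by_cases hx8 : x = s.reg 8 - 1
        · subst hx8
          rw [ha1] at h1 h2
          exact Or.inr ⟨by rw [← h1, hf'], by rw [← h2, hc']⟩
        · refine Or.inl ⟨x, ?_, h1, h2⟩
          simp; omega
    · rw [← t2.reg 1 (by decide)]; simp
    · have : tok Λ (s₂.setReg 8 (s.reg 8 - 1)) + 32 * Λ.D = tok Λ s := by
        obtain ⟨m, hm⟩ : ∃ m, s.reg 8 = m + 1 := ⟨s.reg 8 - 1, by omega⟩
        simp [tok, hm, t2.reg 7 (by decide), t2.reg 1 (by decide)]; ring
      omega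

/-! ### The counters as functions of the domains -/

/-- `W` counts the obstructions in the domains given by `A`. -/
structure Sem (X : Net) (A : ℕ → ℕ → ℕ) (W : ℕ → ℕ → ℕ → ℕ) : Prop where
  bit : ∀ i < X.n, ∀ a < X.d, A i a ≤ 1
  cnt : ∀ f < X.E, ∀ b < X.d, ∀ a < X.d, W f b a = ((Finset.range X.d).filter fun c =>
    A (X.dst f) c = 1 ∧ X.R f b c = true ∧ ¬ X.R f a c = true).card

/-- If `c` causes a loss then it is itself one of the counted obstructions, so the truncated
subtraction of the loss is exact. -/
theorem Sem.loss_le {X : Net} {A : ℕ → ℕ → ℕ} {W : ℕ → ℕ → ℕ → ℕ} (h : Sem X A W) {j c f b a : ℕ}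
    (hc : c < X.d) (hA : A j c = 1) (hf : f < X.E) (hdst : X.dst f = j) (hb : b < X.d)
    (ha : a < X.d) : X.loss c f b a ≤ W f b a := by
  rw [h.cnt f hf b hb a ha]
  simp only [Net.loss]
  split
  · rename_i hl
    refine Finset.card_pos.2 ⟨c, ?_⟩
    simp only [Finset.mem_filter, Finset.mem_range]
    exact ⟨hc, by rw [hdst, hA], hl⟩
  · omega

theorem Sem.elim {X : Net} {A : ℕ → ℕ → ℕ} {W W' : ℕ → ℕ → ℕ → ℕ} (h : Sem X A W) {j c : ℕ}
    (hc : c < X.d) (hA : A j c = 1) (hW : ∀ f < X.E, ∀ b < X.d, ∀ a < X.d, W' f b a = W f b a -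
      if X.dst f = j then X.loss c f b a else 0) : Sem X (upd2 A j c 0) W' := by
  refine ⟨?_, ?_⟩
  · intro i hi a ha
    simp only [upd2]
    split
    · omega
    · exact h.bit i hi a ha
  · intro f hf b hb a ha
    rw [hW f hf b hb a ha, h.cnt f hf b hb a ha]
    by_cases hdst : X.dst f = j
    · rw [if_pos hdst]
      simp only [Net.loss]
      by_cases hl : X.R f b c = true ∧ ¬ X.R f a c = true
      · rw [if_pos hl, ← Finset.card_erase_of_mem (a := c) (by simp [hc, hdst, hA, hl])]
        congr 1
        ext c'
        simp only [Finset.mem_erase, Finset.mem_filter, Finset.mem_range, upd2, hdst, true_and]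
        by_cases hcc : c' = c
        · simp [hcc]
        · simp [hcc]
      · rw [if_neg hl, Nat.sub_zero]
        congr 1
        ext c'
        rw [Finset.mem_filter, Finset.mem_filter]
        simp only [Finset.mem_range, upd2, hdst, true_and]
        by_cases hcc : c' = c
        · subst hcc
          simp only [if_true]
          constructor
          · rintro ⟨_, _, h3⟩; exact absurd h3 hl
          · rintro ⟨_, h2, _⟩; omega
        · rw [if_neg hcc]
    · rw [if_neg hdst, Nat.sub_zero]
      simp [upd2, hdst]

/-- The values that are left, weighted with the degrees of their variables. -/
def sumA (X : Net) (A : ℕ → ℕ → ℕ) : ℕ :=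
  ∑ i ∈ Finset.range X.n, ∑ a ∈ Finset.range X.d, A i a * (X.deg i X.E + 1)

theorem sumA_dec {X : Net} {A : ℕ → ℕ → ℕ} {j c : ℕ} (hj : j < X.n) (hc : c < X.d)
    (hA : A j c = 1) : sumA X (upd2 A j c 0) + (X.deg j X.E + 1) = sumA X A := by
  have key : ∀ (m x : ℕ) (f g : ℕ → ℕ) (δ : ℕ), x < m → (∀ y, y ≠ x → f y = g y) →
      f x + δ = g x → (∑ y ∈ Finset.range m, f y) + δ = ∑ y ∈ Finset.range m, g y := by
    intro m x f g δ hx hne he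
    have hx' := Finset.mem_range.2 hx
    rw [← Finset.add_sum_erase _ f hx', ← Finset.add_sum_erase _ g hx', ← he]
    have : ∑ y ∈ (Finset.range m).erase x, f y = ∑ y ∈ (Finset.range m).erase x, g y :=
      Finset.sum_congr rfl fun y hy => hne y (Finset.ne_of_mem_erase hy)
    omega
  refine key X.n j _ _ _ hj (fun y hy => ?_) (key X.d c _ _ _ hc (fun y hy => ?_) ?_)
  · simp [upd2, hy]
  · simp [upd2, hy]
  · simp [upd2, hA]

/-- What holds whenever the main loop is entered; `T` describes the domains in terms of the list
of eliminations. -/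
structure Core (X : Net) (T : (ℕ → ℕ → ℕ) → ℕ → (ℕ → ℕ) → Prop) (s : ASt) : Prop where
  stat : Stat X s
  inv : MInv X s
  sem : Sem X s.alv (s.a3 5)
  rep : T s.alv (s.reg 1) s.out

/-- A round that discards an entry is paid by the credits of the entry. A round that eliminates a
value of `x_j` is paid by the drop `deg j + 1` of `sumA`, at `110 * D²` per unit: 80 for `elim` and
30 for the rest of the round. The predicate `T` keeps the machine apart from CSP semantics: all that
is used is that candidates preserve it. -/
theorem mainLoop_spec {Λ : Layout} {X : Net} (hX : Fits Λ X)
    {T : (ℕ → ℕ → ℕ) → ℕ → (ℕ → ℕ) → Prop}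
    (hT : ∀ s j c, Core X T s → Cand X s j c → T (upd2 s.alv j c 0) (s.reg 1 + 1)
      (Function.update (Function.update s.out (2 * s.reg 1) j) (2 * s.reg 1 + 1) c))
    {s : ASt} {k : ℕ} (h0 : Core X T s)
    (hk : pot Λ s + 110 * (Λ.D * Λ.D) * sumA X s.alv + 1 ≤ k) :
    WP Λ mainLoop (fun s' _ => Core X T s' ∧ s'.reg 7 = 0 ∧ s'.reg 8 = 0 ∧
      2 * s'.reg 1 + 4 ≤ Λ.M) s k := by
  refine WP.of_le fun hK => ?_
  have hD : Λ.D = Λ.d + 1 := rfl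
  have hDD : Λ.D ≤ Λ.D * Λ.D := Nat.le_mul_of_pos_left _ (by omega)
  refine WP.while_rule hX.valid (by rfl) (fun s' k' => Core X T s' ∧ k' ≤ k ∧
    pot Λ s' + 110 * (Λ.D * Λ.D) * sumA X s'.alv + 1 ≤ k') ?_ ⟨h0, le_rfl, hk⟩
  rintro s₁ k₁ ⟨hC, hk1, hk2⟩
  refine ⟨by omega, ⟨trivial, trivial⟩, ?_, ?_⟩
  · intro hv
    simp only [val, BinOp.apply] at hv
    have hbit := hC.sem.bit
    have htoklt : 32 * Λ.D ≤ tok Λ s₁ := by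
      have : 32 * Λ.D * 1 ≤ tok Λ s₁ := Nat.mul_le_mul_left _ (by omega)
      omega
    have hpt : tok Λ s₁ ≤ pot Λ s₁ := Nat.le_add_right _ _
    refine WP.prim_seq (by omega) (Prim.set hX.valid (by rfl) (by rfl) (by rfl) trivial) ?_
    simp only [val]
    set s₂ := s₁.setReg 9 0 with hs₂
    have ht2 : tok Λ s₂ = tok Λ s₁ := tok_eq (by simp [hs₂]) (by simp [hs₂]) (by simp [hs₂])
    have e7 : s₂.reg 7 = s₁.reg 7 := by simp [hs₂]
    have e8 : s₂.reg 8 = s₁.reg 8 := by simp [hs₂]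
    have hS2 : Stat X s₂ := hC.stat.setReg _ _
    have hI2 : MInv X s₂ := hC.inv.setReg (by decide) (by decide)
    have hM7 : s₁.reg 7 + 4 ≤ Λ.M :=
      hX.lt_len (k := k₁) ((tok_le (by simp)).trans (by omega)) (by omega)
    have hM8 : s₁.reg 8 + 4 ≤ Λ.M :=
      hX.lt_len (k := k₁) ((tok_le (by simp)).trans (by omega)) (by omega)
    have hpeek : WP Λ (cond (.reg 7) peekNS peekC) (fun s' k' => Stat X s' ∧ MInv X s' ∧
        s'.alv = s₁.alv ∧ s'.out = s₁.out ∧ s'.reg 1 = s₁.reg 1 ∧ s'.a3 = s₁.a3 ∧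
        ((s'.reg 9 = 0 ∧ tok Λ s' + k₁ + 10 * Λ.D ≤ tok Λ s₁ + k') ∨
        (s'.reg 9 ≠ 0 ∧ Cand X s' (s'.reg 10) (s'.reg 11) ∧ tok Λ s' = tok Λ s₁ ∧
          k₁ ≤ k' + 20 * Λ.D))) s₂ (k₁ - 1 - 1) := by
      refine WP.ite hX.valid (by omega) (by rfl) trivial ?_ ?_
      · intro hv7
        refine WP.imp (peekNS_spec hX hS2 hI2 hbit hv7 (by simp [hs₂])
          (by rw [e7]; exact hM7) (by omega)) ?_
        rintro s' k' hk' ⟨q1, q2, q3, q4, q5, q6, q7⟩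
        refine ⟨q1, q2, q3, q4, q5.trans (by simp [hs₂]), q6, ?_⟩
        rcases q7 with ⟨r1, r2⟩ | ⟨r1, r2, r3, r4⟩
        · exact Or.inl ⟨r1, by omega⟩
        · exact Or.inr ⟨r1, r2, by omega, by omega⟩
      · intro hv7
        simp only [val] at hv7
        refine WP.imp (peekC_spec hX hS2 hI2 hbit hv7 (by omega) (by rw [e8]; exact hM8)
          (by omega)) ?_
        rintro s' k' hk' ⟨q1, q2, q3, q4, q5, q6, q7⟩
        refine ⟨q1, q2, q3, q4, q5.trans (by simp [hs₂]), q6, ?_⟩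
        rcases q7 with ⟨r1, r2⟩ | ⟨r1, r2, r3, r4⟩
        · exact Or.inl ⟨r1, by omega⟩
        · exact Or.inr ⟨r1, r2, by omega, by omega⟩
    refine WP.seq (WP.imp hpeek ?_)
    rintro s₃ k₃ hk₃ ⟨q1, q2, q3, q4, q5, q6, q7⟩
    have hC3 : Core X T s₃ := ⟨q1, q2, by rw [q3, q6]; exact hC.sem, by rw [q3, q4, q5]; exact hC.rep⟩
    refine WP.ite hX.valid ?_ (by rfl) trivial ?_ ?_
    · rcases q7 with ⟨r1, r2⟩ | ⟨r1, r2, r3, r4⟩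
      · omega
      · have := sumA_dec r2.1 r2.2.1 r2.2.2.1
        rw [q3] at this
        have h1 : 110 * (Λ.D * Λ.D) * 1 ≤ 110 * (Λ.D * Λ.D) * sumA X s₁.alv :=
          Nat.mul_le_mul_left _ (by omega)
        omega
    · intro hv9
      rcases q7 with ⟨r1, r2⟩ | ⟨r1, r2, r3, r4⟩
      · exact absurd r1 hv9
      · have hdec := sumA_dec r2.1 r2.2.1 r2.2.2.1
        generalize hj : s₃.reg 10 = j at *
        generalize hc : s₃.reg 11 = c at *
        have hpot3 : pot Λ s₃ = pot Λ s₁ := by simp only [pot, r3, q6]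
        have h1 : 110 * (Λ.D * Λ.D) * sumA X s₃.alv =
            110 * (Λ.D * Λ.D) * sumA X (upd2 s₃.alv j c 0) +
            (80 * (Λ.D * Λ.D) * (X.deg j X.E + 1) + 30 * (Λ.D * Λ.D) * (X.deg j X.E + 1)) := by
          rw [← hdec]; ring
        have h2 : 30 * (Λ.D * Λ.D) * 1 ≤ 30 * (Λ.D * Λ.D) * (X.deg j X.E + 1) :=
          Nat.mul_le_mul_left _ (by omega)
        rw [q3] at h1
        refine WP.imp (elim_spec hX q1 q2 r2.1 r2.2.1 hj hc hC3.sem.bit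
          (fun f hf hdst b hb a ha => hC3.sem.loss_le r2.2.1 r2.2.2.1 hf hdst hb ha) (by omega)) ?_
        rintro s' k' hk' ⟨t1, t2, t3, t4, t5, t6, t7⟩
        refine ⟨⟨t1, t2, ?_, ?_⟩, by omega, ?_⟩
        · rw [t3]; exact hC3.sem.elim r2.2.1 r2.2.2.1 t6
        · rw [t3, t4, t5]; exact hT s₃ j c hC3 r2
        · rw [t3, q3]; omega
    · intro hv9
      simp only [val] at hv9
      rcases q7 with ⟨r1, r2⟩ | ⟨r1, r2⟩
      · have hpot3 : pot Λ s₃ + tok Λ s₁ = pot Λ s₁ + tok Λ s₃ := by simp only [pot, q6]; omega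
        refine WP.skip (by omega) ⟨hC3, by omega, ?_⟩
        rw [q3]; omega
      · exact absurd hv9 r1
  · intro hv
    simp only [val, BinOp.apply] at hv
    refine ⟨hC, by omega, by omega, ?_⟩
    refine hX.lt_len (k := k₁) ?_ (by omega)
    have : 32 * Λ.D * (2 * s₁.reg 1) ≤ tok Λ s₁ := Nat.mul_le_mul_left _ (by omega)
    have hpt : tok Λ s₁ ≤ pot Λ s₁ := Nat.le_add_right _ _
    omega

end RAM

namespace RAM

open AExpr

/-! ### Three nested loops -/

/-- The triples below `(B₁, B₂, B₃)` that precede `(i, b, a)` lexicographically. -/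
def Before (B₂ B₃ i b a : ℕ) (x y z : ℕ) : Prop :=
  y < B₂ ∧ z < B₃ ∧ (x < i ∨ x = i ∧ (y < b ∨ y = b ∧ z < a))

theorem before_zero {B₂ B₃ x y z : ℕ} : ¬ Before B₂ B₃ 0 0 0 x y z := by
  simp [Before]

theorem not_before_self {B₂ B₃ i b a : ℕ} : ¬ Before B₂ B₃ i b a i b a := by
  simp [Before]

theorem before_succ {B₂ B₃ i b a x y z : ℕ} (hb : b < B₂) (ha : a < B₃) :
    Before B₂ B₃ i b (a + 1) x y z ↔ Before B₂ B₃ i b a x y z ∨ (x = i ∧ y = b ∧ z = a) := by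
  simp only [Before]; omega

/-- Thanks to the bounds built into `Before`, the end of a row is the same position as the start of
the next. -/
theorem before_row {B₂ B₃ i b : ℕ} : Before B₂ B₃ i b B₃ = Before B₂ B₃ i (b + 1) 0 := by
  funext x y z
  simp only [Before, eq_iff_iff]; omega

theorem before_plane {B₂ B₃ i : ℕ} : Before B₂ B₃ i B₂ 0 = Before B₂ B₃ (i + 1) 0 0 := by
  funext x y z
  simp only [Before, eq_iff_iff]; omega

def for3 (r₁ : ℕ) (N₁ : AExpr) (r₂ : ℕ) (N₂ : AExpr) (r₃ : ℕ) (N₃ : AExpr) (p : Program) :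
    Program := forTo r₁ N₁ (forTo r₂ N₂ (forTo r₃ N₃ p))

/-- The invariant depends only on the set of triples already treated, so the same one serves all
three loops. -/
theorem WP.for3 {Λ : Layout} (hΛ : Λ.Valid) {r₁ r₂ r₃ : ℕ} {N₁ N₂ N₃ : AExpr} {p : Program}
    {s : ASt} {k : ℕ} (φ : ASt → ℕ) (c B₁ B₂ B₃ : ℕ)
    (Inv : (ℕ → ℕ → ℕ → Prop) → ASt → Prop)
    (hr₁ : userReg r₁ = true) (hr₂ : userReg r₂ = true) (hr₃ : userReg r₃ = true)
    (h₁₂ : r₁ ≠ r₂) (h₁₃ : r₁ ≠ r₃) (h₂₃ : r₂ ≠ r₃)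
    (hf₁ : (AExpr.op .lt (.reg r₁) N₁).fits = true) (hf₂ : (AExpr.op .lt (.reg r₂) N₂).fits = true)
    (hf₃ : (AExpr.op .lt (.reg r₃) N₃).fits = true)
    (hN₁ : ∀ s, N₁.val Λ s = B₁ ∧ N₁.Ok Λ s) (hN₂ : ∀ s, N₂.val Λ s = B₂ ∧ N₂.Ok Λ s)
    (hN₃ : ∀ s, N₃.val Λ s = B₃ ∧ N₃.Ok Λ s)
    (hφ : ∀ s r v, r = r₁ ∨ r = r₂ ∨ r = r₃ → φ (s.setReg r v) = φ s)
    (hset : ∀ P s r v, r = r₁ ∨ r = r₂ ∨ r = r₃ → Inv P s → Inv P (s.setReg r v))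
    (hbody : ∀ i b a s k, i < B₁ → b < B₂ → a < B₃ → s.reg r₁ = i → s.reg r₂ = b → s.reg r₃ = a →
      Inv (Before B₂ B₃ i b a) s → φ s + c ≤ k →
      WP Λ p (fun s' k' => s'.reg r₁ = i ∧ s'.reg r₂ = b ∧ s'.reg r₃ = a ∧
        Inv (Before B₂ B₃ i b (a + 1)) s' ∧ φ s' + k ≤ φ s + c + k') s k)
    (h0 : Inv (Before B₂ B₃ 0 0 0) s)
    (hk : φ s + (B₁ * (B₂ * (B₃ * (c + 2) + 2 + 2) + 2 + 2) + 2) ≤ k) :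
    WP Λ (for3 r₁ N₁ r₂ N₂ r₃ N₃ p) (fun s' k' => Inv (Before B₂ B₃ B₁ 0 0) s' ∧
      φ s' + k ≤ φ s + (B₁ * (B₂ * (B₃ * (c + 2) + 2 + 2) + 2 + 2) + 2) + k') s k := by
  refine WP.imp (WP.forTo hΛ φ _ B₁ (fun i s => Inv (Before B₂ B₃ i 0 0) s) hr₁ hf₁ hN₁
    (fun s v => hφ s _ v (by simp)) ?_ (hset _ _ _ _ (by simp) h0) hk) ?_
  · intro i s k hi e1 hI hk
    refine WP.imp (WP.forTo hΛ φ _ B₂ (fun b s => s.reg r₁ = i ∧ Inv (Before B₂ B₃ i b 0) s)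
      hr₂ hf₂ hN₂ (fun s v => hφ s _ v (by simp)) ?_
      ⟨by simp [h₁₂, e1], hset _ _ _ _ (by simp) hI⟩ hk) ?_
    · rintro b s k hb e2 ⟨e1, hI⟩ hk
      refine WP.imp (WP.forTo hΛ φ c B₃ (fun a s => s.reg r₁ = i ∧ s.reg r₂ = b ∧
        Inv (Before B₂ B₃ i b a) s) hr₃ hf₃ hN₃ (fun s v => hφ s _ v (by simp)) ?_
        ⟨by simp [h₁₃, e1], by simp [h₂₃, e2], hset _ _ _ _ (by simp) hI⟩ hk) ?_
      · rintro a s k ha e3 ⟨e1, e2, hI⟩ hk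
        refine WP.imp (hbody i b a s k hi hb ha e1 e2 e3 hI hk) ?_
        rintro s' k' - ⟨q1, q2, q3, q4, q5⟩
        exact ⟨q3, ⟨by simp [h₁₃, q1], by simp [h₂₃, q2], hset _ _ _ _ (by simp) q4⟩, q5⟩
      · rintro s' k' - ⟨-, ⟨q1, q2, q3⟩, q4⟩
        rw [before_row] at q3
        exact ⟨q2, ⟨by simp [h₁₂, q1], hset _ _ _ _ (by simp) q3⟩, q4⟩
    · rintro s' k' - ⟨-, ⟨q1, q2⟩, q3⟩
      rw [before_plane] at q2
      exact ⟨q1, hset _ _ _ _ (by simp) q2, q3⟩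
  · rintro s' k' - ⟨-, q1, q2⟩
    exact ⟨q1, q2⟩

/-! ### The initialisation -/

namespace Layout

/-- The network described by the input. -/
def net (Λ : Layout) : Net where
  n := Λ.n
  d := Λ.d
  E := 2 * Λ.e
  src f := if f < Λ.e then Λ.blk f 0 else Λ.blk (f - Λ.e) 1
  dst f := if f < Λ.e then Λ.blk f 1 else Λ.blk (f - Λ.e) 0
  R f a c := if f < Λ.e then decide (Λ.blk f (2 + (a * Λ.d + c)) = 1)
    else decide (Λ.blk (f - Λ.e) (2 + (c * Λ.d + a)) = 1)

end Layout

def initEnds : Program :=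
  forTo 10 .e <| .seq (st3 0 (.reg 10) zero zero (.blk (.reg 10) zero)) <|
    .seq (st3 0 (add (.reg 10) .e) zero zero (.blk (.reg 10) one)) <|
    .seq (st3 1 (.reg 10) zero zero (.blk (.reg 10) one))
      (st3 1 (add (.reg 10) .e) zero zero (.blk (.reg 10) zero))

abbrev entry : AExpr := .blk (.reg 10) (add (.lit 2) (add (mul (.reg 11) .d) (.reg 12)))

def initRel : Program :=
  for3 10 .e 11 .d 12 .d <| .seq (st3 2 (.reg 10) (.reg 11) (.reg 12) entry)
    (st3 2 (add (.reg 10) .e) (.reg 12) (.reg 11) entry)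

/-- Each constraint is put in front of the list of its source, so the lists come out in decreasing
order, as `Net.prv` describes them. -/
def initLists : Program :=
  forTo 10 (add .e .e) <| .seq (st3 4 (.reg 10) zero zero (aHead (aSrc (.reg 10))))
    (st3 3 (aSrc (.reg 10)) zero zero (add (.reg 10) one))

theorem initEnds_spec {Λ : Layout} (hΛ : Λ.Valid) {s : ASt} {k : ℕ} (hk : Λ.e * 6 + 2 ≤ k) :
    WP Λ initEnds (fun s' k' => Same [10] [0, 1] s s' ∧
      (∀ f < Λ.net.E, s'.a3 0 f 0 0 = Λ.net.src f ∧ s'.a3 1 f 0 0 = Λ.net.dst f) ∧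
      k ≤ Λ.e * 6 + 2 + k') s k := by
  have hF : Λ.F = Λ.n + 2 * Λ.e := rfl
  have hD : Λ.D = Λ.d + 1 := rfl
  refine WP.imp (WP.forTo hΛ (fun _ => 0) 4 Λ.e (fun p s₁ => Same [10] [0, 1] s s₁ ∧
    ∀ f < Λ.net.E, f < p ∨ (Λ.e ≤ f ∧ f < Λ.e + p) →
      s₁.a3 0 f 0 0 = Λ.net.src f ∧ s₁.a3 1 f 0 0 = Λ.net.dst f)
    (by rfl) (by rfl) (fun _ => ⟨rfl, trivial⟩) (fun _ _ => rfl) ?_ ?_ ?_) ?_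
  · rintro p s₁ k₁ hp h10 ⟨hsame, hinv⟩ hk₁
    refine WP.prim_seq (by omega) (Prim.st3 hΛ (by rfl) ?_ (by rfl) (by rfl) ?_) ?_
    · simp [Ok, val, h10]; omega
    · simp [Ok, val, h10]; omega
    refine WP.prim_seq (by omega) (Prim.st3 hΛ (by rfl) ?_ (by rfl) (by rfl) ?_) ?_
    · simp [Ok, val, h10, BinOp.apply]; omega
    · simp [Ok, val, h10]; omega
    refine WP.prim_seq (by omega) (Prim.st3 hΛ (by rfl) ?_ (by rfl) (by rfl) ?_) ?_
    · simp [Ok, val, h10]; omega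
    · simp [Ok, val, h10]; omega
    refine WP.prim (by omega) (Prim.st3 hΛ (by rfl) ?_ (by rfl) (by rfl) ?_) ?_
    · simp [Ok, val, h10, BinOp.apply]; omega
    · simp [Ok, val, h10]; omega
    simp only [val, BinOp.apply, ASt.set3_reg, h10]
    refine ⟨trivial, ⟨⟨?_, ?_, hsame.alv, hsame.out⟩, ?_⟩, by omega⟩
    · intro q hq
      have : q ≠ 10 := by simpa using hq
      simp [this, hsame.reg q hq]
    · intro α hα
      have : α ≠ 0 ∧ α ≠ 1 := by simpa using hα
      simp [this, hsame.a3 α hα]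
    · intro f hf hfp
      norm_num only [ASt.setReg_a3, ASt.set3_a3, if_true, if_false, upd3, and_true]
      by_cases h1 : f = p
      · subst h1
        have h2 : Λ.e ≠ 0 := by omega
        simp [h2, Layout.net, hp]
      · by_cases h2 : f = p + Λ.e
        · subst h2
          simp [Layout.net]
        · simp only [h1, h2, if_false]
          exact hinv f hf (by omega)
  · refine ⟨⟨?_, fun _ _ => rfl, rfl, rfl⟩, fun f hf h => by omega⟩
    intro q hq
    have : q ≠ 10 := by simpa using hq
    simp [this]
  · show 0 + _ ≤ k
    omega
  · rintro s' k' hk' ⟨-, ⟨h1, h2⟩, h3⟩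
    refine ⟨h1, fun f hf => h2 f hf ?_, by omega⟩
    simp only [Layout.net] at hf; omega

theorem initRel_spec {Λ : Layout} (hΛ : Λ.Valid) {s : ASt} {k : ℕ}
    (hbit : ∀ p < Λ.e, ∀ x < Λ.d * Λ.d, Λ.blk p (2 + x) ≤ 1)
    (hk : Λ.e * (Λ.d * (Λ.d * (2 + 2) + 2 + 2) + 2 + 2) + 2 ≤ k) :
    WP Λ initRel (fun s' k' => Same [10, 11, 12] [2] s s' ∧
      (∀ f < Λ.net.E, ∀ a < Λ.d, ∀ c < Λ.d, s'.a3 2 f a c = (Λ.net.R f a c).toNat) ∧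
      k ≤ Λ.e * (Λ.d * (Λ.d * (2 + 2) + 2 + 2) + 2 + 2) + 2 + k') s k := by
  have hF : Λ.F = Λ.n + 2 * Λ.e := rfl
  have hD : Λ.D = Λ.d + 1 := rfl
  refine WP.imp (WP.for3 hΛ (fun _ => 0) 2 Λ.e Λ.d Λ.d (fun P s₁ => Same [10, 11, 12] [2] s s₁ ∧
    ∀ p < Λ.e, ∀ a < Λ.d, ∀ c < Λ.d, P p a c → s₁.a3 2 p a c = (Λ.net.R p a c).toNat ∧
      s₁.a3 2 (p + Λ.e) c a = (Λ.net.R (p + Λ.e) c a).toNat)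
    (by rfl) (by rfl) (by rfl) (by decide) (by decide) (by decide) (by rfl) (by rfl) (by rfl)
    (fun _ => ⟨rfl, trivial⟩) (fun _ => ⟨rfl, trivial⟩) (fun _ => ⟨rfl, trivial⟩)
    (fun _ _ _ _ => rfl) ?_ ?_ ?_ ?_) ?_
  · rintro P s₁ r v hr ⟨h1, h2⟩
    exact ⟨h1.setReg (by simpa using hr), h2⟩
  · rintro p a c s₁ k₁ hp ha hc h10 h11 h12 ⟨hsame, hinv⟩ hk₁
    have hac := mul_add_lt_mul ha hc
    have hv : Λ.blk p (2 + (a * Λ.d + c)) = (Λ.net.R p a c).toNat := by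
      have := hbit p hp _ hac
      simp only [Layout.net, hp, if_true]
      rcases Nat.le_one_iff_eq_zero_or_eq_one.1 this with h | h <;> simp [h]
    have hv' : Λ.net.R (p + Λ.e) c a = Λ.net.R p a c := by
      simp [Layout.net, hp]
    refine WP.prim_seq (by omega) (Prim.st3 hΛ (by rfl) ?_ (by rfl) (by rfl) ?_) ?_
    · simp [Ok, val, h10, h11, h12]; omega
    · simp [Ok, val, h10, h11, h12, BinOp.apply]; omega
    refine WP.prim (by omega) (Prim.st3 hΛ (by rfl) ?_ (by rfl) (by rfl) ?_) ?_
    · simp [Ok, val, h10, h11, h12, BinOp.apply]; omega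
    · simp [Ok, val, h10, h11, h12, BinOp.apply]; omega
    simp only [val, BinOp.apply, ASt.set3_reg, h10, h11, h12, hv]
    refine ⟨trivial, trivial, trivial, ⟨⟨?_, ?_, hsame.alv, hsame.out⟩, ?_⟩, by omega⟩
    · intro q hq
      exact hsame.reg q hq
    · intro α hα
      have : α ≠ 2 := by simpa using hα
      simp [this, hsame.a3 α hα]
    · intro p' hp' a' ha' c' hc' hP
      norm_num only [ASt.set3_a3, if_true, if_false, upd3]
      rw [before_succ ha hc] at hP
      have h1 : ¬ (p' = p + Λ.e) := by omega
      have h2 : ¬ (p' + Λ.e = p) := by omega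
      simp only [h1, h2, false_and, if_false, Nat.add_right_cancel_iff]
      by_cases h3 : p' = p ∧ a' = a ∧ c' = c
      · obtain ⟨rfl, rfl, rfl⟩ := h3
        simp [hv']
      · have h4 : ¬ (p' = p ∧ c' = c ∧ a' = a) := by tauto
        rw [if_neg h3, if_neg h4]
        exact hinv p' hp' a' ha' c' hc' (hP.resolve_right h3)
  · exact ⟨Same.refl _ _ _, fun _ _ _ _ _ _ h => absurd h before_zero⟩
  · show 0 + _ ≤ k
    omega
  · rintro s' k' hk' ⟨⟨h1, h2⟩, h3⟩
    refine ⟨h1, fun f hf a ha c hc => ?_, by omega⟩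
    have hf' : f < 2 * Λ.e := hf
    by_cases hfe : f < Λ.e
    · exact (h2 f hfe a ha c hc ⟨ha, hc, Or.inl hfe⟩).1
    · have := (h2 (f - Λ.e) (by omega) c hc a ha ⟨hc, ha, Or.inl (by omega)⟩).2
      rwa [Nat.sub_add_cancel (by omega)] at this

theorem initLists_spec {Λ : Layout} (hΛ : Λ.Valid) {s : ASt} {k : ℕ}
    (hsrc : ∀ f < Λ.net.E, s.a3 0 f 0 0 = Λ.net.src f) (hlt : ∀ f < Λ.net.E, Λ.net.src f < Λ.n)
    (hz : ∀ x, s.a3 3 x 0 0 = 0) (hk : (Λ.e + Λ.e) * 4 + 2 ≤ k) :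
    WP Λ initLists (fun s' k' => Same [10] [3, 4] s s' ∧
      (∀ i, s'.a3 3 i 0 0 = Λ.net.prv i Λ.net.E) ∧
      (∀ f < Λ.net.E, s'.a3 4 f 0 0 = Λ.net.prv (Λ.net.src f) f) ∧
      k ≤ (Λ.e + Λ.e) * 4 + 2 + k') s k := by
  have hF : Λ.F = Λ.n + 2 * Λ.e := rfl
  have hD : Λ.D = Λ.d + 1 := rfl
  have hE : Λ.net.E = 2 * Λ.e := rfl
  refine WP.imp (WP.forTo hΛ (fun _ => 0) 2 (Λ.e + Λ.e) (fun g s₁ => Same [10] [3, 4] s s₁ ∧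
    (∀ i, s₁.a3 3 i 0 0 = Λ.net.prv i g) ∧ ∀ f < g, s₁.a3 4 f 0 0 = Λ.net.prv (Λ.net.src f) f)
    (by rfl) (by rfl) (fun _ => ⟨rfl, trivial, trivial⟩) (fun _ _ => rfl) ?_ ?_ ?_) ?_
  · rintro g s₁ k₁ hg h10 ⟨hsame, hinv, hinv'⟩ hk₁
    have hg' : g < Λ.net.E := by omega
    have e0 : s₁.a3 0 g 0 0 = Λ.net.src g := by rw [hsame.a3 0 (by decide), hsrc g hg']
    have hl := hlt g hg'
    refine WP.prim_seq (by omega) (Prim.st3 hΛ (by rfl) ?_ (by rfl) (by rfl) ?_) ?_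
    · simp [Ok, val, h10]; omega
    · simp [Ok, val, h10, e0]; omega
    have e0' : (s₁.set3 4 g 0 0 (s₁.a3 3 (Λ.net.src g) 0 0)).a3 0 g 0 0 = Λ.net.src g := by
      simpa using e0
    simp only [val, h10, e0]
    refine WP.prim (by omega) (Prim.st3 hΛ (by rfl) ?_ (by rfl) (by rfl) ⟨trivial, trivial⟩) ?_
    · simp only [Ok, val, ASt.set3_reg, h10, e0']; simp; omega
    simp only [val, BinOp.apply, ASt.set3_reg, h10, e0']
    refine ⟨trivial, ⟨⟨?_, ?_, hsame.alv, hsame.out⟩, ?_, ?_⟩, by omega⟩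
    · intro q hq
      have : q ≠ 10 := by simpa using hq
      simp [this, hsame.reg q hq]
    · intro α hα
      have : α ≠ 3 ∧ α ≠ 4 := by simpa using hα
      simp [this, hsame.a3 α hα]
    · intro i
      norm_num only [ASt.setReg_a3, ASt.set3_a3, if_true, if_false, upd3, and_true]
      simp only [Net.prv]
      by_cases h : i = Λ.net.src g
      · rw [if_pos h, if_pos h.symm]
      · rw [if_neg h, if_neg (Ne.symm h), hinv]
    · intro f hf
      norm_num only [ASt.setReg_a3, ASt.set3_a3, if_true, if_false, upd3, and_true]
      by_cases h : f = g
      · subst h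
        rw [if_pos rfl, hinv]
      · rw [if_neg h, hinv' f (by omega)]
  · exact ⟨(Same.refl _ _ _).setReg (by decide), fun i => by simpa [Net.prv] using hz i,
      fun f hf => by omega⟩
  · show 0 + _ ≤ k
    omega
  · rintro s' k' hk' ⟨-, ⟨h1, h2, h3⟩, h4⟩
    rw [hE]
    refine ⟨h1, fun i => by rw [h2, two_mul], fun f hf => h3 f (by omega), by omega⟩

end RAM

namespace RAM

open AExpr

/-! ### Initialisation of the counters -/

/-- The number of obstructions, in the domains `A`, to the substitution of `a` for `b`. -/
def Net.obs (X : Net) (A : ℕ → ℕ → ℕ) (m f b a : ℕ) : ℕ :=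
  ((Finset.range m).filter fun c =>
    A (X.dst f) c = 1 ∧ X.R f b c = true ∧ ¬ X.R f a c = true).card

theorem Net.obs_succ {X : Net} {A : ℕ → ℕ → ℕ} {m f b a : ℕ} : X.obs A (m + 1) f b a =
    X.obs A m f b a +
      if A (X.dst f) m = 1 ∧ X.R f b m = true ∧ ¬ X.R f a m = true then 1 else 0 := by
  simp only [Net.obs, Finset.range_add_one, Finset.filter_insert]
  split
  · rw [Finset.card_insert_of_notMem (by simp)]
  · rfl

def countW : Program :=
  forTo 17 .d (cond (mul (mul (aRel (.reg 10) (.reg 11) (.reg 17))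
      (sub one (aRel (.reg 10) (.reg 12) (.reg 17)))) (.alv (aDst (.reg 10)) (.reg 17)))
    (st3 5 (.reg 10) (.reg 11) (.reg 12) (add (aW (.reg 10) (.reg 11) (.reg 12)) one)) .skip)

def recordW : Program :=
  cond (aW (.reg 10) (.reg 11) (.reg 12)) (.seq (set 18 (aSrc (.reg 10))) <|
    .seq (st3 6 (.reg 18) (.reg 11) (.reg 12) (add (aN (.reg 18) (.reg 11) (.reg 12)) one))
      (st3 7 (.reg 18) (.reg 11) (.reg 12)
        (add (aSM (.reg 18) (.reg 11) (.reg 12)) (add (.reg 10) one)))) .skip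

def initCounts : Program := for3 10 (add .e .e) 11 .d 12 .d (.seq countW recordW)

theorem countW_spec {Λ : Layout} {X : Net} (hX : Fits Λ X) {s : ASt} {k f b a : ℕ}
    (hS : Stat X s) (hA : ∀ i < X.n, ∀ a < X.d, s.alv i a ≤ 1)
    (hf : f < X.E) (hb : b < X.d) (ha : a < X.d)
    (h10 : s.reg 10 = f) (h11 : s.reg 11 = b) (h12 : s.reg 12 = a)
    (hW : s.a3 5 f b a = 0) (hk : 4 * Λ.D ≤ k) :
    WP Λ countW (fun s' k' => Same [17] [5] s s' ∧
      s'.a3 5 = upd3 (s.a3 5) f b a (X.obs s.alv X.d f b a) ∧ k ≤ 4 * Λ.D + k') s k := by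
  have hn := hX.n
  have hd := hX.d
  have hE := hX.E
  have hD : Λ.D = Λ.d + 1 := rfl
  have hF : Λ.F = Λ.n + 2 * Λ.e := rfl
  refine WP.imp (WP.forTo hX.valid (fun _ => 0) 2 Λ.d (fun c s₁ => Same [17] [5] s s₁ ∧
    s₁.a3 5 = upd3 (s.a3 5) f b a (X.obs s.alv c f b a))
    (by rfl) (by rfl) (fun _ => ⟨rfl, trivial⟩) (fun _ _ => rfl) ?_ ?_ ?_) ?_
  · rintro c s₁ k₁ hc h17 ⟨hsame, hinv⟩ hk₁
    have e10 : s₁.reg 10 = f := (hsame.reg 10 (by decide)).trans h10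
    have e11 : s₁.reg 11 = b := (hsame.reg 11 (by decide)).trans h11
    have e12 : s₁.reg 12 = a := (hsame.reg 12 (by decide)).trans h12
    have hS1 := hsame.stat hS (by decide)
    have hrel := hS1.rel f hf b hb c (by omega)
    have hrel' := hS1.rel f hf a ha c (by omega)
    have hdst := hS1.dst f hf
    have hdn := hX.dst f hf
    have hbit := hA _ hdn c (by omega)
    refine WP.ite hX.valid (by omega) (by rfl) ?_ ?_ ?_
    · simp only [Ok, val, e10, e11, e12, h17, hdst]; simp; omega
    · intro hv
      simp only [val, BinOp.apply, e10, e11, e12, h17, hrel, hrel', hdst, hsame.alv] at hv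
      have hcond : s.alv (X.dst f) c = 1 ∧ X.R f b c = true ∧ ¬ X.R f a c = true := by
        refine ⟨?_, ?_, ?_⟩
        · have : s.alv (X.dst f) c ≠ 0 := by intro h; simp [h] at hv
          omega
        · by_contra h; simp [h] at hv
        · intro h; simp [h] at hv
      refine WP.prim (by omega) (Prim.st3 hX.valid (by rfl) ?_ (by rfl) (by rfl) ?_) ?_
      · simp only [Ok, val, e10, e11, e12]; simp; omega
      · simp only [Ok, val, e10, e11, e12]; simp; omega
      simp only [val, e10, e11, e12, BinOp.apply]
      refine ⟨by simpa using h17, ⟨⟨?_, ?_, hsame.alv, hsame.out⟩, ?_⟩, by omega⟩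
      · intro q hq
        have : q ≠ 17 := by simpa using hq
        simp [this, hsame.reg q hq]
      · intro α hα
        have : α ≠ 5 := by simpa using hα
        simp [this, hsame.a3 α hα]
      · simp only [ASt.setReg_a3, ASt.set3_a3, if_true]
        rw [Net.obs_succ, if_pos hcond, hinv]
        funext f' b' a'
        simp only [upd3]
        split <;> simp
    · intro hv
      simp only [val, BinOp.apply, e10, e11, e12, h17, hrel, hrel', hdst, hsame.alv] at hv
      refine WP.skip (by omega) ⟨h17, ⟨hsame.setReg (by decide), ?_⟩, by omega⟩
      rw [Net.obs_succ, if_neg, add_zero]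
      · exact hinv
      · rintro ⟨h1, h2, h3⟩
        simp [h1, h2, h3] at hv
  · refine ⟨(Same.refl _ _ _).setReg (by decide), ?_⟩
    funext f' b' a'
    simp only [ASt.setReg_a3, upd3]
    split
    · rename_i h; obtain ⟨rfl, rfl, rfl⟩ := h; simp [Net.obs, hW]
    · rfl
  · show 0 + _ ≤ k
    omega
  · rintro s' k' hk' ⟨-, ⟨h1, h2⟩, h3⟩
    exact ⟨h1, by rw [hd]; exact h2, by omega⟩

/-- The counters are correct for the triples in `P`. -/
structure Counted (X : Net) (A : ℕ → ℕ → ℕ) (P : ℕ → ℕ → ℕ → Prop)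
    (W N SM : ℕ → ℕ → ℕ → ℕ) : Prop where
  pos : ∀ f < X.E, ∀ b < X.d, ∀ a < X.d, P f b a → W f b a = X.obs A X.d f b a
  neg : ∀ f b a, ¬ P f b a → W f b a = 0
  card : ∀ i b a, N i b a = (X.act W i b a).card
  sum : ∀ i b a, SM i b a = ∑ f ∈ X.act W i b a, (f + 1)

/-- Since `W` vanishes outside `P`, the constraint `f` is not yet in `act`; a positive count inserts
it, which adds 1 to the cardinality and `f + 1` to the sum. -/
theorem Counted.next {X : Net} {A : ℕ → ℕ → ℕ} {P P' : ℕ → ℕ → ℕ → Prop}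
    {W N SM : ℕ → ℕ → ℕ → ℕ} (h : Counted X A P W N SM) {f b a : ℕ} (hf : f < X.E)
    (hnP : ¬ P f b a) (hP' : ∀ x y z, P' x y z ↔ P x y z ∨ (x = f ∧ y = b ∧ z = a)) :
    (X.obs A X.d f b a = 0 → Counted X A P' (upd3 W f b a 0) N SM) ∧
    (X.obs A X.d f b a ≠ 0 → Counted X A P' (upd3 W f b a (X.obs A X.d f b a))
      (upd3 N (X.src f) b a (N (X.src f) b a + 1))
      (upd3 SM (X.src f) b a (SM (X.src f) b a + (f + 1))) ∧
      SM (X.src f) b a + (f + 1) ≤ X.E * X.E) := by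
  have hW := h.neg f b a hnP
  have hpos : ∀ f' < X.E, ∀ b' < X.d, ∀ a' < X.d, P' f' b' a' →
      upd3 W f b a (X.obs A X.d f b a) f' b' a' = X.obs A X.d f' b' a' := by
    intro f' hf' b' hb' a' ha' hp
    simp only [upd3]
    split
    · rename_i h'; obtain ⟨rfl, rfl, rfl⟩ := h'; rfl
    · rename_i h'
      exact h.pos f' hf' b' hb' a' ha' (((hP' _ _ _).1 hp).resolve_right h')
  have hneg : ∀ v f' b' a', ¬ P' f' b' a' → upd3 W f b a v f' b' a' = 0 := by
    intro v f' b' a' hp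
    simp only [upd3]
    rw [if_neg fun h' => hp ((hP' _ _ _).2 (Or.inr h'))]
    exact h.neg _ _ _ fun h' => hp ((hP' _ _ _).2 (Or.inl h'))
  refine ⟨fun h0 => ?_, fun h0 => ?_⟩
  · have hWW : upd3 W f b a 0 = W := by
      funext f' b' a'
      simp only [upd3]
      split
      · rename_i h'; obtain ⟨rfl, rfl, rfl⟩ := h'; exact hW.symm
      · rfl
    refine ⟨?_, hneg 0, by rw [hWW]; exact h.card, by rw [hWW]; exact h.sum⟩
    rw [← h0]
    exact hpos
  · have hact : ∀ i b' a', X.act (upd3 W f b a (X.obs A X.d f b a)) i b' a' =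
        if i = X.src f ∧ b' = b ∧ a' = a then insert f (X.act W (X.src f) b a)
        else X.act W i b' a' := by
      intro i b' a'
      split
      · rename_i h'
        obtain ⟨rfl, rfl, rfl⟩ := h'
        ext g
        simp only [Net.mem_act, Finset.mem_insert, upd3]
        by_cases hg : g = f
        · subst hg; simp [hf, h0]
        · simp [hg]
      · rename_i h'
        ext g
        simp only [Net.mem_act, upd3]
        by_cases hg : g = f ∧ b' = b ∧ a' = a
        · obtain ⟨rfl, rfl, rfl⟩ := hg
          have : X.src g ≠ i := fun h2 => h' ⟨h2.symm, rfl, rfl⟩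
          simp [this]
        · simp [hg]
    have hnot : f ∉ X.act W (X.src f) b a := by simp [Net.mem_act, hW]
    refine ⟨⟨hpos, hneg _, fun i b' a' => ?_, fun i b' a' => ?_⟩, ?_⟩
    · rw [hact]
      simp only [upd3]
      split
      · rw [Finset.card_insert_of_notMem hnot, h.card]
      · exact h.card _ _ _
    · rw [hact]
      simp only [upd3]
      split
      · rw [Finset.sum_insert hnot, h.sum, add_comm]
      · exact h.sum _ _ _
    · rw [h.sum, add_comm, ← Finset.sum_insert (f := fun g => g + 1) hnot]
      have hsub : insert f (X.act W (X.src f) b a) ⊆ Finset.range X.E := by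
        intro g hg
        rcases Finset.mem_insert.1 hg with rfl | hg
        · exact Finset.mem_range.2 hf
        · exact Finset.mem_range.2 (Net.mem_act.1 hg).1
      refine (Finset.sum_le_sum_of_subset hsub).trans ?_
      refine (Finset.sum_le_card_nsmul _ _ X.E fun g hg => ?_).trans (by simp)
      exact Finset.mem_range.1 hg

theorem initCounts_spec {Λ : Layout} {X : Net} (hX : Fits Λ X) {s : ASt} {k : ℕ}
    (hS : Stat X s) (hA : ∀ i < X.n, ∀ a < X.d, s.alv i a ≤ 1)
    (h5 : s.a3 5 = fun _ _ _ => 0) (h6 : s.a3 6 = fun _ _ _ => 0) (h7 : s.a3 7 = fun _ _ _ => 0)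
    (hk : (Λ.e + Λ.e) * (Λ.d * (Λ.d * (4 * Λ.D + 4 + 2) + 2 + 2) + 2 + 2) + 2 ≤ k) :
    WP Λ initCounts (fun s' k' => Same [10, 11, 12, 17, 18] [5, 6, 7] s s' ∧
      Counted X s.alv (fun f b a => f < X.E ∧ b < X.d ∧ a < X.d) (s'.a3 5) (s'.a3 6) (s'.a3 7) ∧
      k ≤ (Λ.e + Λ.e) * (Λ.d * (Λ.d * (4 * Λ.D + 4 + 2) + 2 + 2) + 2 + 2) + 2 + k') s k := by
  have hn := hX.n
  have hd := hX.d
  have hE := hX.E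
  have hD : Λ.D = Λ.d + 1 := rfl
  have hF : Λ.F = Λ.n + 2 * Λ.e := rfl
  refine WP.imp (WP.for3 hX.valid (fun _ => 0) (4 * Λ.D + 4) (Λ.e + Λ.e) Λ.d Λ.d
    (fun P s₁ => Same [10, 11, 12, 17, 18] [5, 6, 7] s s₁ ∧
      Counted X s.alv P (s₁.a3 5) (s₁.a3 6) (s₁.a3 7))
    (by rfl) (by rfl) (by rfl) (by decide) (by decide) (by decide) (by rfl) (by rfl) (by rfl)
    (fun _ => ⟨rfl, trivial, trivial⟩) (fun _ => ⟨rfl, trivial⟩) (fun _ => ⟨rfl, trivial⟩)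
    (fun _ _ _ _ => rfl) ?_ ?_ ?_ ?_) ?_
  · rintro P s₁ r v hr ⟨h1, h2⟩
    exact ⟨h1.setReg (by rcases hr with rfl | rfl | rfl <;> decide), h2⟩
  · rintro f b a s₁ k₁ hf hb ha h10 h11 h12 ⟨hsame, hinv⟩ hk₁
    have hf' : f < X.E := by omega
    have hb' : b < X.d := by omega
    have ha' : a < X.d := by omega
    have hS1 := hsame.stat hS (by decide)
    have hsn := hX.src f hf'
    obtain ⟨hn0, hn1⟩ := hinv.next hf' not_before_self
      (fun x y z => before_succ (x := x) (y := y) (z := z) hb ha)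
    refine WP.seq (WP.imp (countW_spec hX hS1 (by rw [hsame.alv]; exact hA) hf' hb' ha' h10 h11 h12
      (hinv.neg _ _ _ not_before_self) (by omega)) ?_)
    rintro s₂ k₂ hk₂ ⟨q1, q2, q3⟩
    rw [hsame.alv] at q2
    have e10 : s₂.reg 10 = f := (q1.reg 10 (by decide)).trans h10
    have e11 : s₂.reg 11 = b := (q1.reg 11 (by decide)).trans h11
    have e12 : s₂.reg 12 = a := (q1.reg 12 (by decide)).trans h12
    have hw : s₂.a3 5 f b a = X.obs s.alv X.d f b a := by rw [q2]; simp [upd3]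
    have hS2 := q1.stat hS1 (by decide)
    have hsame2 := hsame.trans (q1.mono (rs' := [10, 11, 12, 17, 18]) (as' := [5, 6, 7])
      (by decide) (by decide))
    refine WP.ite hX.valid (by omega) (by rfl) ?_ ?_ ?_
    · simp only [Ok, val, e10, e11, e12]; simp; omega
    · intro hv
      simp only [val, e10, e11, e12, hw] at hv
      obtain ⟨hn1, hle⟩ := hn1 hv
      refine WP.prim_seq (by omega) (Prim.set hX.valid (by rfl) (by rfl) (by rfl) ?_) ?_
      · simp [Ok, val, e10]; omega
      simp only [val, e10, hS2.src f hf']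
      refine WP.prim_seq (by omega) (Prim.st3 hX.valid (by rfl) ?_ (by rfl) (by rfl) ?_) ?_
      · simp [Ok, val, e11, e12]; omega
      · simp [Ok, val, e11, e12]; omega
      norm_num only [val, ASt.setReg_reg, ASt.setReg_a3, BinOp.apply, e11, e12, if_true, if_false]
      -- This entry grows by `f + 1` at once, not by one; the bound `E * E` on the sums, which is
      -- built into `low`, replaces `tame`.
      refine WP.prim (by omega) (Prim.st3_of_bound hX.valid (by rfl) ?_ (by rfl) ?_ ?_) ?_
      · simp [Ok, val, e11, e12]; omega
      · simp [Ok, val, e11, e12]; omega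
      · intro σ Z hR
        norm_num only [val, ASt.set3_reg, ASt.setReg_reg, ASt.setReg_a3, ASt.set3_a3, BinOp.apply, e10, e11, e12,
          if_true, if_false]
        rw [q1.a3 7 (by decide)]
        have := hR.lo
        have hl : Λ.low = Λ.base + 33 * Λ.M + (2 * Λ.e + 1) * (2 * Λ.e + 1) + 100 := rfl
        have : X.E * X.E ≤ (2 * Λ.e + 1) * (2 * Λ.e + 1) := Nat.mul_le_mul (by omega) (by omega)
        omega
      norm_num only [val, ASt.set3_reg, ASt.setReg_reg, ASt.setReg_a3, ASt.set3_a3, BinOp.apply, e10, e11, e12,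
          if_true, if_false]
      rw [← q2, ← q1.a3 6 (by decide), ← q1.a3 7 (by decide)] at hn1
      refine ⟨trivial, trivial, trivial, ⟨⟨?_, ?_, hsame2.alv, hsame2.out⟩, hn1⟩, by omega⟩
      · intro q hq
        have : q ≠ 18 := by rintro rfl; exact hq (by decide)
        simp [this, hsame2.reg q hq]
      · intro α hα
        have : α ≠ 6 ∧ α ≠ 7 := by
          constructor <;> (rintro rfl; exact hα (by decide))
        simp [this, hsame2.a3 α hα]
    · intro hv
      simp only [val, e10, e11, e12, hw] at hv
      have hn0 := hn0 hv
      rw [hv] at q2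
      rw [← q2, ← q1.a3 6 (by decide), ← q1.a3 7 (by decide)] at hn0
      exact WP.skip (by omega) ⟨e10, e11, e12, ⟨hsame2, hn0⟩, by omega⟩
  · refine ⟨Same.refl _ _ _, fun _ _ _ _ _ _ h => absurd h before_zero, ?_, ?_, ?_⟩
    · intro f b a _; rw [h5]
    · intro i b a; rw [h5, h6]; simp [Net.act]
    · intro i b a; rw [h5, h7]; simp [Net.act]
  · show 0 + _ ≤ k
    omega
  · rintro s' k' hk' ⟨⟨h1, h2⟩, h3⟩
    refine ⟨h1, ?_, by omega⟩
    have : Before Λ.d Λ.d (Λ.e + Λ.e) 0 0 = fun f b a => f < X.E ∧ b < X.d ∧ a < X.d := by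
      funext f b a
      simp only [Before, eq_iff_iff]; omega
    rwa [this] at h2

/-! ### Examination of all triples -/

def initEvents : Program := for3 15 .n 13 .d 14 .d event

/-- The set of examined triples matters only within the ranges of the indices. -/
theorem Net.Inv.total {X : Net} {P Pend A W N SM G S ns cq}
    (h : Net.Inv X P Pend A W N SM G S ns cq)
    (hP : ∀ i < X.n, ∀ b < X.d, ∀ a < X.d, P i b a) :
    Net.Inv X (fun _ _ _ => True) Pend A W N SM G S ns cq :=
  { h with
    found := fun i hi b hb a ha _ => h.found i hi b hb a ha (hP i hi b hb a ha)
    fresh := fun i hi b hb a ha h' => h.fresh i hi b hb a ha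
      (Or.inl (h'.resolve_right fun h'' => h''.1 trivial))
    nsMem := fun i hi b hb a ha _ => h.nsMem i hi b hb a ha (hP i hi b hb a ha) }

theorem initEvents_spec {Λ : Layout} {X : Net} (hX : Fits Λ X) {s : ASt} {k : ℕ}
    (hS : Stat X s) (hA : ∀ i < X.n, ∀ a < X.d, s.alv i a ≤ 1)
    (hI : SInv X (Before Λ.d Λ.d 0 0 0) (fun _ _ => False) s)
    (hk : tok Λ s + (Λ.n * (Λ.d * (Λ.d * (44 * Λ.D + 4 + 2) + 2 + 2) + 2 + 2) + 2) ≤ k) :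
    WP Λ initEvents (fun s' k' => Same [7, 8, 13, 14, 15, 16, 17] [8, 9] s s' ∧ MInv X s' ∧
      tok Λ s' + k ≤ tok Λ s +
        (Λ.n * (Λ.d * (Λ.d * (44 * Λ.D + 4 + 2) + 2 + 2) + 2 + 2) + 2) + k') s k := by
  have hn := hX.n
  have hd := hX.d
  refine WP.imp (WP.for3 hX.valid (tok Λ) (44 * Λ.D + 4) Λ.n Λ.d Λ.d
    (fun P s₁ => Same [7, 8, 13, 14, 15, 16, 17] [8, 9] s s₁ ∧ SInv X P (fun _ _ => False) s₁)
    (by rfl) (by rfl) (by rfl) (by decide) (by decide) (by decide) (by rfl) (by rfl) (by rfl)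
    (fun _ => ⟨rfl, trivial⟩) (fun _ => ⟨rfl, trivial⟩) (fun _ => ⟨rfl, trivial⟩)
    ?_ ?_ ?_ ⟨Same.refl _ _ _, hI⟩ hk) ?_
  · intro s r v hr
    rcases hr with rfl | rfl | rfl <;> exact tok_eq (by simp) (by simp) (by simp)
  · rintro P s₁ r v hr ⟨h1, h2⟩
    rcases hr with rfl | rfl | rfl <;>
      exact ⟨h1.setReg (by decide), h2.setReg (by decide) (by decide)⟩
  · rintro i b a s₁ k₁ hi hb ha h15 h13 h14 ⟨hsame, hinv⟩ hk₁
    have hle : (4 + if s₁.a3 6 i b a ≤ 1 then 44 * Λ.D else 0) ≤ 44 * Λ.D + 4 := by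
      split <;> omega
    refine WP.imp (event_spec hX (hsame.stat hS (by decide)) hinv (by omega) (by omega) (by omega)
      h15 h13 h14 (by rw [hsame.alv]; exact hA i (by omega) a (by omega)) not_before_self
      (fun x y z => before_succ (x := x) (y := y) (z := z) hb ha) (by omega)) ?_
    rintro s' k' - ⟨q1, q2, q3⟩
    exact ⟨(q2.reg 15 (by decide)).trans h15, (q2.reg 13 (by decide)).trans h13,
      (q2.reg 14 (by decide)).trans h14,
      ⟨hsame.trans (q2.mono (by decide) (by decide)), q1⟩, by omega⟩
  · rintro s' k' - ⟨⟨h1, h2⟩, h3⟩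
    refine ⟨h1, Net.Inv.total h2 fun i hi b hb a ha => ?_, h3⟩
    simp only [Before]; omega

def init : Program :=
  .seq initEnds <| .seq initRel <| .seq initLists <| .seq initCounts initEvents

theorem init_cost (n d e : ℕ) : (e * 6 + 2) + (e * (d * (d * (2 + 2) + 2 + 2) + 2 + 2) + 2) +
    ((e + e) * 4 + 2) + ((e + e) * (d * (d * (4 * (d + 1) + 4 + 2) + 2 + 2) + 2 + 2) + 2) +
    (n * (d * (d * (44 * (d + 1) + 4 + 2) + 2 + 2) + 2 + 2) + 2) ≤
    100 * (n + 2 * e + 1) * (d + 1) ^ 3 := by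
  ring_nf
  omega

theorem init_spec {Λ : Layout} (hX : Fits Λ Λ.net) {s : ASt} {k : ℕ}
    (hA : ∀ i < Λ.n, ∀ a < Λ.d, s.alv i a ≤ 1)
    (hbit : ∀ p < Λ.e, ∀ x < Λ.d * Λ.d, Λ.blk p (2 + x) ≤ 1)
    (hsupp : ∀ f < Λ.net.E, ∀ b < Λ.d, s.alv (Λ.net.src f) b = 1 →
      ∃ c < Λ.d, s.alv (Λ.net.dst f) c = 1 ∧ Λ.net.R f b c = true)
    (hreg : ∀ r, s.reg r = 0) (h3 : ∀ α x y z, s.a3 α x y z = 0)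
    (hk : 100 * (Λ.F + 1) * Λ.D ^ 3 ≤ k) :
    WP Λ init (fun s' k' => Stat Λ.net s' ∧ MInv Λ.net s' ∧ Sem Λ.net s'.alv (s'.a3 5) ∧
      s'.alv = s.alv ∧ s'.reg 1 = 0 ∧ tok Λ s' + k ≤ 100 * (Λ.F + 1) * Λ.D ^ 3 + k') s k := by
  have hcost := init_cost Λ.n Λ.d Λ.e
  rw [show Λ.n + 2 * Λ.e + 1 = Λ.F + 1 from rfl, show Λ.d + 1 = Λ.D from rfl] at hcost
  have hlt : ∀ f < Λ.net.E, Λ.net.src f < Λ.n := hX.src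
  refine WP.seq (WP.imp (initEnds_spec hX.valid (by omega)) ?_)
  rintro s₁ k₁ - ⟨a1, a2, a3⟩
  refine WP.seq (WP.imp (initRel_spec hX.valid hbit (by omega)) ?_)
  rintro s₂ k₂ - ⟨b1, b2, b3⟩
  have b4 : ∀ f < Λ.net.E, s₂.a3 0 f 0 0 = Λ.net.src f := fun f hf => by
    rw [b1.a3 0 (by decide), (a2 f hf).1]
  refine WP.seq (WP.imp (initLists_spec hX.valid b4 hlt
    (fun x => by rw [b1.a3 3 (by decide), a1.a3 3 (by decide), h3]) (by omega)) ?_)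
  rintro s₃ k₃ - ⟨c1, c2, c3, c4⟩
  have hS3 : Stat Λ.net s₃ := by
    refine ⟨fun f hf => ?_, fun f hf => ?_, fun f hf a ha c hc => ?_, fun i _ => c2 i, c3⟩
    · rw [c1.a3 0 (by decide), b4 f hf]
    · rw [c1.a3 1 (by decide), b1.a3 1 (by decide), (a2 f hf).2]
    · rw [c1.a3 2 (by decide), b2 f hf a ha c hc]
  have hs3 : Same [10, 11, 12] [0, 1, 2, 3, 4] s s₃ :=
    ((a1.mono (by decide) (by decide)).trans (b1.mono (by decide) (by decide))).trans
      (c1.mono (by decide) (by decide))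
  have hz : ∀ α, α ∉ [0, 1, 2, 3, 4] → s₃.a3 α = fun _ _ _ => 0 := by
    intro α hα
    funext x y z
    rw [hs3.a3 α hα, h3]
  refine WP.seq (WP.imp (initCounts_spec hX hS3 (by rw [hs3.alv]; exact hA) (hz 5 (by decide))
    (hz 6 (by decide)) (hz 7 (by decide)) (by omega)) ?_)
  rintro s₄ k₄ - ⟨d1, d2, d3⟩
  have hs4 : ∀ r, r ∉ [10, 11, 12, 17, 18] → s₄.reg r = 0 := by
    intro r hr
    rw [d1.reg r hr, hs3.reg r (by simp at hr ⊢; tauto), hreg]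
  have halv : s₄.alv = s.alv := d1.alv.trans hs3.alv
  have h8 : s₄.a3 8 = fun _ _ _ => 0 := (d1.a3 8 (by decide)).trans (hz 8 (by decide))
  have h9 : s₄.a3 9 = fun _ _ _ => 0 := (d1.a3 9 (by decide)).trans (hz 9 (by decide))
  have htok : tok Λ s₄ = 0 := by
    simp [tok, hs4 7 (by decide), hs4 8 (by decide), hs4 1 (by decide)]
  have hns : ∀ i b a, ¬ nsSet s₄ i b a := by
    rintro i b a ⟨x, hx, -⟩
    rw [hs4 7 (by decide)] at hx; omega
  have hcq : ∀ f b, ¬ cSet s₄ f b := by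
    rintro f b ⟨x, hx, -⟩
    rw [hs4 8 (by decide)] at hx; omega
  have hI : SInv Λ.net (Before Λ.d Λ.d 0 0 0) (fun _ _ => False) s₄ := by
    constructor
    · intro f hf b hb
      rw [d2.pos f hf b hb b hb ⟨hf, hb, hb⟩]
      simp [Net.obs]
    · exact fun i _ b _ a _ => d2.card i b a
    · exact fun i _ b _ a _ => d2.sum i b a
    · intro f _ b _ c _
      rw [h8, h9]; simp
    · intro i _ b _ a _ h
      rw [h8] at h; exact absurd rfl h
    · exact fun i _ b _ a _ h => absurd h before_zero
    · intro i _ b _ a _ _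
      rw [h8]
    · exact fun i _ b _ a _ h => absurd h before_zero
    · exact fun i b a h => absurd h (hns _ _ _)
    -- Here arc consistency enters: all `S` are 0, so a value with a support satisfies no condition,
    -- and the empty stack of conditions is complete.
    · intro f hf b hb h1 h2
      rw [halv] at h1
      obtain ⟨c, hc, hc1, hc2⟩ := hsupp f hf b hb h1
      refine absurd ?_ (h2 c hc (by rw [halv]; exact hc1) hc2)
      rw [h9]
    · exact fun f b h => absurd h (hcq _ _)
  refine WP.imp (initEvents_spec hX (d1.stat hS3 (by decide)) (by rw [halv]; exact hA) hI
    (by rw [htok]; omega)) ?_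
  rintro s₅ k₅ - ⟨f1, f2, f3⟩
  refine ⟨f1.stat (d1.stat hS3 (by decide)) (by decide), f2, ?_, f1.alv.trans halv, ?_, by omega⟩
  · rw [f1.alv, f1.a3 5 (by decide), halv]
    refine ⟨hA, fun f hf b hb a ha => ?_⟩
    rw [d2.pos f hf b hb a ha ⟨hf, hb, ha⟩, hs3.alv]
    rfl
  · rw [f1.reg 1 (by decide), hs4 1 (by decide)]

end RAM

namespace RAM

open AExpr

/-! ### The whole program -/

theorem sumN_le (n d : ℕ) (N : ℕ → ℕ → ℕ → ℕ) : sumN n d N ≤ n * (d * (d * 2)) := by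
  refine (Finset.sum_le_card_nsmul _ _ (d * (d * 2)) fun i _ => ?_).trans (by simp)
  refine (Finset.sum_le_card_nsmul _ _ (d * 2) fun b _ => ?_).trans (by simp)
  exact (Finset.sum_le_card_nsmul _ _ 2 fun a _ => min_le_right _ _).trans (by simp)

theorem Net.sum_deg_le (X : Net) (g : ℕ) : ∑ i ∈ Finset.range X.n, X.deg i g ≤ g := by
  induction g with
  | zero => simp [Net.deg]
  | succ g ih =>
    simp only [Net.deg_succ, Finset.sum_add_distrib]
    have : ∑ i ∈ Finset.range X.n, (if X.src g = i then 1 else 0) ≤ 1 := by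
      rw [Finset.sum_ite_eq]
      split <;> omega
    omega

theorem sumA_le {X : Net} {A : ℕ → ℕ → ℕ} (hA : ∀ i < X.n, ∀ a < X.d, A i a ≤ 1) :
    sumA X A ≤ X.d * (X.E + X.n) := by
  have h1 : sumA X A ≤ ∑ i ∈ Finset.range X.n, X.d * (X.deg i X.E + 1) := by
    refine Finset.sum_le_sum fun i hi => ?_
    refine (Finset.sum_le_card_nsmul _ _ (X.deg i X.E + 1) fun a ha => ?_).trans (by simp)
    have := hA i (Finset.mem_range.1 hi) a (Finset.mem_range.1 ha)
    calc A i a * (X.deg i X.E + 1) ≤ 1 * (X.deg i X.E + 1) := Nat.mul_le_mul_right _ this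
      _ = _ := one_mul _
  refine h1.trans ?_
  rw [← Finset.mul_sum, Finset.sum_add_distrib]
  refine Nat.mul_le_mul_left _ ?_
  have := X.sum_deg_le X.E
  simp only [Finset.sum_const, Finset.card_range, smul_eq_mul, mul_one]
  omega

/-! ### Computation of the parameters and of the memory layout. -/

def lenExpr : Expr :=
  .op .add (.op .mul (.op .mul (.op .mul (.lit 32)
    (.op .add (.op .add (.reg 4) (.op .mul (.lit 2) (.reg 6))) (.lit 1))) (.reg 3)) (.reg 3)) (.lit 4)

def baseExpr : Expr :=
  .op .add (.op .add (.lit 3) (.op .mul (.reg 4) (.reg 5)))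
    (.op .mul (.reg 6) (.op .add (.lit 2) (.op .mul (.reg 5) (.reg 5))))

/-- Read the parameters of the input and lay out the memory. -/
def prologue : Program :=
  .seq (.set 4 (.load (.lit 0))) <| .seq (.set 5 (.load (.lit 1))) <|
    .seq (.set 6 (.load (.lit 2))) <| .seq (.set 3 (.op .add (.reg 5) (.lit 1))) <|
    .seq (.set 2 baseExpr) (.set 0 (.op .add (.reg 2) (.op .mul (.lit 32) lenExpr)))

def program : Program := .seq prologue (.seq init mainLoop)

/-- The layout chosen by the program. -/
def layout (n d e : ℕ) (blk : ℕ → ℕ → ℕ) (L : Size) : Layout where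
  n := n
  d := d
  e := e
  M := 32 * (n + 2 * e + 1) * (d + 1) * (d + 1) + 4
  K := 1024 * (n + 2 * e + 1) * (d + 1) ^ 3
  blk := blk
  L := L

/-- The state `σ` holds the input from which the layout `Λ` was computed. -/
structure Holds (Λ : Layout) (σ : State) : Prop where
  reg : ∀ r, σ.reg r = 0
  n : σ.mem 0 = Λ.n
  d : σ.mem 1 = Λ.d
  e : σ.mem 2 = Λ.e
  blk : ∀ p < Λ.e, ∀ x < 2 + Λ.d * Λ.d,
    σ.mem ((3 + Λ.n * Λ.d) + (p * (2 + Λ.d * Λ.d) + x)) = Λ.blk p x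
  rest : ∀ x, Λ.base ≤ x → σ.mem x = 0
  le : ∀ x, σ.mem x ≤ Λ.low

/-- The abstract form of the initial state. -/
def start (Λ : Layout) (σ : State) : ASt where
  reg _ := 0
  alv x y := σ.mem (3 + (x * Λ.d + y))
  out _ := 0
  a3 _ _ _ _ := 0
  a1 _ _ := 0

/-- The second conclusion restores the bound on the registers for the next assignment. Six of these,
at 41 units each, fit into the 300 units allowed for the prologue. -/
theorem Exec.set_of_bound {L : Size} {reg mem : ℕ → ℕ} {Z : ℕ} (r : ℕ) (x : Expr) (v : ℕ)
    (hZ : 100 ≤ Z) (hreg : ∀ r, reg r ≤ Z) (hmem : ∀ x, mem x ≤ Z) (hW : Z ^ 128 < L.words)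
    (hl : x.smallLits = true) (hs : x.Safe L ⟨reg, mem⟩) (hc : x.cost ≤ 40)
    (hx : x.tot ⟨reg, mem⟩ = v) (hv : v ≤ Z) :
    (∃ t ≤ 41, Exec L (.set r x) ⟨reg, mem⟩ t ⟨Function.update reg r v, mem⟩) ∧
      ∀ r', Function.update reg r v r' ≤ Z := by
  subst hx
  refine ⟨⟨x.cost + 1, by omega, Exec.set _ r x _
    (Expr.eval_eq_tot hZ hreg hmem hW x hl hs (by omega)).1⟩, fun r' => ?_⟩
  have := hreg r'
  simp only [Function.update_apply]
  split <;> omega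

theorem prologue_spec {Λ : Layout} (hΛ : Λ.Valid)
    (hM : Λ.M = 32 * (Λ.n + 2 * Λ.e + 1) * (Λ.d + 1) * (Λ.d + 1) + 4) {σ : State}
    (hσ : Holds Λ σ) :
    ∃ t σ', t ≤ 300 ∧ Exec Λ.L prologue σ t σ' ∧ Rel Λ σ' (start Λ σ) Λ.low := by
  have hcells := hΛ.cells
  have h100 : 100 ≤ Λ.low := by simp [Layout.low]
  have hb : Λ.base = (3 + Λ.n * Λ.d) + Λ.e * (2 + Λ.d * Λ.d) := rfl
  have hl : Λ.low = Λ.base + 33 * Λ.M + (2 * Λ.e + 1) * (2 * Λ.e + 1) + 100 := rfl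
  have hW : Λ.low ^ 128 < Λ.L.words :=
    lt_of_le_of_lt (Nat.pow_le_pow_left (Nat.le_add_right _ _) _) hΛ.words
  have hn := hσ.le 0
  have hd := hσ.le 1
  have he := hσ.le 2
  rw [hσ.n] at hn
  rw [hσ.d] at hd
  rw [hσ.e] at he
  have hdM : Λ.d + 1 ≤ Λ.M := by
    rw [hM, mul_assoc]
    have : 1 ≤ (Λ.d + 1) * (Λ.d + 1) := Nat.mul_pos (by omega) (by omega)
    have h2 : Λ.d + 1 ≤ (Λ.d + 1) * (Λ.d + 1) := Nat.le_mul_of_pos_left _ (by omega)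
    have h3 : (Λ.d + 1) * (Λ.d + 1) ≤ 32 * (Λ.n + 2 * Λ.e + 1) * ((Λ.d + 1) * (Λ.d + 1)) :=
      Nat.le_mul_of_pos_left _ (by omega)
    omega
  have e0 := hσ.reg
  have en := hσ.n
  have ed := hσ.d
  have ee := hσ.e
  have hle := hσ.le
  have hblk := hσ.blk
  have hrest := hσ.rest
  obtain ⟨reg, mem⟩ := σ
  simp only at e0 en ed ee hle hblk hrest
  obtain ⟨⟨t1, k1, e1⟩, b1⟩ := Exec.set_of_bound (L := Λ.L) (reg := reg) (mem := mem) 4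
    (.load (.lit 0)) Λ.n h100 (fun r => by rw [e0]; omega) hle hW (by rfl)
    ⟨trivial, by simp only [Expr.tot]; omega⟩ (by decide) en hn
  obtain ⟨⟨t2, k2, e2⟩, b2⟩ := Exec.set_of_bound 5 (.load (.lit 1)) Λ.d h100
    b1 hle hW (by rfl) ⟨trivial, by simp only [Expr.tot]; omega⟩ (by decide) ed hd
  obtain ⟨⟨t3, k3, e3⟩, b3⟩ := Exec.set_of_bound 6 (.load (.lit 2)) Λ.e h100
    b2 hle hW (by rfl) ⟨trivial, by simp only [Expr.tot]; omega⟩ (by decide) ee he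
  obtain ⟨⟨t4, k4, e4⟩, b4⟩ := Exec.set_of_bound 3 (.op .add (.reg 5) (.lit 1)) Λ.D h100
    b3 hle hW (by rfl) ⟨trivial, trivial⟩ (by decide)
    (by simp [Expr.tot, BinOp.apply, Layout.D]) (by simp only [Layout.D]; omega)
  obtain ⟨⟨t5, k5, e5⟩, b5⟩ := Exec.set_of_bound 2 baseExpr Λ.base h100
    b4 hle hW (by rfl) (by simp [baseExpr, Expr.Safe]) (by decide)
    (by simp [baseExpr, Expr.tot, BinOp.apply, Layout.base]) (by omega)
  obtain ⟨⟨t6, k6, e6⟩, b6⟩ := Exec.set_of_bound 0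
    (.op .add (.reg 2) (.op .mul (.lit 32) lenExpr)) (Λ.base + 32 * Λ.M) h100
    b5 hle hW (by rfl) (by simp [lenExpr, Expr.Safe]) (by decide)
    (by simp [lenExpr, Expr.tot, BinOp.apply, Layout.D, hM]) (by omega)
  refine ⟨_, _, ?_, Exec.seq _ _ _ _ _ _ _ e1 (Exec.seq _ _ _ _ _ _ _ e2 (Exec.seq _ _ _ _ _ _ _ e3
    (Exec.seq _ _ _ _ _ _ _ e4 (Exec.seq _ _ _ _ _ _ _ e5 e6)))), ?_⟩
  · omega
  · constructor
    · simp
    · simp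
    · simp
    · simp
    · simp
    · simp
    · intro r hr
      have hr' : r = 1 ∨ 7 ≤ r := by simpa [userReg] using hr
      have hne : r ≠ 0 ∧ r ≠ 2 ∧ r ≠ 3 ∧ r ≠ 4 ∧ r ≠ 5 ∧ r ≠ 6 := by omega
      simp [hne, e0, start]
    · exact fun _ _ _ _ => rfl
    · exact hblk
    · intro α _ x _ y _ z _
      exact hrest _ (by omega)
    · intro α _ x _
      exact hrest _ (by omega)
    · intro x _
      exact hrest _ (by omega)
    · exact b6
    · exact hle
    · exact le_rfl

theorem layout_fits {n d e : ℕ} {blk : ℕ → ℕ → ℕ} {L : Size}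
    (hblk : ∀ p < e, blk p 0 < n ∧ blk p 1 < n) (hv : (layout n d e blk L).Valid) :
    Fits (layout n d e blk L) (layout n d e blk L).net := by
  have hb : ∀ f < 2 * e, ¬ f < e → blk (f - e) 0 < n ∧ blk (f - e) 1 < n :=
    fun f hf h => hblk _ (by omega)
  have hh : 2 * e / 2 = e := by omega
  constructor
  · rfl
  · rfl
  · rfl
  · intro f hf
    simp only [layout, Layout.net] at hf ⊢
    by_cases h : f < e
    · simpa [h] using (hblk f h).1
    · simpa [h] using (hb f hf h).2
  · intro f hf
    simp only [layout, Layout.net] at hf ⊢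
    by_cases h : f < e
    · simpa [h] using (hblk f h).2
    · simpa [h] using (hb f hf h).1
  · intro f hf
    simp only [layout, Layout.net, Net.rev, hh] at hf ⊢
    by_cases h : f < e
    · simp [h]
    · have h2 : f - e < e := by omega
      simp [h, h2]
  · intro f hf
    simp only [layout, Layout.net, Net.rev, hh] at hf ⊢
    by_cases h : f < e
    · simp [h]
    · have h2 : f - e < e := by omega
      simp [h, h2]
  -- `M` and `K` are matched so that `cap` is an equality; the summand 4 of `M` accounts for `128 *
  -- D`.
  · simp only [layout, Layout.D]
    apply le_of_eq
    ring
  · exact hv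

theorem run_spec {n d e : ℕ} {blk : ℕ → ℕ → ℕ} {L : Size} {Λ : Layout}
    (hΛ : Λ = layout n d e blk L) (hv : Λ.Valid)
    (hblk : ∀ p < e, blk p 0 < n ∧ blk p 1 < n) {σ : State} (hσ : Holds Λ σ)
    (hA : ∀ i < n, ∀ a < d, σ.mem (3 + (i * d + a)) ≤ 1)
    (hbit : ∀ p < e, ∀ x < d * d, blk p (2 + x) ≤ 1)
    (hsupp : ∀ f < Λ.net.E, ∀ b < d, σ.mem (3 + (Λ.net.src f * d + b)) = 1 →
      ∃ c < d, σ.mem (3 + (Λ.net.dst f * d + c)) = 1 ∧ Λ.net.R f b c = true)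
    {T : (ℕ → ℕ → ℕ) → ℕ → (ℕ → ℕ) → Prop}
    (hT0 : ∀ out, T (fun x y => σ.mem (3 + (x * d + y))) 0 out)
    (hT : ∀ s j c, Core Λ.net T s → Cand Λ.net s j c → T (upd2 s.alv j c 0) (s.reg 1 + 1)
      (Function.update (Function.update s.out (2 * s.reg 1) j) (2 * s.reg 1 + 1) c)) :
    ∃ t σ' s' Z, t ≤ 300 * Λ.K + 300 ∧ Exec L program σ t σ' ∧ Rel Λ σ' s' Z ∧
      Core Λ.net T s' ∧ s'.reg 7 = 0 ∧ s'.reg 8 = 0 ∧ 2 * s'.reg 1 + 4 ≤ Λ.M := by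
  have hX : Fits Λ Λ.net := by subst hΛ; exact layout_fits hblk hv
  have hn : Λ.n = n := by rw [hΛ]; rfl
  have hd : Λ.d = d := by rw [hΛ]; rfl
  have he : Λ.e = e := by rw [hΛ]; rfl
  have hL : Λ.L = L := by rw [hΛ]; rfl
  have hB : Λ.blk = blk := by rw [hΛ]; rfl
  have hK : Λ.K = 1024 * (Λ.F + 1) * Λ.D ^ 3 := by rw [hΛ]; rfl
  obtain ⟨t₀, σ₀, ht₀, hex₀, hR₀⟩ := prologue_spec hv (by rw [hΛ]; rfl) hσ
  have hinit := init_spec hX (s := start Λ σ) (k := Λ.K) (by rw [hn, hd]; simpa only [start, hd] using hA)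
    (by rw [he, hd, hB]; exact hbit) (by rw [hd]; simpa only [start, hd] using hsupp)
    (fun _ => rfl) (fun _ _ _ _ => rfl) (by rw [hK]; exact Nat.mul_le_mul_right _ (by omega))
  have hall : WP Λ (.seq init mainLoop) (fun s' _ => Core Λ.net T s' ∧ s'.reg 7 = 0 ∧
      s'.reg 8 = 0 ∧ 2 * s'.reg 1 + 4 ≤ Λ.M) (start Λ σ) Λ.K := by
    refine WP.seq (WP.imp hinit ?_)
    rintro s₁ k₁ - ⟨q1, q2, q3, q4, q5, q6⟩
    have hC : Core Λ.net T s₁ := by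
      refine ⟨q1, q2, q3, ?_⟩
      rw [q4, q5]
      simpa only [start, hd] using hT0 s₁.out
    refine mainLoop_spec hX hT hC ?_
    have h1 := sumN_le Λ.n Λ.d (s₁.a3 6)
    have h2 := sumA_le q3.bit
    have hF : Λ.F = Λ.n + 2 * Λ.e := rfl
    have hD : Λ.D = Λ.d + 1 := rfl
    -- The budget in units of `(F + 1) * D ^ 3`: 100 for the initialisation, 96 for the potential of
    -- the counters and 110 for the eliminations, within the 1024 provided.
    have h3 : 48 * Λ.D * sumN Λ.n Λ.d (s₁.a3 6) ≤ 96 * (Λ.F + 1) * Λ.D ^ 3 := by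
      calc 48 * Λ.D * sumN Λ.n Λ.d (s₁.a3 6) ≤ 48 * Λ.D * ((Λ.F + 1) * (Λ.D * (Λ.D * 2))) :=
            Nat.mul_le_mul_left _ (h1.trans (Nat.mul_le_mul (by omega) (Nat.mul_le_mul (by omega)
              (Nat.mul_le_mul_right _ (by omega)))))
        _ = _ := by ring
    have h4 : 110 * (Λ.D * Λ.D) * sumA Λ.net s₁.alv ≤ 110 * (Λ.F + 1) * Λ.D ^ 3 := by
      calc 110 * (Λ.D * Λ.D) * sumA Λ.net s₁.alv ≤ 110 * (Λ.D * Λ.D) * (Λ.D * (Λ.F + 1)) :=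
            Nat.mul_le_mul_left _ (h2.trans (Nat.mul_le_mul (by rw [hX.d]; omega)
              (by rw [hX.n, hX.E]; omega)))
        _ = _ := by ring
    have h5 : 1 ≤ (Λ.F + 1) * Λ.D ^ 3 := Nat.mul_pos (by omega) (Nat.pow_pos (by omega))
    rw [hK] at q6
    simp only [mul_assoc 1024, mul_assoc 100, mul_assoc 96 (_ + 1), mul_assoc 110 (_ + 1)] at h3 h4 q6
    simp only [pot]
    omega
  obtain ⟨t₁, σ₁, s₁, k₁, hex₁, ht₁, hR₁, hQ⟩ := hall le_rfl σ₀ Λ.low hR₀ le_rfl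
  rw [hL] at hex₀ hex₁
  exact ⟨t₀ + t₁, σ₁, s₁, _, by omega, Exec.seq _ _ _ _ _ _ _ hex₀ hex₁, hR₁, hQ⟩

end RAM

namespace BinaryCSP

variable {n : ℕ}

/-! ### Substitution in reduced instances -/

theorem EliminatesTo.append {I J : BinaryCSP n} {l : List (Fin n × ℕ)} {i : Fin n} {b : ℕ}
    (h : I.EliminatesTo l J) (hs : J.PriorityStep i b) :
    I.EliminatesTo (l ++ [(i, b)]) (J.eliminate i b) := by
  induction l generalizing I with
  | nil =>
    simp only [EliminatesTo] at h
    subst h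
    exact ⟨hs, rfl⟩
  | cons p l ih => exact ⟨h.1, ih h.2⟩

theorem mem_eliminate {J : BinaryCSP n} {i i' : Fin n} {b a : ℕ} :
    a ∈ (J.eliminate i b).dom i' ↔ a ∈ J.dom i' ∧ ¬ (i' = i ∧ a = b) := by
  simp only [eliminate, Function.update_apply]
  by_cases h : i' = i
  · subst h; simp [and_comm]
  · simp [h]

/-- Wherever `b` was a support, another one is needed. For NS it is the substitute. For CNS
conditioned by `x_j` it is given directly at `x_j`; at another variable, take a support `c` of `b`
at `x_j` and use the substitute belonging to `c`. -/
theorem ArcConsistent.eliminate {J : BinaryCSP n} (h : J.ArcConsistent) {i : Fin n} {b : ℕ}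
    (hs : J.PriorityStep i b) : (J.eliminate i b).ArcConsistent := by
  have key : b ∈ J.dom i ∧ ∀ k, k ≠ i → ∀ v ∈ J.dom k, J.rel i k b v = true →
      ∃ a ∈ J.dom i, a ≠ b ∧ J.rel i k a v = true := by
    rcases hs with ⟨hb, a, ha, hab, harr⟩ | ⟨⟨hb, j, hj, hc⟩, -⟩
    · exact ⟨hb, fun k hk v hv hr => ⟨a, ha, hab, harr k hk v hv hr⟩⟩
    · refine ⟨hb, fun k hk v hv hr => ?_⟩
      by_cases hkj : k = j
      · subst hkj
        obtain ⟨a, ha, hab, h1, -⟩ := hc v hv hr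
        exact ⟨a, ha, hab, h1⟩
      · obtain ⟨c, hc1, hc2⟩ := h i j hj.symm b hb
        obtain ⟨a, ha, hab, -, h2⟩ := hc c hc1 hc2
        exact ⟨a, ha, hab, h2 k hk hkj v hv hr⟩
  intro i' j' hij v hv
  rw [mem_eliminate] at hv
  obtain ⟨w, hw, hr⟩ := h i' j' hij v hv.1
  by_cases hwb : j' = i ∧ w = b
  · obtain ⟨rfl, rfl⟩ := hwb
    rw [J.rel_symm _ _ hij] at hr
    obtain ⟨a, ha, hab, h1⟩ := key.2 i' hij v hv.1 hr
    refine ⟨a, mem_eliminate.2 ⟨ha, fun h' => hab h'.2⟩, ?_⟩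
    show J.rel i' j' v a = true
    rw [J.rel_symm _ _ hij, h1]
  · exact ⟨w, mem_eliminate.2 ⟨hw, hwb⟩, hr⟩

/-- The network `X` consists of the constraints of `I`, in both orientations. -/
structure Models (I : BinaryCSP n) (X : RAM.Net) : Prop where
  size : X.n = n
  d : X.d = I.maxDom
  edge : ∀ f < X.E, ∃ i j : Fin n, X.src f = i ∧ X.dst f = j ∧ I.constraintGraph.Adj i j ∧
    ∀ b < I.maxDom, ∀ c < I.maxDom,
      (X.R f b c = true ↔ b ∈ I.dom i ∧ c ∈ I.dom j ∧ I.rel i j b c = true)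
  exists_edge : ∀ i j : Fin n, I.constraintGraph.Adj i j → ∃ f < X.E, X.src f = i ∧ X.dst f = j
  unique : ∀ f < X.E, ∀ g < X.E, X.src f = X.src g → X.dst f = X.dst g → f = g

/-- `J` is a reduced form of `I`, whose domains are described by `A`. -/
structure Reduct (I J : BinaryCSP n) (A : ℕ → ℕ → ℕ) : Prop where
  rel : J.rel = I.rel
  sub : ∀ i, J.dom i ⊆ I.dom i
  ac : J.ArcConsistent
  alive : ∀ (i : Fin n) (a : ℕ), a < I.maxDom → A i a = if a ∈ J.dom i then 1 else 0

/-! ### The counters and substitution in the reduced instance. -/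

section

variable {I J : BinaryCSP n} {X : RAM.Net} {A : ℕ → ℕ → ℕ} {W : ℕ → ℕ → ℕ → ℕ}

theorem Reduct.lt (hR : I.Reduct J A) (hI : I.Numbered) {i : Fin n} {a : ℕ} (ha : a ∈ J.dom i) :
    a < I.maxDom := Finset.mem_range.1 (hI i (hR.sub i ha))

theorem Reduct.alive_iff (hR : I.Reduct J A) {i : Fin n} {a : ℕ} (ha : a < I.maxDom) :
    A i a = 1 ↔ a ∈ J.dom i := by
  rw [hR.alive i a ha]; simp

theorem Reduct.rel_of_not_adj (hR : I.Reduct J A) {i j : Fin n} (hij : i ≠ j)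
    (h : ¬ I.constraintGraph.Adj i j) {a c : ℕ} (ha : a ∈ J.dom i) (hc : c ∈ J.dom j) :
    J.rel i j a c = true := by
  rw [hR.rel]
  by_contra h'
  exact h ⟨hij, a, hR.sub i ha, c, hR.sub j hc, by simpa using h'⟩

theorem Models.arrow_iff (hX : I.Models X) (hI : I.Numbered) (hR : I.Reduct J A)
    (hS : RAM.Sem X A W) {f : ℕ} {i j : Fin n} {b a : ℕ} (hf : f < X.E) (hi : X.src f = i)
    (hj : X.dst f = j) (hb : b ∈ J.dom i) (ha : a ∈ J.dom i) :
    W f b a = 0 ↔ J.Arrow i j b a := by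
  obtain ⟨i', j', hi', hj', -, hrel⟩ := hX.edge f hf
  obtain rfl : i = i' := Fin.ext (by omega)
  obtain rfl : j = j' := Fin.ext (by omega)
  have hb' := hR.lt hI hb
  have ha' := hR.lt hI ha
  rw [hS.cnt f hf b (by rw [hX.d]; exact hb') a (by rw [hX.d]; exact ha'), hX.d, Finset.card_eq_zero,
    Finset.filter_eq_empty_iff]
  constructor
  · intro h c hc hr
    by_contra hac
    have hc' := hR.lt hI hc
    refine h (Finset.mem_range.2 hc') ⟨?_, ?_, ?_⟩
    · rw [hj]; exact (hR.alive_iff hc').2 hc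
    · rw [hrel b hb' c hc', ← hR.rel]; exact ⟨hR.sub i hb, hR.sub j hc, hr⟩
    · rw [hrel a ha' c hc', ← hR.rel]; exact fun h3 => hac h3.2.2
  · rintro h c hc ⟨h1, h2, h3⟩
    have hc' := Finset.mem_range.1 hc
    rw [hj, hR.alive_iff hc'] at h1
    rw [hrel b hb' c hc', ← hR.rel] at h2
    rw [hrel a ha' c hc', ← hR.rel] at h3
    exact h3 ⟨hR.sub i ha, hR.sub j h1, h c h1 h2.2.2⟩

/-- Pairs of variables without a listed constraint impose nothing, so only listed constraints have
to be checked. The predicate `p` serves to leave out a conditioning variable. -/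
theorem Models.arrows_iff (hX : I.Models X) (hI : I.Numbered) (hR : I.Reduct J A)
    (hS : RAM.Sem X A W) {i : Fin n} {b a : ℕ} (hb : b ∈ J.dom i) (ha : a ∈ J.dom i)
    (p : Fin n → Prop) : (∀ k, k ≠ i → p k → J.Arrow i k b a) ↔
      ∀ f < X.E, X.src f = i → (∀ k : Fin n, X.dst f = k → p k) → W f b a = 0 := by
  constructor
  · intro h f hf hi hp
    obtain ⟨i', j, hi', hj, hadj, -⟩ := hX.edge f hf
    obtain rfl : i = i' := Fin.ext (by omega)
    exact (hX.arrow_iff hI hR hS hf hi hj hb ha).2 (h j hadj.1.symm (hp j hj))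
  · intro h k hk hp
    by_cases hadj : I.constraintGraph.Adj i k
    · obtain ⟨f, hf, hi, hj⟩ := hX.exists_edge i k hadj
      refine (hX.arrow_iff hI hR hS hf hi hj hb ha).1 (h f hf hi fun k' hk' => ?_)
      obtain rfl : k = k' := Fin.ext (by omega)
      exact hp
    · exact fun c hc _ => hR.rel_of_not_adj hk.symm hadj ha hc

end

/-- The list of eliminations in `out`, of length `len`, leads to the domains described by `A`. -/
def Trace (I : BinaryCSP n) (A : ℕ → ℕ → ℕ) (len : ℕ) (out : ℕ → ℕ) : Prop :=
  ∃ (l : List (Fin n × ℕ)) (J : BinaryCSP n), I.EliminatesTo l J ∧ I.Reduct J A ∧ len = l.length ∧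
    ∀ (t : ℕ) (ht : t < l.length), out (2 * t) = (l[t].1 : ℕ) ∧ out (2 * t + 1) = l[t].2

/-! ### Legitimacy of the candidates and completeness of the stacks. -/

section

variable {I J : BinaryCSP n} {X : RAM.Net} {s : RAM.ASt}
  {T : (ℕ → ℕ → ℕ) → ℕ → (ℕ → ℕ) → Prop}

theorem Models.card_eq_zero_iff (hX : I.Models X) (hI : I.Numbered) (hR : I.Reduct J s.alv)
    (hC : RAM.Core X T s) {i : Fin n} {b a : ℕ} (hb : b ∈ J.dom i) (ha : a ∈ J.dom i) :
    s.a3 6 i b a = 0 ↔ ∀ k, k ≠ i → J.Arrow i k b a := by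
  have h := hX.arrows_iff hI hR hC.sem hb ha fun _ => True
  simp only [forall_const] at h
  rw [h, hC.inv.cnt i (by rw [hX.size]; exact i.2) b (by rw [hX.d]; exact hR.lt hI hb) a
    (by rw [hX.d]; exact hR.lt hI ha), Finset.card_eq_zero, Finset.eq_empty_iff_forall_notMem]
  simp only [RAM.Net.mem_act]
  constructor
  · intro h f hf hi
    by_contra hW
    exact h f ⟨hf, hi, hW⟩
  · rintro h f ⟨hf, hi, hW⟩
    exact hW (h f hf hi)

/-- An NS value comes with a triple having `N = 0`, which by `nsMem` would lie on the stack of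
substitutions. -/
theorem Models.not_NS (hX : I.Models X) (hI : I.Numbered) (hR : I.Reduct J s.alv)
    (hC : RAM.Core X T s) (h7 : s.reg 7 = 0) (i : Fin n) (b : ℕ) : ¬ J.NS i b := by
  rintro ⟨hb, a, ha, hab, harr⟩
  have hN := (hX.card_eq_zero_iff hI hR hC hb ha).2 harr
  have hb' := hR.lt hI hb
  have ha' := hR.lt hI ha
  obtain ⟨x, hx, -⟩ := hC.inv.nsMem i (by rw [hX.size]; exact i.2) b (by rw [hX.d]; exact hb') a
    (by rw [hX.d]; exact ha') trivial hN ((hR.alive_iff ha').2 ha) ((hR.alive_iff hb').2 hb) hab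
  omega

/-- For a condition, a nonzero count `S` provides a value recorded in `G`; by `good` it survives,
differs from the eliminated value and is obstructed at most in the conditioning constraint. Priority
is respected because the stack of substitutions is empty. -/
theorem Models.priorityStep (hX : I.Models X) (hI : I.Numbered) (hR : I.Reduct J s.alv)
    (hC : RAM.Core X T s) {j : Fin n} {c : ℕ} (h : RAM.Cand X s j c) :
    J.PriorityStep j c := by
  obtain ⟨hj, hc, hA, h⟩ := h
  rw [hX.d] at hc
  have hcm := (hR.alive_iff hc).1 hA
  rcases h with ⟨a, ha, hAa, hac, hN⟩ | ⟨h7, f, hf, hsrc, hS⟩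
  · rw [hX.d] at ha
    have ham := (hR.alive_iff ha).1 hAa
    exact Or.inl ⟨hcm, a, ham, hac, (hX.card_eq_zero_iff hI hR hC hcm ham).1 hN⟩
  · refine Or.inr ⟨⟨hcm, ?_⟩, hX.not_NS hI hR hC h7⟩
    obtain ⟨i', k, hi', hk, hadj, hrel⟩ := hX.edge f hf
    obtain rfl : j = i' := Fin.ext (by omega)
    refine ⟨k, hadj.1.symm, fun c' hc' hr => ?_⟩
    have hlt := hR.lt hI hc'
    have hne := hS c' (by rw [hX.d]; exact hlt) (by rw [hk]; exact (hR.alive_iff hlt).2 hc')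
      (by rw [hrel c hc c' hlt, ← hR.rel]; exact ⟨hR.sub _ hcm, hR.sub _ hc', hr⟩)
    rw [hC.inv.supp f hf c (by rw [hX.d]; exact hc) c' (by rw [hX.d]; exact hlt)] at hne
    obtain ⟨a, ha⟩ := Finset.card_ne_zero.1 hne
    rw [Finset.mem_filter, Finset.mem_range, hX.d] at ha
    obtain ⟨ha, hG, hRa⟩ := ha
    rw [hsrc] at hG
    obtain ⟨h1, h2, g, hg, -, hGg, hW⟩ := hC.inv.good j hj c (by rw [hX.d]; exact hc) a
      (by rw [hX.d]; exact ha) (by omega)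
    obtain rfl : g = f := by omega
    have ham := (hR.alive_iff ha).1 h1
    rw [hrel a ha c' hlt, ← hR.rel] at hRa
    refine ⟨a, ham, h2, hRa.2.2, (hX.arrows_iff hI hR hC.sem hcm ham fun k' => k' ≠ k).2 ?_⟩
    intro f' hf' hs' hp
    refine hW f' hf' hs' ?_
    rintro rfl
    exact hp k hk rfl

/-- Suppose the condition is a listed constraint `f`. The substitute `a` for a given `c` is
obstructed at most in `f`, and since `b` is not NS it is obstructed there; so `N = 1` and `a` has
been counted in `S f b c`. All these counts are then nonzero, and `cMem` puts `(f, b)` on an empty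
stack. -/
theorem Models.not_CNS (hX : I.Models X) (hI : I.Numbered) (hR : I.Reduct J s.alv)
    (hC : RAM.Core X T s) (h7 : s.reg 7 = 0) (h8 : s.reg 8 = 0) (i : Fin n) (b : ℕ) :
    ¬ J.CNS i b := by
  rintro ⟨hb, j, hj, hall⟩
  have hNS := hX.not_NS hI hR hC h7 i b
  have hin : (i : ℕ) < X.n := by rw [hX.size]; exact i.2
  have hb' := hR.lt hI hb
  have hbX : b < X.d := by rw [hX.d]; exact hb'
  by_cases hadj : I.constraintGraph.Adj i j
  · obtain ⟨f, hf, hi, hjf⟩ := hX.exists_edge i j hadj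
    obtain ⟨i', j', hi', hj', -, hrel⟩ := hX.edge f hf
    obtain rfl : i = i' := Fin.ext (by omega)
    obtain rfl : j = j' := Fin.ext (by omega)
    have hq := hC.inv.cMem f hf b hbX (by rw [hi]; exact (hR.alive_iff hb').2 hb) ?_
    · rcases hq with ⟨x, hx, -⟩ | hq
      · omega
      · exact hq
    · intro c hc hA hr
      rw [hX.d] at hc
      rw [hjf, hR.alive_iff hc] at hA
      rw [hrel b hb' c hc, ← hR.rel] at hr
      obtain ⟨a, ha, hab, hra, harr⟩ := hall c hA hr.2.2
      have ha' := hR.lt hI ha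
      have haX : a < X.d := by rw [hX.d]; exact ha'
      have hothers : ∀ g < X.E, X.src g = i → g ≠ f → s.a3 5 g b a = 0 := by
        intro g hg hgi hgf
        refine (hX.arrows_iff hI hR hC.sem hb ha fun k => k ≠ j).1 harr g hg hgi ?_
        rintro k hk rfl
        exact hgf (hX.unique g hg f hf (by omega) (by omega))
      have hsub : X.act (s.a3 5) i b a ⊆ {f} := by
        intro g hg
        obtain ⟨h1, h2, h3⟩ := RAM.Net.mem_act.1 hg
        rw [Finset.mem_singleton]
        by_contra hgf
        exact h3 (hothers g h1 h2 hgf)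
      have hN0 : s.a3 6 i b a ≠ 0 := fun h0 =>
        hNS ⟨hb, a, ha, hab, (hX.card_eq_zero_iff hI hR hC hb ha).1 h0⟩
      have hcnt := hC.inv.cnt i hin b hbX a haX
      have hle := Finset.card_le_card hsub
      rw [Finset.card_singleton] at hle
      have hG := hC.inv.found i hin b hbX a haX trivial (by omega) ((hR.alive_iff ha').2 ha)
      obtain ⟨-, -, g, hg, hgi, hGg, hW⟩ := hC.inv.good i hin b hbX a haX hG
      -- `good` only excludes obstructions outside `g`. As `N ≠ 0` there is one, and it lies in `f`.
      have hgf : g = f := by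
        by_contra hgf
        obtain ⟨x, hx⟩ := Finset.card_ne_zero.1 (hcnt ▸ hN0)
        have hxf := Finset.mem_singleton.1 (hsub hx)
        subst hxf
        exact (RAM.Net.mem_act.1 hx).2.2 (hW x hf hi (Ne.symm hgf))
      subst hgf
      rw [hC.inv.supp g hg b hbX c (by rw [hX.d]; exact hc)]
      refine Finset.card_ne_zero_of_mem (a := a) (Finset.mem_filter.2 ⟨Finset.mem_range.2 haX, ?_, ?_⟩)
      · rw [hi]; exact hGg
      · rw [hrel a ha' c hc, ← hR.rel]
        exact ⟨hR.sub _ ha, hR.sub _ hA, hra⟩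
  -- The condition is trivial: a single support `c`, given by arc consistency, yields a substitute
  -- that works in every constraint, so `b` would be NS.
  · obtain ⟨c, hc, hr⟩ := hR.ac i j hj.symm b hb
    obtain ⟨a, ha, hab, -, harr⟩ := hall c hc hr
    refine hNS ⟨hb, a, ha, hab, fun k hk => ?_⟩
    by_cases hkj : k = j
    · subst hkj
      exact fun c' hc' _ => hR.rel_of_not_adj hj.symm hadj ha hc'
    · exact harr k hk hkj

theorem Models.trace (hX : I.Models X) (hI : I.Numbered) {j c : ℕ}
    (hC : RAM.Core X I.Trace s) (h : RAM.Cand X s j c) :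
    I.Trace (RAM.upd2 s.alv j c 0) (s.reg 1 + 1)
      (Function.update (Function.update s.out (2 * s.reg 1) j) (2 * s.reg 1 + 1) c) := by
  obtain ⟨l, J, hl, hR, hlen, hout⟩ := hC.rep
  have hj : j < n := by rw [← hX.size]; exact h.1
  obtain ⟨i, rfl⟩ : ∃ i : Fin n, (i : ℕ) = j := ⟨⟨j, hj⟩, rfl⟩
  have hstep := hX.priorityStep hI hR hC h
  refine ⟨l ++ [(i, c)], J.eliminate i c, hl.append hstep, ⟨hR.rel, ?_, hR.ac.eliminate hstep, ?_⟩,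
    by simp [hlen], ?_⟩
  · intro i' a ha
    exact hR.sub i' (mem_eliminate.1 ha).1
  · intro i' a ha
    have := hR.alive i' a ha
    simp only [RAM.upd2, mem_eliminate, Fin.val_inj]
    by_cases h' : i' = i ∧ a = c
    · simp [h']
    · simp [h', this]
  · intro t ht
    simp only [List.length_append, List.length_singleton] at ht
    rw [hlen]
    by_cases htl : t < l.length
    · rw [List.getElem_append_left htl, Function.update_of_ne (by omega), Function.update_of_ne (by omega),
        Function.update_of_ne (by omega), Function.update_of_ne (by omega)]
      exact hout t htl
    · obtain rfl : t = l.length := by omega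
      simp

end

end BinaryCSP

namespace BinaryCSP

variable {n : ℕ}

/-! ### The encoding of instances -/

theorem length_flatMap_const {α : Type*} (l : List α) (f : α → List ℕ) {m : ℕ}
    (hf : ∀ x ∈ l, (f x).length = m) : (l.flatMap f).length = l.length * m := by
  induction l with
  | nil => simp
  | cons x l ih =>
    rw [List.flatMap_cons, List.length_append, hf x (by simp), ih fun y hy => hf y (by simp [hy]),
      List.length_cons]
    ring

theorem getD_flatMap_const {α : Type*} (l : List α) (f : α → List ℕ) {m : ℕ}
    (hf : ∀ x ∈ l, (f x).length = m) {i x : ℕ} (hi : i < l.length) (hx : x < m) :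
    (l.flatMap f).getD (i * m + x) 0 = (f l[i]).getD x 0 := by
  induction l generalizing i with
  | nil => simp at hi
  | cons y l ih =>
    have hy := hf y (by simp)
    rw [List.flatMap_cons]
    cases i with
    | zero => rw [zero_mul, zero_add, List.getD_append _ _ _ _ (by omega)]; rfl
    | succ i =>
      have hle : (f y).length ≤ (i + 1) * m + x := by rw [hy, add_mul]; omega
      rw [List.getD_append_right _ _ _ _ hle, hy,
        show (i + 1) * m + x - m = i * m + x by rw [add_mul, one_mul]; omega]
      exact ih (fun z hz => hf z (by simp [hz])) (by simpa using hi)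

theorem getD_range_map {d a : ℕ} (g : ℕ → ℕ) (ha : a < d) :
    ((List.range d).map g).getD a 0 = g a := by
  simp [List.getD_eq_getElem?_getD, ha]

theorem length_domTable (dom : Fin n → Finset ℕ) (d : ℕ) : (domTable dom d).length = n * d := by
  rw [domTable, length_flatMap_const _ _ (m := d) (by simp), List.length_finRange]

theorem length_constraintBlock (I : BinaryCSP n) (p : Fin n × Fin n) :
    (I.constraintBlock p).length = 2 + I.maxDom * I.maxDom := by
  simp only [constraintBlock, List.length_cons]
  rw [length_flatMap_const _ _ (m := I.maxDom) (by simp), List.length_range]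
  omega

theorem length_encode (I : BinaryCSP n) (es : List (Fin n × Fin n)) : (I.encode es).length =
    (3 + n * I.maxDom) + es.length * (2 + I.maxDom * I.maxDom) := by
  simp only [encode, List.length_cons, List.length_append, length_domTable]
  rw [length_flatMap_const _ _ fun p _ => I.length_constraintBlock p]
  omega

theorem getD_encode (I : BinaryCSP n) (es : List (Fin n × Fin n)) (k : ℕ) :
    (I.encode es).getD (3 + k) 0 = (domTable I.dom I.maxDom ++ es.flatMap I.constraintBlock).getD k 0 := by
  rw [encode, add_comm]
  rfl

theorem mem_initState_dom (I : BinaryCSP n) (es : List (Fin n × Fin n)) (i : Fin n) {a : ℕ}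
    (ha : a < I.maxDom) :
    (I.initState es).mem (3 + (i * I.maxDom + a)) = if a ∈ I.dom i then 1 else 0 := by
  have h := RAM.mul_add_lt_mul i.2 ha
  simp only [initState]
  rw [getD_encode, List.getD_append _ _ _ _ (by rw [length_domTable]; exact h), domTable,
    getD_flatMap_const _ _ (by simp) (by simp) ha, getD_range_map _ ha]
  simp

theorem mem_initState_block (I : BinaryCSP n) (es : List (Fin n × Fin n)) {p x : ℕ}
    (hp : p < es.length) (hx : x < 2 + I.maxDom * I.maxDom) :
    (I.initState es).mem ((3 + n * I.maxDom) + (p * (2 + I.maxDom * I.maxDom) + x)) =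
      (I.constraintBlock es[p]).getD x 0 := by
  simp only [initState]
  rw [add_assoc, getD_encode, List.getD_append_right _ _ _ _ (by rw [length_domTable]; omega),
    length_domTable, Nat.add_sub_cancel_left,
    getD_flatMap_const _ _ (fun p _ => I.length_constraintBlock p) hp hx]

theorem getD_constraintBlock (I : BinaryCSP n) (p : Fin n × Fin n) {a c : ℕ} (ha : a < I.maxDom)
    (hc : c < I.maxDom) : (I.constraintBlock p).getD (2 + (a * I.maxDom + c)) 0 =
      if a ∈ I.dom p.1 ∧ c ∈ I.dom p.2 ∧ I.rel p.1 p.2 a c = true then 1 else 0 := by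
  rw [constraintBlock, add_comm]
  show List.getD (List.flatMap _ _) _ _ = _
  rw [getD_flatMap_const _ _ (m := I.maxDom) (by simp) (by simpa using ha) hc, getD_range_map _ hc]
  simp

theorem le_of_mem_encode (I : BinaryCSP n) (es : List (Fin n × Fin n)) {x : ℕ}
    (hx : x ∈ I.encode es) : x ≤ n + I.maxDom + es.length + 1 := by
  simp only [encode, domTable, constraintBlock, List.mem_cons, List.mem_append, List.mem_flatMap,
    List.mem_map] at hx
  rcases hx with rfl | rfl | rfl | ⟨i, -, a, -, rfl⟩ | ⟨p, -, rfl | rfl | ⟨a, -, b, -, rfl⟩⟩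
  · omega
  · omega
  · omega
  · split <;> omega
  · have := p.1.2; omega
  · have := p.2.2; omega
  · split <;> omega

theorem mem_initState_le (I : BinaryCSP n) (es : List (Fin n × Fin n)) (x : ℕ) :
    (I.initState es).mem x ≤ n + I.maxDom + es.length + 1 := by
  simp only [initState]
  by_cases h : x < (I.encode es).length
  · rw [List.getD_eq_getElem _ _ h]
    exact I.le_of_mem_encode es (List.getElem_mem h)
  · rw [List.getD_eq_default _ _ (by omega)]; omega

theorem IsConstraintList.numConstraints {I : BinaryCSP n} {es : List (Fin n × Fin n)}
    (h : I.IsConstraintList es) : I.numConstraints = es.length := by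
  have hset : I.constraintGraph.edgeSet =
      ((es.map fun p => s(p.1, p.2)).toFinset : Set (Sym2 (Fin n))) := by
    ext z
    rw [List.coe_toFinset, ← h.2 z]
    rfl
  rw [BinaryCSP.numConstraints, hset, Set.ncard_coe_finset, List.toFinset_card_of_nodup h.1,
    List.length_map]

theorem IsConstraintList.adj {I : BinaryCSP n} {es : List (Fin n × Fin n)}
    (h : I.IsConstraintList es) {p : ℕ} (hp : p < es.length) :
    I.constraintGraph.Adj es[p].1 es[p].2 :=
  (SimpleGraph.mem_edgeSet _).1 ((h.2 _).1 (List.mem_map_of_mem (List.getElem_mem hp)))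

theorem IsConstraintList.exists_getElem {I : BinaryCSP n} {es : List (Fin n × Fin n)}
    (h : I.IsConstraintList es) {i j : Fin n} (hij : I.constraintGraph.Adj i j) :
    ∃ (p : ℕ) (hp : p < es.length), es[p] = (i, j) ∨ es[p] = (j, i) := by
  obtain ⟨q, hq, hqe⟩ := List.mem_map.1 ((h.2 s(i, j)).2 ((SimpleGraph.mem_edgeSet _).2 hij))
  obtain ⟨p, hp, rfl⟩ := List.getElem_of_mem hq
  refine ⟨p, hp, ?_⟩
  rcases Sym2.eq_iff.1 hqe with ⟨h1, h2⟩ | ⟨h1, h2⟩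
  · exact Or.inl (Prod.ext h1 h2)
  · exact Or.inr (Prod.ext h1 h2)

theorem IsConstraintList.getElem_inj {I : BinaryCSP n} {es : List (Fin n × Fin n)}
    (h : I.IsConstraintList es) {p q : ℕ} (hp : p < es.length) (hq : q < es.length)
    (hpq : s(es[p].1, es[p].2) = s(es[q].1, es[q].2)) : p = q := by
  have hp' : p < (es.map fun p => s(p.1, p.2)).length := by simpa using hp
  have hq' : q < (es.map fun p => s(p.1, p.2)).length := by simpa using hq
  exact (h.1.getElem_inj_iff (hi := hp') (hj := hq')).1 (by simpa using hpq)

/-! ### The oriented network read off from the input. -/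

/-- The bits of the constraints, as they stand in the input. -/
def blocks (I : BinaryCSP n) (es : List (Fin n × Fin n)) (p x : ℕ) : ℕ :=
  (I.initState es).mem ((3 + n * I.maxDom) + (p * (2 + I.maxDom * I.maxDom) + x))

theorem blocks_fst (I : BinaryCSP n) (es : List (Fin n × Fin n)) {p : ℕ} (hp : p < es.length) :
    I.blocks es p 0 = es[p].1 := by
  rw [blocks, mem_initState_block I es hp (by omega)]; rfl

theorem blocks_snd (I : BinaryCSP n) (es : List (Fin n × Fin n)) {p : ℕ} (hp : p < es.length) :
    I.blocks es p 1 = es[p].2 := by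
  rw [blocks, mem_initState_block I es hp (by omega)]; rfl

theorem blocks_bit (I : BinaryCSP n) (es : List (Fin n × Fin n)) {p a c : ℕ} (hp : p < es.length)
    (ha : a < I.maxDom) (hc : c < I.maxDom) : I.blocks es p (2 + (a * I.maxDom + c)) =
      if a ∈ I.dom es[p].1 ∧ c ∈ I.dom es[p].2 ∧ I.rel es[p].1 es[p].2 a c = true then 1 else 0 := by
  have := RAM.mul_add_lt_mul ha hc
  rw [blocks, mem_initState_block I es hp (by omega), getD_constraintBlock I _ ha hc]

/-- The memory layout for an instance. -/
def layout (I : BinaryCSP n) (es : List (Fin n × Fin n)) (L : RAM.Size) : RAM.Layout :=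
  RAM.layout n I.maxDom es.length (I.blocks es) L

/-- Uniqueness holds because the unordered pairs in the list are distinct, while the two
orientations of one constraint differ in their sources. -/
theorem models (I : BinaryCSP n) {es : List (Fin n × Fin n)} (h : I.IsConstraintList es)
    (L : RAM.Size) : I.Models (I.layout es L).net := by
  have hE : (I.layout es L).net.E = 2 * es.length := rfl
  have hlow : ∀ f (hf : f < es.length), (I.layout es L).net.src f = es[f].1 ∧
      (I.layout es L).net.dst f = es[f].2 := by
    intro f hf
    rw [← I.blocks_fst es hf, ← I.blocks_snd es hf]
    exact ⟨if_pos hf, if_pos hf⟩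
  have hhigh : ∀ f (hf : f < es.length), (I.layout es L).net.src (f + es.length) = es[f].2 ∧
      (I.layout es L).net.dst (f + es.length) = es[f].1 := by
    intro f hf
    have h1 : ¬ f + es.length < es.length := by omega
    rw [← I.blocks_fst es hf, ← I.blocks_snd es hf]
    refine ⟨(if_neg h1).trans ?_, (if_neg h1).trans ?_⟩ <;>
    · show I.blocks es (f + es.length - es.length) _ = _
      rw [Nat.add_sub_cancel]
  have hcases : ∀ f < 2 * es.length, ∃ p, p < es.length ∧ (f = p ∨ f = p + es.length) := by
    intro f hf
    by_cases h1 : f < es.length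
    · exact ⟨f, h1, Or.inl rfl⟩
    · exact ⟨f - es.length, by omega, Or.inr (by omega)⟩
  refine ⟨rfl, rfl, ?_, ?_, ?_⟩
  · intro f hf
    obtain ⟨p, hp, rfl | rfl⟩ := hcases f hf
    · refine ⟨es[f].1, es[f].2, (hlow f hp).1, (hlow f hp).2, h.adj hp, fun b hb c hc => ?_⟩
      have hR : (I.layout es L).net.R f b c = decide (I.blocks es f (2 + (b * I.maxDom + c)) = 1) :=
        if_pos hp
      rw [hR, blocks_bit I es hp hb hc]
      simp
    · have h1 : ¬ p + es.length < es.length := by omega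
      refine ⟨es[p].2, es[p].1, (hhigh p hp).1, (hhigh p hp).2, (h.adj hp).symm, fun b hb c hc => ?_⟩
      have hR : (I.layout es L).net.R (p + es.length) b c =
          decide (I.blocks es (p + es.length - es.length) (2 + (c * I.maxDom + b)) = 1) := if_neg h1
      rw [hR, Nat.add_sub_cancel, blocks_bit I es hp hc hb, I.rel_symm _ _ (h.adj hp).1]
      simp only [ite_eq_left_iff, zero_ne_one, imp_false, not_not, decide_eq_true_eq]
      tauto
  · intro i j hij
    obtain ⟨p, hp, hpe | hpe⟩ := h.exists_getElem hij
    · refine ⟨p, by omega, ?_⟩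
      rw [(hlow p hp).1, (hlow p hp).2, hpe]
      exact ⟨rfl, rfl⟩
    · refine ⟨p + es.length, by omega, ?_⟩
      rw [(hhigh p hp).1, (hhigh p hp).2, hpe]
      exact ⟨rfl, rfl⟩
  · intro f hf g hg hs hd
    obtain ⟨p, hp, hfp⟩ := hcases f hf
    obtain ⟨q, hq, hgq⟩ := hcases g hg
    have hpq : p = q := by
      refine h.getElem_inj hp hq (Sym2.eq_iff.2 ?_)
      rcases hfp with rfl | rfl <;> rcases hgq with rfl | rfl <;>
        simp only [hlow _ hp, hlow _ hq, hhigh _ hp, hhigh _ hq, Fin.val_inj] at hs hd <;> tauto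
    subst hpq
    have hne : (es[p].1 : ℕ) ≠ es[p].2 := fun h' => (h.adj hp).1 (Fin.ext h')
    rcases hfp with rfl | rfl <;> rcases hgq with rfl | rfl
    · rfl
    · rw [(hlow _ hp).1, (hhigh _ hp).1] at hs
      exact absurd hs hne
    · rw [(hlow _ hp).1, (hhigh _ hp).1] at hs
      exact absurd hs.symm hne
    · rfl

theorem layout_valid (I : BinaryCSP n) (es : List (Fin n × Fin n)) {L : RAM.Size}
    (hcells : (I.layout es L).base + 33 * (I.layout es L).M ≤ L.cells)
    (hwords : ((I.layout es L).low + (I.layout es L).K) ^ 128 < L.words) :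
    (I.layout es L).Valid := by
  refine ⟨?_, hcells, hwords⟩
  show (n + 2 * es.length) * (I.maxDom + 1) * (I.maxDom + 1) ≤
    32 * (n + 2 * es.length + 1) * (I.maxDom + 1) * (I.maxDom + 1) + 4
  have : (n + 2 * es.length) * (I.maxDom + 1) * (I.maxDom + 1) ≤
    32 * (n + 2 * es.length + 1) * (I.maxDom + 1) * (I.maxDom + 1) :=
    Nat.mul_le_mul_right _ (Nat.mul_le_mul_right _ (by omega))
  omega

theorem appliesCNS (I : BinaryCSP n) {es : List (Fin n × Fin n)} (hnum : I.Numbered)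
    (hac : I.ArcConsistent) (hes : I.IsConstraintList es) {L : RAM.Size} {T : ℕ}
    (hcells : (I.layout es L).base + 33 * (I.layout es L).M ≤ L.cells)
    (hwords : ((I.layout es L).low + (I.layout es L).K) ^ 128 < L.words)
    (hT : 300 * (I.layout es L).K + 300 ≤ T) : AppliesCNS RAM.program I es L T := by
  have hX := I.models hes L
  have hv := I.layout_valid es hcells hwords
  have hbase : (I.layout es L).base =
      (3 + n * I.maxDom) + es.length * (2 + I.maxDom * I.maxDom) := rfl
  have hM : (I.layout es L).M =
      32 * (n + 2 * es.length + 1) * (I.maxDom + 1) * (I.maxDom + 1) + 4 := rfl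
  have hlow : (I.layout es L).low = (I.layout es L).base + 33 * (I.layout es L).M +
      (2 * es.length + 1) * (2 * es.length + 1) + 100 := rfl
  have hMle : n + I.maxDom + es.length + 1 ≤ (I.layout es L).M := by
    have h1 : 1 * (I.maxDom + 1) ≤ (I.maxDom + 1) * (I.maxDom + 1) := Nat.mul_le_mul_right _ (by omega)
    have h2 : (n + 2 * es.length + 1) * 1 ≤ (n + 2 * es.length + 1) * ((I.maxDom + 1) * (I.maxDom + 1)) :=
      Nat.mul_le_mul_left _ (by omega)
    have h3 : 1 * ((I.maxDom + 1) * (I.maxDom + 1)) ≤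
      (n + 2 * es.length + 1) * ((I.maxDom + 1) * (I.maxDom + 1)) := Nat.mul_le_mul_right _ (by omega)
    rw [hM, mul_assoc 32, mul_assoc 32, mul_assoc (n + 2 * es.length + 1)]
    omega
  have hholds : RAM.Holds (I.layout es L) (I.initState es) := by
    refine ⟨fun _ => rfl, rfl, rfl, rfl, fun _ _ _ _ => rfl, fun x hx => ?_, fun x => ?_⟩
    · simp only [initState]
      exact List.getD_eq_default _ _ (by rw [length_encode]; omega)
    · have := I.mem_initState_le es x
      omega
  have hR0 : I.Reduct I fun x y => (I.initState es).mem (3 + (x * I.maxDom + y)) :=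
    ⟨rfl, fun _ => Finset.Subset.refl _, hac, fun i a ha => mem_initState_dom I es i ha⟩
  have hbit : ∀ p < es.length, ∀ x < I.maxDom * I.maxDom, I.blocks es p (2 + x) ≤ 1 := by
    intro p hp x hx
    have hd : 0 < I.maxDom := Nat.pos_of_ne_zero fun h => by simp [h] at hx
    have h1 : x / I.maxDom < I.maxDom := Nat.div_lt_of_lt_mul hx
    have h2 : x % I.maxDom < I.maxDom := Nat.mod_lt _ hd
    have h3 := I.blocks_bit es hp h1 h2
    rw [mul_comm, Nat.div_add_mod] at h3
    rw [h3]
    split <;> omega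
  have hsupp : ∀ f < (I.layout es L).net.E, ∀ b < I.maxDom,
      (I.initState es).mem (3 + ((I.layout es L).net.src f * I.maxDom + b)) = 1 →
      ∃ c < I.maxDom, (I.initState es).mem (3 + ((I.layout es L).net.dst f * I.maxDom + c)) = 1 ∧
        (I.layout es L).net.R f b c = true := by
    intro f hf b hb hA
    obtain ⟨i, j, hi, hj, hadj, hrl⟩ := hX.edge f hf
    rw [hi, mem_initState_dom I es i hb] at hA
    have hbm : b ∈ I.dom i := by by_contra h'; simp [h'] at hA
    obtain ⟨c, hc, hr⟩ := hac i j hadj.1 b hbm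
    have hcd := hR0.lt hnum hc
    refine ⟨c, hcd, ?_, (hrl b hb c hcd).2 ⟨hbm, hc, hr⟩⟩
    rw [hj, mem_initState_dom I es j hcd, if_pos hc]
  obtain ⟨t, σ, s, Z, ht, hex, hrel, hC, h7, h8, hlen⟩ := RAM.run_spec (Λ := I.layout es L)
    (T := I.Trace) rfl hv
    (fun p hp => by rw [I.blocks_fst es hp, I.blocks_snd es hp]; exact ⟨es[p].1.2, es[p].2.2⟩) hholds
    (fun i hi a ha => by rw [mem_initState_dom I es ⟨i, hi⟩ ha]; split <;> omega) hbit hsupp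
    (fun out => ⟨[], I, rfl, hR0, rfl, fun t ht => by simp at ht⟩)
    (fun s j c hC h => hX.trace hnum hC h)
  obtain ⟨l, J, hl, hR, hlenl, hout⟩ := hC.rep
  refine ⟨by rw [length_encode]; omega, t, σ, l, J, by omega, hex, hl,
    fun i b => ⟨hX.not_NS hnum hR hC h7 i b, hX.not_CNS hnum hR hC h7 h8 i b⟩, ?_, ?_, ?_, ?_⟩
  · intro i a ha
    rw [add_assoc, ← hR.alive i a ha]
    exact hrel.alv i i.2 a ha
  · rw [hrel.reg 1 rfl, hlenl]
  · rw [hrel.r0, ← hlenl]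
    omega
  · intro t ht
    rw [hrel.r0, add_assoc ((I.layout es L).base + 32 * (I.layout es L).M),
      hrel.out _ (by omega), hrel.out _ (by omega)]
    exact hout t ht

end BinaryCSP

namespace BinaryCSP

variable {n : ℕ}

/-! ### Bounds -/

theorem maxDom_pos (I : BinaryCSP n) {es : List (Fin n × Fin n)} (hnum : I.Numbered)
    (hes : I.IsConstraintList es) (h : 0 < es.length) : 0 < I.maxDom := by
  obtain ⟨-, a, ha, -⟩ := hes.adj h
  exact lt_of_le_of_lt (Nat.zero_le _) (Finset.mem_range.1 (hnum _ ha))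

theorem length_bound {K e d : ℕ} (hn : n ≤ K * e) (he : 0 < e) (hd : 0 < d) :
    32 * (n + 2 * e + 1) * (d + 1) * (d + 1) + 4 ≤ (128 * (K + 3) + 4) * (e * d ^ 2) := by
  have h1 : n + 2 * e + 1 ≤ (K + 3) * e := by rw [add_mul]; omega
  have h2 : d + 1 ≤ 2 * d := by omega
  have h3 : 1 ≤ e * d ^ 2 := Nat.mul_pos he (Nat.pow_pos hd)
  calc 32 * (n + 2 * e + 1) * (d + 1) * (d + 1) + 4
      ≤ 32 * ((K + 3) * e) * (2 * d) * (2 * d) + 4 * (e * d ^ 2) :=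
        Nat.add_le_add (Nat.mul_le_mul (Nat.mul_le_mul (Nat.mul_le_mul_left _ h1) h2) h2) (by omega)
    _ = _ := by ring

theorem base_bound {K e d : ℕ} (hn : n ≤ K * e) (he : 0 < e) (hd : 0 < d) :
    (3 + n * d) + e * (2 + d * d) ≤ (K + 6) * (e * d ^ 2) := by
  have h3 : 1 ≤ e * d ^ 2 := Nat.mul_pos he (Nat.pow_pos hd)
  have h4 : d ≤ d ^ 2 := Nat.le_self_pow (by omega) d
  have h5 : n * d ≤ K * e * d ^ 2 := Nat.mul_le_mul hn h4
  have h6 : e * 2 ≤ e * (2 * d ^ 2) := Nat.mul_le_mul_left _ (by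
    have : 0 < d ^ 2 := Nat.pow_pos hd
    omega)
  have h7 : e * (2 * d ^ 2) = 2 * (e * d ^ 2) := by ring
  have h8 : K * e * d ^ 2 = K * (e * d ^ 2) := by ring
  have h9 : e * (d * d) = e * d ^ 2 := by ring
  rw [add_mul, mul_add, h9]
  omega

theorem time_bound {K e d : ℕ} (hn : n ≤ K * e) (he : 0 < e) (hd : 0 < d) :
    1024 * (n + 2 * e + 1) * (d + 1) ^ 3 ≤ 8192 * (K + 3) * (e * d ^ 3) := by
  have h1 : n + 2 * e + 1 ≤ (K + 3) * e := by rw [add_mul]; omega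
  have h2 : d + 1 ≤ 2 * d := by omega
  calc 1024 * (n + 2 * e + 1) * (d + 1) ^ 3 ≤ 1024 * ((K + 3) * e) * (2 * d) ^ 3 :=
        Nat.mul_le_mul (Nat.mul_le_mul_left _ h1) (Nat.pow_le_pow_left h2 _)
    _ = _ := by ring

-- All entries of a run are at most `c * (e * d) ^ 3`. The 128th power required by `Layout.Valid`
-- has degree `3 * 128 = 384` in `e * d`, which the exponent `C` absorbs.
set_option exponentiation.threshold 400 in
theorem words_bound {c m C x : ℕ} (hm : 0 < m) (hx : x ≤ c * m ^ 3) (hC : c ^ 128 < C)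
    (hC' : 384 ≤ C) : x ^ 128 < C * m ^ C := by
  calc x ^ 128 ≤ (c * m ^ 3) ^ 128 := Nat.pow_le_pow_left hx _
    _ = c ^ 128 * m ^ 384 := by rw [mul_pow, ← pow_mul]
    _ < C * m ^ 384 := Nat.mul_lt_mul_of_pos_right hC (Nat.pow_pos hm)
    _ ≤ C * m ^ C := Nat.mul_le_mul_left _ (Nat.pow_le_pow_right hm hC')

end BinaryCSP

/-! ### Choice of the machine and of the constants. -/

theorem theorem3 :
    ∃ P : RAM.Program,
      (∀ (n : ℕ) (I : BinaryCSP n) (es : List (Fin n × Fin n)),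
        I.Numbered → I.ArcConsistent → I.IsConstraintList es →
          ∃ (L : RAM.Size) (T : ℕ), BinaryCSP.AppliesCNS P I es L T) ∧
      ∀ K : ℕ, ∃ C : ℕ, ∀ (n : ℕ) (I : BinaryCSP n) (es : List (Fin n × Fin n)),
        I.Numbered → I.ArcConsistent → I.IsConstraintList es →
        0 < n → n ≤ K * I.numConstraints →
          BinaryCSP.AppliesCNS P I es
            { cells := C * (I.numConstraints * I.maxDom ^ 2)
              words := C * (I.numConstraints * I.maxDom) ^ C }
            (C * (I.numConstraints * I.maxDom ^ 3)) := by
  refine ⟨RAM.program, fun n I es hnum hac hes => ?_, fun K => ?_⟩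
  -- The numbers of the layout do not depend on its machine, so any size, here `⟨0, 0⟩`, serves to
  -- compute what the machine must provide.
  · refine ⟨⟨(I.layout es ⟨0, 0⟩).base + 33 * (I.layout es ⟨0, 0⟩).M,
      ((I.layout es ⟨0, 0⟩).low + (I.layout es ⟨0, 0⟩).K) ^ 128 + 1⟩, _,
      I.appliesCNS hnum hac hes le_rfl (Nat.lt_succ_self _) le_rfl⟩
  -- `a` is the constant for the number of cells and `b` the one for the credits. In `c`, which
  -- bounds the entries, `109 = 9 + 100` comes from `(2e + 1)² ≤ 9e²` and from the last summand of
  -- `low`.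
  · obtain ⟨a, ha⟩ : ∃ a, a = (K + 6) + 33 * (128 * (K + 3) + 4) := ⟨_, rfl⟩
    obtain ⟨b, hb⟩ : ∃ b, b = 8192 * (K + 3) := ⟨_, rfl⟩
    obtain ⟨c, hc⟩ : ∃ c, c = a + 109 + b := ⟨_, rfl⟩
    have hcc : c ≤ c ^ 128 := Nat.le_self_pow (by omega) c
    obtain ⟨C, hC⟩ : ∃ C, C = c ^ 128 + 300 * b + 1000 := ⟨_, rfl⟩
    refine ⟨C, fun n I es hnum hac hes hn hnK => ?_⟩
    rw [hes.numConstraints] at hnK ⊢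
    have he : 0 < es.length := by
      by_contra h
      rw [Nat.eq_zero_of_not_pos h, mul_zero] at hnK
      omega
    have hd := I.maxDom_pos hnum hes he
    have h1 := BinaryCSP.length_bound hnK he hd
    have h2 := BinaryCSP.base_bound hnK he hd
    have h3 := BinaryCSP.time_bound hnK he hd
    generalize hL : (⟨C * (es.length * I.maxDom ^ 2), C * (es.length * I.maxDom) ^ C⟩ : RAM.Size) = L
    have hM : (I.layout es L).M =
      32 * (n + 2 * es.length + 1) * (I.maxDom + 1) * (I.maxDom + 1) + 4 := rfl
    have hB : (I.layout es L).base =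
      (3 + n * I.maxDom) + es.length * (2 + I.maxDom * I.maxDom) := rfl
    have hK : (I.layout es L).K = 1024 * (n + 2 * es.length + 1) * (I.maxDom + 1) ^ 3 := rfl
    have hl : (I.layout es L).low = (I.layout es L).base + 33 * (I.layout es L).M +
      (2 * es.length + 1) * (2 * es.length + 1) + 100 := rfl
    rw [← hM] at h1
    rw [← hB] at h2
    rw [← hK, ← hb] at h3
    generalize es.length = e at *
    generalize I.maxDom = d at *
    have h4 : (I.layout es L).base + 33 * (I.layout es L).M ≤ a * (e * d ^ 2) := by
      rw [ha, add_mul, mul_assoc 33]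
      omega
    have hpos : 1 ≤ e * d ^ 3 := Nat.mul_pos he (Nat.pow_pos hd)
    refine I.appliesCNS hnum hac hes (h4.trans ?_) ?_ ?_
    · rw [← hL]
      exact Nat.mul_le_mul_right _ (by omega)
    · have hm : 0 < e * d := Nat.mul_pos he hd
      rw [← hL] at h3 h4 hl ⊢
      refine BinaryCSP.words_bound hm (c := c) ?_ (by omega) (by omega)
      -- The summands of `low + K` have different shapes in `e` and `d`; the cube of `e * d`
      -- dominates all of them.
      have q1 : e * d ^ 2 ≤ (e * d) ^ 3 := by
        rw [mul_pow]
        exact Nat.mul_le_mul (Nat.le_self_pow (by omega) e) (Nat.pow_le_pow_right hd (by omega))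
      have q2 : e * d ^ 3 ≤ (e * d) ^ 3 := by
        rw [mul_pow]
        exact Nat.mul_le_mul_right _ (Nat.le_self_pow (by omega) e)
      have q3 : (2 * e + 1) * (2 * e + 1) ≤ 9 * (e * d) ^ 3 := by
        calc (2 * e + 1) * (2 * e + 1) ≤ (3 * e) * (3 * e) := Nat.mul_le_mul (by omega) (by omega)
          _ = 9 * e ^ 2 := by ring
          _ ≤ 9 * (e * d) ^ 3 := Nat.mul_le_mul_left _
            ((Nat.pow_le_pow_left (Nat.le_mul_of_pos_right _ hd) 2).trans
              (Nat.pow_le_pow_right hm (by omega)))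
      have q4 : 1 ≤ (e * d) ^ 3 := Nat.pow_pos hm
      have q5 := h4.trans (Nat.mul_le_mul_left a q1)
      have q6 := h3.trans (Nat.mul_le_mul_left b q2)
      rw [hl, hc, add_mul, add_mul]
      have q7 : 109 * 1 ≤ 109 * (e * d) ^ 3 := Nat.mul_le_mul_left _ q4
      clear hl hB hM hK h1 h2 h3 h4
      linarith
    · rw [hC, add_mul, add_mul, mul_assoc]
      omega
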